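/- **Theorem 4.2.** Let $n,d\ge 1$ be integers, $N=2n+1$, and let $(c_{ij})$ be the Cartan matrix of type $A_{2n}$. For $1\le i\le 2n$ put $\tau i=N-i$. Write $[x,y]=xy-yx$, $\{x,y\}=xy+yx$ and $\mathrm{Sym}_{k_1,k_2}F(k_1,k_2)=F(k_1,k_2)+F(k_2,k_1)$. Let $\mathbf Y^\imath$ be the twisted Yangian of quasi-split type $\mathrm{AIII}_{2n}^{(\tau)}$, i.e. the $\mathbb C[\hbar]$-algebra generated by $b_{i,r},h_{i,r}$ ($1\le i\le 2n$, $r\ge 0$) subject to the following relations, for all $1\le i,j\le 2n$ and $r,s,k_1,k_2\ge 0$: $$[h_{i,r},h_{j,s}]=0,\qquad h_{\tau i,0}=-h_{i,0},\qquad [h_{i,0},b_{j,r}]=(c_{ij}-c_{\tau i,j})b_{j,r},$$ $$[h_{i,1},b_{j,r}]=(c_{ij}+c_{\tau i,j})b_{j,r+1}+\tfrac{\hbar(c_{ij}-c_{\tau i,j})}{2}\{h_{i,0},b_{j,r}\},$$ $$[h_{i,r+2},b_{j,s}]-[h_{i,r},b_{j,s+2}]=\tfrac{c_{ij}-c_{\tau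 i,j}}{2}\hbar\{h_{i,r+1},b_{j,s}\}+\tfrac{c_{ij}+c_{\tau i,j}}{2}\hbar\{h_{i,r},b_{j,s+1}\}+\tfrac{c_{ij}c_{\tau i,j}}{4}\hbar^2[h_{i,r},b_{j,s}],$$ $$[b_{i,r+1},b_{j,s}]-[b_{i,r},b_{j,s+1}]=\tfrac{c_{ij}}{2}\hbar\{b_{i,r},b_{j,s}\}-2\delta_{\tau i,j}(-1)^rh_{j,r+s+1},$$ $$[b_{i,r},b_{j,s}]=\delta_{\tau i,j}(-1)^rh_{j,r+s}\quad\text{if }c_{ij}=0,$$ $$\mathrm{Sym}_{k_1,k_2}[b_{i,k_1},[b_{i,k_2},b_{j,r}]]=0\quad\text{if }c_{ij}=-1,\ j\ne\tau i,$$ $$\mathrm{Sym}_{k_1,k_2}[b_{i,k_1},[b_{i,k_2},b_{\tau i,r}]]=\tfrac43\,\mathrm{Sym}_{k_1,k_2}(-1)^{k_1}\sum_{p=0}^{k_1+r}3^{-p}[b_{i,k_2+p},h_{\tau i,k_1+r-p}]\quad\text{if }c_{i,\tau i}=-1.$$ Let $\Lambda_{\mathfrak c,d}$ be the set of $\mathbf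 v=(v_1,\dots,v_N)\in\mathbb N^N$ with $v_l=v_{N+1-l}$ and $\sum_l v_l=2d$. For such $\mathbf v$ let $[\mathbf v]=([\mathbf v]_1,\dots,[\mathbf v]_N)$ be the partition of $\{1,\dots,2d\}$ into consecutive intervals of sizes $v_1,\dots,v_N$ (a block may be empty). Put $r'=2d+1-r$ for $1\le r\le 2d$. Let $\mathbf R=\mathbb C[x_1,\dots,x_d]$ and set $x_{r}=-x_{r'}$ for $d<r\le 2d$. The Weyl group $W_{\mathfrak c}=\mathbb Z_2^d\rtimes S_d$ of type $C_d$ is the group of permutations $w$ of $\{1,\dots,2d\}$ with $w(r')=w(r)'$ for all $r$; it acts on $\mathbf R$ by $x_r\mapsto x_{w(r)}$. Let $W_{[\mathbf v]^{\mathfrak c}}\subset W_{\mathfrak c}$ be the subgroup preserving every block of $[\mathbf v]$; it is $S_{v_1}\times\dots\times S_{v_n}\times(\mathbb Z_2^m\rtimes S_m)$ with $m=v_{n+1}/2$. Let $$\mathbf P=\bigoplus_{\mathbf v\in\Lambda_{\mathfrak c,d}}\mathbf R^{W_{[\mathbf v]^{\mathfrak c}}}[\hbar].$$ For a partition $I=(I_1,\dots,I_N)$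 of $\{1,\dots,2d\}$ such that $r\in I_l$ if and only if $r'\in I_{N+1-l}$, and for $f\in\mathbf P$, let $f(x_I)$ be the polynomial obtained from the component of $f$ indexed by $\mathbf v'=(|I_1|,\dots,|I_N|)$ by substituting for $x_1,\dots,x_d$ the first $d$ entries of the list of the $x_r$ ordered block by block ($I_1$ first) and by increasing $r$ inside each block. For $j\in I_i$ with $1\le i\le 2n$, let $\tau_j^+I$ be the partition obtained by moving $j$ from $I_i$ to $I_{i+1}$ and $j'$ from $I_{\tau i+1}$ to $I_{\tau i}$. Put $\varphi(z)=1+\hbar/z$ and $\Phi_J(z)=\prod_{s\in J}\varphi(x_s-z)$ for $J\subset\{1,\dots,2d\}$. For $1\le i\le 2n$ and $r\ge0$ define $B_{i,r}$ by giving the component of $B_{i,r}f$ indexed by $\mathbf v$ as $$\sqrt{-1}\sum_{j\in[\mathbf v]_i}\Big(-x_j-\tfrac{n-i}{2}\hbar-\tfrac{\hbar}{4}\Big)^r\,\Phi_{[\mathbf v]_i\setminus\{j\}}(x_j)\,f(x_{\tau_j^+[\mathbf v]}),$$ and let $H_{i,r}$ multiply the component indexed by $\mathbf v$ by the coefficient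 of $\hbar u^{-r-1}$ in the expansion in powers of $u^{-1}$ of $$H_{i,\mathbf v}(u)=\Big(1-\tfrac{\delta_{i,n}-\delta_{i,n+1}}{4u}\hbar\Big)\,\Phi_{[\mathbf v]_i}\Big(-u-\tfrac{n-i}{2}\hbar-\tfrac{\hbar}{4}\Big)\,\Phi_{[\mathbf v]_{\tau i}}\Big(u+\tfrac{n-i}{2}\hbar+\tfrac{\hbar}{4}\Big).$$ Then these a priori rational expressions are elements of $\mathbf R^{W_{[\mathbf v]^{\mathfrak c}}}[\hbar]$, so that $B_{i,r}$ and $H_{i,r}$ are well-defined $\mathbb C[\hbar]$-linear operators on $\mathbf P$, and there is a unique homomorphism of $\mathbb C[\hbar]$-algebras $\mathbf Y^\imath\to\mathrm{End}_{\mathbb C[\hbar]}(\mathbf P)$ with $b_{i,r}\mapsto B_{i,r}$ and $h_{i,r}\mapsto H_{i,r}$ for all $1\le i\le 2n$, $r\ge0$. In other words, this assignment defines a representation of $\mathbf Y^\imath$ on $\mathbf P$ (the polynomial representation). -/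

import Mathlib

open Polynomial

noncomputable section

namespace TwistedYangian

/-! Conventions.  The base ring `ℂ[ħ]` is `ℂ[X]`, with `ħ = X`.  The sets `{1, …, 2n}`,
`{1, …, N}` (`N = 2n + 1`) and `{1, …, 2d}` are `Fin (2 * n)`, `Fin (2 * n + 1)` and
`Fin (2 * d)`, so the element `k` of `Fin m` stands for the number `k + 1`.  Thus `Fin.rev` is
`τ i = N - i` on `{1, …, 2n}`, it is `l ↦ N + 1 - l` on `{1, …, N}` and it is
`r ↦ r' = 2d + 1 - r` on `{1, …, 2d}`.  For `i` in `{1, …, 2n}` the elements `i` and `i + 1` of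
`{1, …, N}` are `i.castSucc` and `i.succ`. -/

/-! ### The twisted Yangian -/

/-- The generators `b_{i,r}` and `h_{i,r}`, for `1 ≤ i ≤ 2n` and `r ≥ 0`. -/
inductive Gen (n : ℕ) : Type
  | b (i : Fin (2 * n)) (r : ℕ) : Gen n
  | h (i : Fin (2 * n)) (r : ℕ) : Gen n

/-- The free `ℂ[ħ]`-algebra on the generators. -/
abbrev Free (n : ℕ) : Type := FreeAlgebra ℂ[X] (Gen n)

/-- The generator `b_{i,r}` of the free algebra. -/
def fb {n : ℕ} (i : Fin (2 * n)) (r : ℕ) : Free n := FreeAlgebra.ι ℂ[X] (Gen.b i r)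

/-- The generator `h_{i,r}` of the free algebra. -/
def fh {n : ℕ} (i : Fin (2 * n)) (r : ℕ) : Free n := FreeAlgebra.ι ℂ[X] (Gen.h i r)

/-- The commutator `[x, y] = xy - yx`. -/
def comm {A : Type*} [Ring A] (x y : A) : A := x * y - y * x

/-- The anticommutator `{x, y} = xy + yx`. -/
def anti {A : Type*} [Ring A] (x y : A) : A := x * y + y * x

/-- The entry `c_{ij}` of the Cartan matrix of type `A_{2n}`, as a complex number. -/
def cartan {n : ℕ} (i j : Fin (2 * n)) : ℂ := (CartanMatrix.A (2 * n) i j : ℂ)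

/-- The symmetrization `Sym_{k₁,k₂} F(k₁, k₂) = F(k₁, k₂) + F(k₂, k₁)`. -/
def sym {A : Type*} [Ring A] (F : ℕ → ℕ → A) (k₁ k₂ : ℕ) : A := F k₁ k₂ + F k₂ k₁

/-- The defining relations of the twisted Yangian of quasi-split type `AIII_{2n}^{(τ)}`, in the
Drinfeld presentation. -/
inductive Rel (n : ℕ) : Free n → Free n → Prop
  | hh (i j : Fin (2 * n)) (r s : ℕ) : Rel n (comm (fh i r) (fh j s)) 0
  | h_tau (i : Fin (2 * n)) : Rel n (fh i.rev 0) (-fh i 0)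
  | h_zero_b (i j : Fin (2 * n)) (r : ℕ) :
      Rel n (comm (fh i 0) (fb j r)) (C (cartan i j - cartan i.rev j) • fb j r)
  | h_one_b (i j : Fin (2 * n)) (r : ℕ) :
      Rel n (comm (fh i 1) (fb j r))
        (C (cartan i j + cartan i.rev j) • fb j (r + 1)
          + (C ((cartan i j - cartan i.rev j) / 2) * X) • anti (fh i 0) (fb j r))
  | h_b (i j : Fin (2 * n)) (r s : ℕ) :
      Rel n (comm (fh i (r + 2)) (fb j s) - comm (fh i r) (fb j (s + 2)))
        ((C ((cartan i j - cartan i.rev j) / 2) * X) • anti (fh i (r + 1)) (fb j s)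
          + (C ((cartan i j + cartan i.rev j) / 2) * X) • anti (fh i r) (fb j (s + 1))
          + (C (cartan i j * cartan i.rev j / 4) * X ^ 2) • comm (fh i r) (fb j s))
  | b_b (i j : Fin (2 * n)) (r s : ℕ) :
      Rel n (comm (fb i (r + 1)) (fb j s) - comm (fb i r) (fb j (s + 1)))
        ((C (cartan i j / 2) * X) • anti (fb i r) (fb j s)
          - (if i.rev = j then (2 * (-1) ^ r : ℂ[X]) • fh j (r + s + 1) else 0))
  | serre_zero (i j : Fin (2 * n)) (r s : ℕ) (hc : cartan i j = 0) :
      Rel n (comm (fb i r) (fb j s))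
        (if i.rev = j then ((-1) ^ r : ℂ[X]) • fh j (r + s) else 0)
  | serre_neg_one (i j : Fin (2 * n)) (k₁ k₂ r : ℕ) (hc : cartan i j = -1) (hj : j ≠ i.rev) :
      Rel n (sym (fun k l => comm (fb i k) (comm (fb i l) (fb j r))) k₁ k₂) 0
  | serre_tau (i : Fin (2 * n)) (k₁ k₂ r : ℕ) (hc : cartan i i.rev = -1) :
      Rel n (sym (fun k l => comm (fb i k) (comm (fb i l) (fb i.rev r))) k₁ k₂)
        ((C (4 / 3 : ℂ)) • sym (fun k l => ((-1) ^ k : ℂ[X]) •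
          ∑ p ∈ Finset.range (k + r + 1),
            C (((3 : ℂ) ^ p)⁻¹) • comm (fb i (l + p)) (fh i.rev (k + r - p))) k₁ k₂)

/-- The twisted Yangian `Y^ı` of quasi-split type `AIII_{2n}^{(τ)}`, a `ℂ[ħ]`-algebra. -/
abbrev Y (n : ℕ) : Type := RingQuot (Rel n)

/-- The generator `b_{i,r}` of `Y^ı`. -/
def Y.b {n : ℕ} (i : Fin (2 * n)) (r : ℕ) : Y n := RingQuot.mkAlgHom ℂ[X] (Rel n) (fb i r)

/-- The generator `h_{i,r}` of `Y^ı`. -/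
def Y.h {n : ℕ} (i : Fin (2 * n)) (r : ℕ) : Y n := RingQuot.mkAlgHom ℂ[X] (Rel n) (fh i r)

/-! ### Compositions and partitions -/

/-- The set `Λ_{c,d}` of symmetric compositions of `2d` with `N = 2n + 1` parts. -/
@[ext]
structure Lam (n d : ℕ) : Type where
  val : Fin (2 * n + 1) → ℕ
  symm : ∀ l, val l = val l.rev
  sum_eq : ∑ l, val l = 2 * d

/-- A partition `I = (I_1, …, I_N)` of `{1, …, 2d}` with `r ∈ I_l` if and only if
`r' ∈ I_{N+1-l}`, given by the function that sends `r` to the index of its block. -/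
@[ext]
structure SymPart (n d : ℕ) : Type where
  val : Fin (2 * d) → Fin (2 * n + 1)
  symm : ∀ r, val r.rev = (val r).rev

/-- The block `I_l` of a partition. -/
def SymPart.block {n d : ℕ} (I : SymPart n d) (l : Fin (2 * n + 1)) : Finset (Fin (2 * d)) :=
  Finset.univ.filter fun r => I.val r = l

/-- The composition formed by the block sizes of a partition. -/
def SymPart.shape {n d : ℕ} (I : SymPart n d) : Lam n d :=
  ⟨fun l => (I.block l).card,
    by
      intro l
      refine Finset.card_bij (fun r _ => r.rev) ?_ ?_ ?_
      · intro r hr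
        simp only [SymPart.block, Finset.mem_filter, Finset.mem_univ, true_and] at hr ⊢
        rw [I.symm, hr]
      · intro a _ b _ h
        exact Fin.rev_injective h
      · intro r hr
        simp only [SymPart.block, Finset.mem_filter, Finset.mem_univ, true_and] at hr
        refine ⟨r.rev, ?_, Fin.rev_rev r⟩
        simp only [SymPart.block, Finset.mem_filter, Finset.mem_univ, true_and]
        rw [I.symm, hr, Fin.rev_rev],
    by
      have h := Finset.card_eq_sum_card_fiberwise (s := (Finset.univ : Finset (Fin (2 * d))))
        (t := (Finset.univ : Finset (Fin (2 * n + 1)))) (f := I.val) (by simp [Set.MapsTo])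
      simpa [SymPart.block] using h.symm⟩

/-- The index of the block of `[v]` that contains `r`: it is one plus the number of
`1 ≤ i ≤ 2n` such that `v_1 + ⋯ + v_i < r`. -/
def label {n d : ℕ} (v : Lam n d) (r : Fin (2 * d)) : Fin (2 * n + 1) :=
  ⟨(Finset.univ.filter fun i : Fin (2 * n) =>
      ∑ l ∈ Finset.Iic i.castSucc, v.val l ≤ (r : ℕ)).card,
    Nat.lt_succ_of_le ((Finset.card_le_univ _).trans (by simp))⟩

theorem label_eq_iff {n d : ℕ} (v : Lam n d) (r : Fin (2 * d)) (l : Fin (2 * n + 1)) :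
    label v r = l ↔
      ∑ j ∈ Finset.Iio l, v.val j ≤ (r : ℕ) ∧ (r : ℕ) < ∑ j ∈ Finset.Iic l, v.val j := by
  have key : ∀ l : Fin (2 * n + 1), (∑ j ∈ Finset.Iio l, v.val j ≤ (r : ℕ) ∧
      (r : ℕ) < ∑ j ∈ Finset.Iic l, v.val j) → label v r = l := by
    intro l ⟨h1, h2⟩
    apply Fin.ext
    have hset : (Finset.univ.filter fun i : Fin (2 * n) =>
        ∑ j ∈ Finset.Iic i.castSucc, v.val j ≤ (r : ℕ))
        = Finset.univ.filter fun i : Fin (2 * n) => (i : ℕ) < (l : ℕ) := by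
      ext i
      simp only [Finset.mem_filter, Finset.mem_univ, true_and]
      constructor
      · intro h
        by_contra hc
        have hle : ∑ j ∈ Finset.Iic l, v.val j ≤ ∑ j ∈ Finset.Iic i.castSucc, v.val j := by
          apply Finset.sum_le_sum_of_subset
          apply Finset.Iic_subset_Iic.2
          rw [Fin.le_def]
          simpa using hc
        omega
      · intro h
        refine le_trans (Finset.sum_le_sum_of_subset ?_) h1
        intro j hj
        rw [Finset.mem_Iic, Fin.le_def] at hj
        rw [Finset.mem_Iio, Fin.lt_def]
        simp only [Fin.val_castSucc] at hj
        omega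
    change (Finset.univ.filter fun i : Fin (2 * n) =>
        ∑ j ∈ Finset.Iic i.castSucc, v.val j ≤ (r : ℕ)).card = (l : ℕ)
    rw [hset, Fin.card_filter_val_lt]
    omega
  constructor
  · intro h
    have hex : ∃ m : Fin (2 * n + 1), (r : ℕ) < ∑ j ∈ Finset.Iic m, v.val j := by
      refine ⟨Fin.last _, ?_⟩
      have : Finset.Iic (Fin.last (2 * n)) = Finset.univ := by
        ext j; simp [Fin.le_last]
      rw [this, v.sum_eq]
      exact r.2
    classical
    obtain ⟨m, hm, hmin⟩ := WellFounded.has_min (wellFounded_lt (α := Fin (2 * n + 1)))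
      {m | (r : ℕ) < ∑ j ∈ Finset.Iic m, v.val j} hex
    have h3 : ∑ j ∈ Finset.Iio m, v.val j ≤ (r : ℕ) := by
      rcases Fin.eq_zero_or_eq_succ m with h0 | ⟨k, hk⟩
      · subst h0
        have h4 : Finset.Iio (0 : Fin (2 * n + 1)) = ∅ := by
          ext j
          simp only [Finset.mem_Iio, Fin.lt_def, Finset.notMem_empty, iff_false]
          exact Nat.not_lt_zero _
        rw [h4, Finset.sum_empty]
        exact Nat.zero_le _
      · subst hk
        have hk2 : Finset.Iio k.succ = Finset.Iic k.castSucc := by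
          ext j
          simp only [Finset.mem_Iio, Finset.mem_Iic, Fin.lt_def, Fin.le_def, Fin.val_succ,
            Fin.val_castSucc]
          omega
        rw [hk2]
        by_contra hc
        exact hmin k.castSucc (not_le.1 hc) Fin.castSucc_lt_succ
    have := key m ⟨h3, hm⟩
    rw [← h, this]
    exact ⟨h3, hm⟩
  · exact key l

/-- The partition `[v]` of `{1, …, 2d}` into the consecutive intervals
`[v]_l = [1 + v_1 + ⋯ + v_{l-1}, v_1 + ⋯ + v_l]`. -/
def std {n d : ℕ} (v : Lam n d) : SymPart n d :=
  ⟨label v, by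
    intro r
    have h := (label_eq_iff v r (label v r)).1 rfl
    have e1 : ∑ j ∈ Finset.Iio (label v r).rev, v.val j = ∑ j ∈ Finset.Ioi (label v r), v.val j := by
      refine Finset.sum_bij (fun j _ => j.rev) ?_ ?_ ?_ ?_
      · intro j hj
        rw [Finset.mem_Iio] at hj
        rw [Finset.mem_Ioi]
        exact Fin.lt_rev_iff.1 hj
      · intro a _ b _ hab
        exact Fin.rev_injective hab
      · intro j hj
        rw [Finset.mem_Ioi] at hj
        exact ⟨j.rev, by rw [Finset.mem_Iio]; exact Fin.rev_lt_rev.2 hj, Fin.rev_rev j⟩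
      · intro j _
        exact v.symm j
    have e2 : ∑ j ∈ Finset.Iic (label v r), v.val j + ∑ j ∈ Finset.Ioi (label v r), v.val j
        = 2 * d := by
      refine Eq.trans ?_ v.sum_eq
      rw [← Finset.sum_add_sum_compl (Finset.Iic (label v r))]
      congr 2
      ext j
      simp
    have e3 : ∀ l : Fin (2 * n + 1),
        ∑ j ∈ Finset.Iic l, v.val j = ∑ j ∈ Finset.Iio l, v.val j + v.val l := by
      intro l
      rw [← Finset.Iio_insert l, Finset.sum_insert (by simp), add_comm]
    have e4 := e3 (label v r)
    have e5 := e3 (label v r).rev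
    rw [← v.symm] at e5
    have hr : ((r.rev : Fin (2 * d)) : ℕ) = 2 * d - (r + 1) := Fin.val_rev r
    have hr2 := r.2
    apply (label_eq_iff v r.rev (label v r).rev).2
    rw [hr]
    omega⟩

/-- For `r ∈ I_i`, the partition `τ_r^+ I`, obtained from `I` by shifting `r` from `I_i` to
`I_{i+1}` and `r'` from `I_{τ i + 1}` to `I_{τ i}`. -/
def shift {n d : ℕ} (i : Fin (2 * n)) (r : Fin (2 * d)) (I : SymPart n d) : SymPart n d :=
  ⟨fun s => if s = r then i.succ else if s = r.rev then i.rev.castSucc else I.val s, by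
    have hne : r.rev ≠ r := by
      intro h
      have h1 := congrArg Fin.val h
      rw [Fin.val_rev] at h1
      omega
    intro s
    by_cases h1 : s = r
    · subst h1
      simp [hne, Fin.rev_succ]
    · by_cases h2 : s = r.rev
      · subst h2
        simp [hne, Fin.rev_castSucc]
      · have h3 : s.rev ≠ r := fun h => h2 (by rw [← h, Fin.rev_rev])
        have h4 : s.rev ≠ r.rev := fun h => h1 (Fin.rev_injective h)
        simp [h1, h2, h3, h4, I.symm]⟩

/-! ### Invariant polynomials -/

/-- The ring `R[ħ] = ℂ[ħ][x_1, …, x_d]`. -/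
abbrev Rh (d : ℕ) : Type := MvPolynomial (Fin d) ℂ[X]

/-- The elements `x_1, …, x_{2d}` of `R`, where `x_r = -x_{r'}`. -/
def xvar {d : ℕ} (r : Fin (2 * d)) : Rh d :=
  if h : (r : ℕ) < d then MvPolynomial.X ⟨r, h⟩
  else -MvPolynomial.X ⟨2 * d - 1 - (r : ℕ), by omega⟩

/-- The substitution `f(x_1, …, x_d) ↦ f(x_{σ(1)}, …, x_{σ(d)})`, for a permutation `σ` of
`{1, …, 2d}`. -/
def subst {d : ℕ} (σ : Equiv.Perm (Fin (2 * d))) : Rh d →ₐ[ℂ[X]] Rh d :=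
  MvPolynomial.aeval fun k : Fin d => xvar (σ (Fin.castLE (by omega) k))

/-- The Weyl group `W_c` of type `C_d`, acting on `{1, …, 2d}`: the permutations `w` such that
`w(r') = w(r)'` for all `r`. -/
def weyl (d : ℕ) : Subgroup (Equiv.Perm (Fin (2 * d))) where
  carrier := {w | ∀ r, w r.rev = (w r).rev}
  mul_mem' := by
    intro a b ha hb r
    rw [Equiv.Perm.mul_apply, Equiv.Perm.mul_apply, hb, ha]
  one_mem' := fun _ => rfl
  inv_mem' := by
    intro a ha r
    rw [Equiv.Perm.inv_eq_iff_eq, ha]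
    simp

/-- The subgroup `W_{[v]^c} = S_{[v]_1} × ⋯ × S_{[v]_n} × (ℤ₂^m ⋊ S_m)` of `W_c`, with
`m = v_{n+1} / 2`: the elements of `W_c` that map each block of `[v]` to itself. (On the blocks
`[v]_1, …, [v]_n` such an element is an arbitrary permutation, on the blocks
`[v]_{n+2}, …, [v]_N` it is determined by this, and on `[v]_{n+1}` it is an arbitrary permutation
that commutes with `r ↦ r'`.) -/
def weylSub {n d : ℕ} (v : Lam n d) : Subgroup (Equiv.Perm (Fin (2 * d))) where
  carrier := {w | w ∈ weyl d ∧ ∀ r, label v (w r) = label v r}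
  mul_mem' := by
    intro a b ha hb
    refine ⟨mul_mem ha.1 hb.1, fun r => ?_⟩
    rw [Equiv.Perm.mul_apply, ha.2, hb.2]
  one_mem' := ⟨one_mem _, fun _ => rfl⟩
  inv_mem' := by
    intro a ha
    refine ⟨inv_mem ha.1, fun r => ?_⟩
    rw [← ha.2 (a⁻¹ r)]
    simp

/-- The ring `R^{[v]^c}[ħ]` of invariants of `W_{[v]^c}` in `R[ħ]`. -/
def invariants {n d : ℕ} (v : Lam n d) : Subalgebra ℂ[X] (Rh d) where
  carrier := {f | ∀ w ∈ weylSub v, subst w f = f}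
  mul_mem' := by
    intro a b ha hb w hw
    rw [map_mul, ha w hw, hb w hw]
  add_mem' := by
    intro a b ha hb w hw
    rw [map_add, ha w hw, hb w hw]
  algebraMap_mem' := by
    intro c w _
    exact (subst w).commutes c

/-- The `ℂ[ħ]`-module `P = ⨁_v R^{[v]^c}[ħ]`. -/
abbrev P (n d : ℕ) : Type := DirectSum (Lam n d) fun v => invariants v

/-- The polynomial `f(x_I)`, for a partition `I` with block sizes `v` and `f` in the summand of
`v`: the variables of `f` are replaced by the `x_r`, listed block by block, in increasing order
of `r` inside each block. -/
def evalAt {n d : ℕ} (I : SymPart n d) (f : P n d) : Rh d :=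
  subst (Tuple.sort I.val) (f I.shape : Rh d)

/-! ### The operators -/

/-- The function `φ(z) = 1 + ħ / z`. -/
def phi {L : Type*} [Field L] (h z : L) : L := 1 + h / z

/-- The product `Φ_I(z) = ∏_{s ∈ I} φ(x_s - z)`. -/
def Phi {L : Type*} [Field L] {d : ℕ} (h : L) (x : Fin (2 * d) → L) (I : Finset (Fin (2 * d)))
    (z : L) : L :=
  ∏ s ∈ I, phi h (x s - z)

/-- The shift `(n - i) ħ / 2 + ħ / 4`. -/
def hshift {L : Type*} [Field L] {n : ℕ} (h : L) (i : Fin (2 * n)) : L :=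
  ((n : L) - ((i : ℕ) + 1 : L)) / 2 * h + h / 4

/-- The fraction field of `R[ħ]`. -/
abbrev Kh (d : ℕ) : Type := FractionRing (Rh d)

/-- The inclusion of `R[ħ]` into its fraction field. -/
def toK (d : ℕ) : Rh d →+* Kh d := algebraMap (Rh d) (Kh d)

/-- The element `ħ` of the fraction field. -/
def hK (d : ℕ) : Kh d := toK d (MvPolynomial.C X)

/-- The right-hand side of the formula for `B_{i,r} f` on the summand of `v`,
`√-1 ∑_{j ∈ [v]_i} (-x_j - (n-i)ħ/2 - ħ/4)^r Φ_{[v]_i ∖ {j}}(x_j) f(x_{τ_j^+ [v]})`,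
in the fraction field. -/
def bFormula {n d : ℕ} (i : Fin (2 * n)) (r : ℕ) (f : P n d) (v : Lam n d) : Kh d :=
  toK d (MvPolynomial.C (C Complex.I)) *
    ∑ j ∈ (std v).block i.castSucc,
      (-toK d (xvar j) - hshift (hK d) i) ^ r *
        Phi (hK d) (fun s => toK d (xvar s)) ((std v).block i.castSucc \ {j}) (toK d (xvar j)) *
        toK d (evalAt (shift i j (std v)) f)

/-- The field of formal Laurent series in `u⁻¹` over the fraction field; the exponents of
`LaurentSeries` are those of `u⁻¹`. -/
abbrev Ku (d : ℕ) : Type := LaurentSeries (Kh d)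

/-- The constants in the field of Laurent series in `u⁻¹`. -/
def toKu (d : ℕ) : Kh d →+* Ku d := HahnSeries.C

/-- The element `u` of the field of Laurent series in `u⁻¹`. -/
def uvar (d : ℕ) : Ku d := HahnSeries.single (-1) 1

/-- The element `ħ` of the field of Laurent series in `u⁻¹`. -/
def hKu (d : ℕ) : Ku d := toKu d (hK d)

/-- The difference `δ_{i,n} - δ_{i,n+1}`. -/
def deltaSign {L : Type*} [Field L] {n : ℕ} (i : Fin (2 * n)) : L :=
  (if (i : ℕ) + 1 = n then 1 else 0) - (if (i : ℕ) + 1 = n + 1 then 1 else 0)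

/-- The rational function
`H_{i,v}(u) = (1 - (δ_{i,n} - δ_{i,n+1}) ħ / (4u)) Φ_{[v]_i}(-u - (n-i)ħ/2 - ħ/4)
Φ_{[v]_{τ i}}(u + (n-i)ħ/2 + ħ/4)`, as a series in `u⁻¹`. -/
def hSeries {n d : ℕ} (i : Fin (2 * n)) (v : Lam n d) : Ku d :=
  (1 - deltaSign i / (4 * uvar d) * hKu d) *
    Phi (hKu d) (fun s => toKu d (toK d (xvar s))) ((std v).block i.castSucc)
      (-uvar d - hshift (hKu d) i) *
    Phi (hKu d) (fun s => toKu d (toK d (xvar s))) ((std v).block i.rev.castSucc)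
      (uvar d + hshift (hKu d) i)

/-- The coefficient of `ħ u^{-r-1}` in `H_{i,v}(u)`. -/
def hCoeff {n d : ℕ} (i : Fin (2 * n)) (r : ℕ) (v : Lam n d) : Kh d :=
  (hSeries i v).coeff ((r : ℤ) + 1) / hK d

/-- The operator `B` on `P` is `B_{i,r}`. -/
def IsB {n d : ℕ} (i : Fin (2 * n)) (r : ℕ) (B : Module.End ℂ[X] (P n d)) : Prop :=
  ∀ (f : P n d) (v : Lam n d), toK d (B f v : Rh d) = bFormula i r f v

/-- The operator `H` on `P` is `H_{i,r}`: on the summand of `v` it is multiplication by the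
coefficient of `ħ u^{-r-1}` in `H_{i,v}(u)`. -/
def IsH {n d : ℕ} (i : Fin (2 * n)) (r : ℕ) (H : Module.End ℂ[X] (P n d)) : Prop :=
  ∀ (f : P n d) (v : Lam n d), toK d (H f v : Rh d) = hCoeff i r v * toK d (f v : Rh d)

end TwistedYangian

end

/-! The relations are checked on a larger and simpler space: all functions of symmetric partitions
`I` with values in the fraction field of `R[ħ]`. An element `f` of `P` gives the function `I ↦
f(x_I)`. The map `evalP` is injective, since the standard partitions recover the components, and its
image consists of the functions that have polynomial values and are compatible with the Weyl group
(`exists_evalP_eq`). So it suffices that the operators preserve this image and satisfy the relations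
on the large space.

On the large space `B_{i,r}` is `√-1 ∑_k spec(i,k)^r e_{i,k}`, where `e_{i,k} = move h x i k` moves
the single letter `k`, and `H_{i,r}` is diagonal. Three facts carry the relations. Two letter moves
satisfy a quadratic exchange relation with parameter `c_{ij}` unless `l = k'` and `j = τ i`
(`move_comm`). In that exceptional case both products `e_{i,k} e_{τi,k'}` and `e_{τi,k'} e_{i,k}`
are diagonal, and the defect of the exchange relation is a residue of `H_i(u)`
(`move_mul_move_rev_comm`); partial fractions sum these residues to coefficients of `H_{τi}(u)`.
Finally, moving one letter multiplies `H_i(u)` by an explicit ratio of quadratics in `u`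
(`hSer_shift`), and its coefficients are the relations between `h` and `b`.

The ordinary Serre relation is a formal consequence of the exchange relations. In the exceptional
one only the letters `l = k'` and `l = m'` contribute. Each contribution is a residue of `u H(u) /
((u - α)(u - β))`, while the difference of the values of `H(u)` before and after the move equals `ħ
(3u - s) H(u) / ((u - α)(u - β))`, with `H(u)` on the right taken at one of the two partitions.
Dividing by `3u - s` expands into the powers of `1/3` in the relation (`sum_pow_mul_coeff_sub`,
`sum_halfSerre`).

Integrality of `H_{i,r}` holds because every factor of its series is congruent to 1 modulo `ħ u⁻¹`
(`hPow_eq_one_add`). A single summand of `B_{i,r} f` has simple poles along the hyperplanes `x_a =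
x_b` with `a`, `b` in one block. The whole sum is invariant under the reflection in such a
hyperplane, and an invariant function cannot have a simple pole there (`mem_localAt_of_reflection`,
`bOp_mem`). -/

open Polynomial

noncomputable section

namespace TwistedYangian

/-! ### Laurent series in `u⁻¹` -/

section Laurent

variable {L : Type*} [Field L]

/-- The element `u` of the field of Laurent series in `u⁻¹` over a field. -/
def lu (L : Type*) [Field L] : LaurentSeries L := HahnSeries.single (-1) 1

theorem coeff_lu_mul (F : LaurentSeries L) (k : ℤ) : (lu L * F).coeff k = F.coeff (k + 1) := by
  have := HahnSeries.coeff_single_mul_add (Γ := ℤ) (R := L) (r := 1) (x := F) (a := k + 1) (b := -1)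
  rw [lu]
  simpa using this

theorem coeff_C_mul (a : L) (F : LaurentSeries L) (k : ℤ) :
    (HahnSeries.C a * F).coeff k = a * F.coeff k := by
  rw [HahnSeries.C_mul_eq_smul]; simp

theorem lu_ne_zero : lu L ≠ 0 := by
  rw [lu]; exact HahnSeries.single_ne_zero one_ne_zero

theorem lu_sub_C_ne_zero (a : L) : lu L - HahnSeries.C a ≠ 0 := by
  intro h
  have := congrArg (fun F : LaurentSeries L => F.coeff (-1)) h
  simp [lu, HahnSeries.C_apply] at this

/-- The geometric series `∑ a^k u^{-k-1}`. -/
def geom (a : L) : LaurentSeries L :=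
  HahnSeries.single 1 1 * HahnSeries.ofPowerSeries ℤ L (PowerSeries.mk fun k => a ^ k)

theorem geom_coeff_succ (a : L) (q : ℕ) : (geom a).coeff (q + 1) = a ^ q := by
  have := HahnSeries.coeff_single_mul_add (Γ := ℤ) (R := L) (r := 1)
    (x := HahnSeries.ofPowerSeries ℤ L (PowerSeries.mk fun k => a ^ k)) (a := q) (b := 1)
  rw [geom, this]
  simp

theorem geom_mul (a : L) : (lu L - HahnSeries.C a) * geom a = 1 := by
  have h1 : lu L * HahnSeries.single (1 : ℤ) (1 : L) = 1 := by
    rw [lu, HahnSeries.single_mul_single]; simp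
  have h2 : (HahnSeries.single (1 : ℤ) (1 : L)) = HahnSeries.ofPowerSeries ℤ L PowerSeries.X := by
    simp
  have h3 : HahnSeries.C a = HahnSeries.ofPowerSeries ℤ L (PowerSeries.C a) := by
    simp
  have h4 : (1 - PowerSeries.C a * PowerSeries.X) * (PowerSeries.mk fun k => a ^ k) = 1 := by
    ext k
    rw [sub_mul, one_mul, mul_assoc, map_sub, PowerSeries.coeff_C_mul]
    cases k with
    | zero => simp
    | succ k => rw [PowerSeries.coeff_succ_X_mul]; simp [PowerSeries.coeff_one, pow_succ']
  rw [geom, ← mul_assoc, sub_mul, h1, h2, h3, ← map_one (HahnSeries.ofPowerSeries ℤ L), ← map_mul,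
    ← map_sub, ← map_mul, h4, map_one]

theorem inv_lu_sub_C (a : L) : (lu L - HahnSeries.C a)⁻¹ = geom a :=
  inv_eq_of_mul_eq_one_right (geom_mul a)

theorem coeff_eval₂_lu_pos (p : L[X]) (q : ℕ) :
    (p.eval₂ HahnSeries.C (lu L)).coeff (q + 1) = 0 := by
  have hpow : ∀ k : ℕ, lu L ^ k = HahnSeries.single (-(k : ℤ)) 1 := by
    intro k
    rw [lu, HahnSeries.single_pow]; simp
  induction p using Polynomial.induction_on' with
  | add p q hp hq => rw [eval₂_add, HahnSeries.coeff_add, hp, hq, add_zero]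
  | monomial k a =>
    rw [eval₂_monomial, coeff_C_mul, hpow, HahnSeries.coeff_single_of_ne (by omega), mul_zero]

/-- Partial fractions: the coefficient of `u^{-q-1}` in a rational function with simple poles. -/
theorem coeff_of_mul_prod_eq {ι : Type*} [DecidableEq ι] (T : Finset ι) (b : ι → L)
    (hb : Set.InjOn b T) (N : L[X]) (F : LaurentSeries L)
    (hF : F * ∏ t ∈ T, (lu L - HahnSeries.C (b t)) = N.eval₂ HahnSeries.C (lu L)) (q : ℕ) :
    F.coeff (q + 1) = ∑ t ∈ T, b t ^ q * N.eval (b t) * ∏ s ∈ T \ {t}, (b t - b s)⁻¹ := by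
  set M := Lagrange.nodal T b
  have hM : M.Monic := Lagrange.nodal_monic
  -- Division by the nodal polynomial: the remainder is the Lagrange interpolant of `N`, and the
  -- quotient, a polynomial in `u`, has no negative powers of `u`.
  have hR : N %ₘ M = Lagrange.interpolate T b fun t => N.eval (b t) := by
    apply Lagrange.eq_interpolate_of_eval_eq _ hb
    · have := degree_modByMonic_lt N hM
      rwa [Lagrange.degree_nodal] at this
    · intro t ht
      conv_rhs => rw [← modByMonic_add_div N M]
      rw [eval_add, eval_mul, Lagrange.eval_nodal_at_node ht, zero_mul, add_zero]
  have hM2 : M.eval₂ HahnSeries.C (lu L) = ∏ t ∈ T, (lu L - HahnSeries.C (b t)) := by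
    simp only [M, Lagrange.nodal, eval₂_finsetProd, eval₂_sub, eval₂_X, eval₂_C]
  have hne : ∏ t ∈ T, (lu L - HahnSeries.C (b t)) ≠ 0 :=
    Finset.prod_ne_zero_iff.2 fun t _ => lu_sub_C_ne_zero _
  have hFe : F = (N /ₘ M).eval₂ HahnSeries.C (lu L) + ∑ t ∈ T,
      HahnSeries.C (N.eval (b t) * ∏ s ∈ T \ {t}, (b t - b s)⁻¹) * geom (b t) := by
    apply mul_right_cancel₀ hne
    rw [hF]
    conv_lhs => rw [← modByMonic_add_div N M]
    rw [eval₂_add, eval₂_mul, hM2, hR, Lagrange.interpolate_apply, eval₂_finsetSum, add_mul,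
      add_comm, mul_comm, Finset.sum_mul]
    congr 1
    refine Finset.sum_congr rfl fun t ht => ?_
    rw [eval₂_mul, eval₂_C, map_mul, mul_assoc, mul_assoc, ← Finset.mul_prod_erase T _ ht]
    rw [← mul_assoc (geom (b t)), mul_comm (geom (b t)), geom_mul, one_mul]
    rw [Lagrange.basis, eval₂_finsetProd, map_prod, Finset.sdiff_singleton_eq_erase,
      ← Finset.prod_mul_distrib]
    congr 1
    refine Finset.prod_congr rfl fun s _ => ?_
    rw [Lagrange.basisDivisor, eval₂_mul, eval₂_C, eval₂_sub, eval₂_X, eval₂_C]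
  rw [hFe, HahnSeries.coeff_add, coeff_eval₂_lu_pos, zero_add, HahnSeries.coeff_sum]
  refine Finset.sum_congr rfl fun t _ => ?_
  rw [coeff_C_mul, geom_coeff_succ]
  ring

end Laurent

/-! ### Combinatorics of shifts -/

theorem rev_ne_self {d : ℕ} (r : Fin (2 * d)) : r.rev ≠ r := by
  intro h
  have h1 := congrArg Fin.val h
  rw [Fin.val_rev] at h1
  omega

section Shift

variable {n d : ℕ}

theorem mem_block (I : SymPart n d) (l : Fin (2 * n + 1)) (s : Fin (2 * d)) :
    s ∈ I.block l ↔ I.val s = l := by simp [SymPart.block]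

theorem shift_self (i : Fin (2 * n)) (r : Fin (2 * d)) (I : SymPart n d) :
    (shift i r I).val r = i.succ := by simp [shift]

theorem shift_rev (i : Fin (2 * n)) (r : Fin (2 * d)) (I : SymPart n d) :
    (shift i r I).val r.rev = i.rev.castSucc := by simp [shift, rev_ne_self]

theorem shift_of_ne (i : Fin (2 * n)) {r s : Fin (2 * d)} (I : SymPart n d) (h1 : s ≠ r)
    (h2 : s ≠ r.rev) : (shift i r I).val s = I.val s := by simp [shift, h1, h2]

theorem shift_comm (i j : Fin (2 * n)) {k l : Fin (2 * d)} (I : SymPart n d) (h1 : l ≠ k)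
    (h2 : l ≠ k.rev) : shift i k (shift j l I) = shift j l (shift i k I) := by
  have h3 : l.rev ≠ k := fun h => h2 (by rw [← h, Fin.rev_rev])
  have h4 : l.rev ≠ k.rev := fun h => h1 (Fin.rev_injective h)
  ext s : 2
  simp only [shift]
  by_cases a : s = k
  · subst a; simp [h1.symm, h3.symm]
  · by_cases b : s = k.rev
    · subst b; simp [a, h2.symm, h4.symm]
    · simp [a, b]

end Shift

/-! ### Operators on functions of partitions -/

/-- The hypotheses on the values of `x_1, …, x_{2d}` and `ħ` under which no denominator
vanishes. -/
structure Generic {L : Type*} [Field L] {d : ℕ} (h : L) (x : Fin (2 * d) → L) : Prop where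
  rev : ∀ s, x s.rev = -x s
  inj : Function.Injective x
  ne_zero : h ≠ 0
  add_ne : ∀ (a b : Fin (2 * d)) (q : ℚ), q ≠ 0 → x a + x b ≠ (q : L) * h

namespace Generic

variable {L : Type*} [Field L] {d : ℕ} {h : L} {x : Fin (2 * d) → L}

theorem sub_ne (hx : Generic h x) (a b : Fin (2 * d)) (q : ℚ) (hq : q ≠ 0) :
    x a - x b ≠ (q : L) * h := by
  have := hx.add_ne a b.rev q hq
  rwa [hx.rev, ← sub_eq_add_neg] at this

theorem sub_ne_zero (hx : Generic h x) {a b : Fin (2 * d)} (hab : a ≠ b) : x a - x b ≠ 0 :=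
  _root_.sub_ne_zero.2 (hx.inj.ne hab)

theorem add_ne_zero (hx : Generic h x) {a b : Fin (2 * d)} (hab : a ≠ b.rev) :
    x a + x b ≠ 0 := by
  have := hx.sub_ne_zero hab
  rwa [hx.rev, sub_neg_eq_add] at this

theorem apply_ne_zero (hx : Generic h x) [CharZero L] (a : Fin (2 * d)) : x a ≠ 0 := by
  have := hx.add_ne_zero (rev_ne_self a).symm
  intro h0
  rw [h0] at this
  simp at this

end Generic

section Operators

variable {L : Type*} [Field L] {n d : ℕ}

/-- The entry `c_{ij}` of the Cartan matrix, in the field `L`. -/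
def cart (L : Type*) [Field L] {n : ℕ} (i j : Fin (2 * n)) : L := (CartanMatrix.A (2 * n) i j : ℤ)

theorem cart_self (i : Fin (2 * n)) : cart L i i = 2 := by simp [cart, CartanMatrix.A]

theorem cart_succ {i j : Fin (2 * n)} (h : (i : ℕ) + 1 = j) : cart L i j = -1 := by
  have : i ≠ j := by rintro rfl; omega
  simp [cart, CartanMatrix.A, this, h]

theorem cart_pred {i j : Fin (2 * n)} (h : (j : ℕ) + 1 = i) : cart L i j = -1 := by
  have : i ≠ j := by rintro rfl; omega
  simp [cart, CartanMatrix.A, this, h]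

theorem cart_of_ne {i j : Fin (2 * n)} (h1 : i ≠ j) (h2 : (i : ℕ) + 1 ≠ j)
    (h3 : (j : ℕ) + 1 ≠ i) : cart L i j = 0 := by
  simp [cart, CartanMatrix.A, h1, h2, h3]

theorem cart_symm (i j : Fin (2 * n)) : cart L i j = cart L j i := by
  rw [cart, cart, ← CartanMatrix.A_transpose (2 * n), Matrix.transpose_apply,
    CartanMatrix.A_transpose]

theorem cart_rev_rev (i j : Fin (2 * n)) : cart L i.rev j.rev = cart L i j := by
  have hi := Fin.val_rev i
  have hj := Fin.val_rev j
  have h1 := i.2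
  have h2 := j.2
  rcases eq_or_ne i j with rfl | hne
  · rw [cart_self, cart_self]
  by_cases a : (i : ℕ) + 1 = j
  · rw [cart_succ a, cart_pred (by omega)]
  by_cases b : (j : ℕ) + 1 = i
  · rw [cart_pred b, cart_succ (by omega)]
  rw [cart_of_ne hne a b, cart_of_ne (fun h => hne (Fin.rev_injective h)) (by omega) (by omega)]

theorem cart_rev_left (i j : Fin (2 * n)) : cart L i.rev j = cart L i j.rev := by
  rw [← cart_rev_rev, Fin.rev_rev]

/-- The spectral parameter `-x_k - (n - i) ħ / 2 - ħ / 4`. -/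
def spec (h : L) (x : Fin (2 * d) → L) (i : Fin (2 * n)) (k : Fin (2 * d)) : L :=
  -x k - hshift h i

theorem hshift_rev [CharZero L] (h : L) (i : Fin (2 * n)) : hshift h i.rev = -hshift h i := by
  have h1 : ((i.rev : ℕ) : L) = 2 * n - (i + 1) := by
    rw [Fin.val_rev, Nat.cast_sub (by omega)]; push_cast; ring
  rw [hshift, hshift, h1]
  field_simp
  ring

theorem hshift_succ [CharZero L] (h : L) {i j : Fin (2 * n)} (hij : (i : ℕ) + 1 = j) :
    hshift h i = hshift h j + h / 2 := by
  rw [hshift, hshift, ← hij]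
  push_cast
  field_simp
  ring

variable {h : L} {x : Fin (2 * d) → L}

theorem spec_rev [CharZero L] (hx : Generic h x) (i : Fin (2 * n)) (k : Fin (2 * d)) :
    spec h x i.rev k.rev = -spec h x i k := by
  rw [spec, spec, hshift_rev, hx.rev]; ring

variable (h x) in
/-- The coefficient of `F (τ_k⁺ I)` in the operator indexed by `i`, without the power of the
spectral parameter. -/
def weight (I : SymPart n d) (i : Fin (2 * n)) (k : Fin (2 * d)) : L :=
  if I.val k = i.castSucc then Phi h x (I.block i.castSucc \ {k}) (x k) else 0

variable (h x) in
/-- The operator that moves `k` from the block `i` to the block `i + 1`. -/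
def move (i : Fin (2 * n)) (k : Fin (2 * d)) : Module.End L (SymPart n d → L) where
  toFun F I := weight h x I i k * F (shift i k I)
  map_add' F G := by ext I; simp [mul_add]
  map_smul' c F := by ext I; simp; ring

theorem move_apply (i : Fin (2 * n)) (k : Fin (2 * d)) (F : SymPart n d → L) (I : SymPart n d) :
    move h x i k F I = weight h x I i k * F (shift i k I) := rfl

theorem weight_of_ne {I : SymPart n d} {i : Fin (2 * n)} {k : Fin (2 * d)}
    (hk : I.val k ≠ i.castSucc) : weight h x I i k = 0 := if_neg hk

theorem weight_of_eq {I : SymPart n d} {i : Fin (2 * n)} {k : Fin (2 * d)}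
    (hk : I.val k = i.castSucc) :
    weight h x I i k = Phi h x (I.block i.castSucc \ {k}) (x k) := if_pos hk

theorem Phi_split (I : SymPart n d) (b : Fin (2 * n + 1)) (z : L) {k l : Fin (2 * d)}
    (h1 : l ≠ k) (h2 : l ≠ k.rev) :
    Phi h x (I.block b \ {k}) z = (if I.val l = b then phi h (x l - z) else 1) *
      (if I.val l.rev = b then phi h (x l.rev - z) else 1) *
      Phi h x (I.block b \ {k, l, l.rev}) z := by
  have h3 : l.rev ≠ k := fun h => h2 (by rw [← h, Fin.rev_rev])
  have e : ∀ S : Finset (Fin (2 * d)), Phi h x (I.block b \ S) z =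
      ∏ s ∈ Finset.univ \ S, if I.val s = b then phi h (x s - z) else 1 := by
    intro S
    rw [Phi, ← Finset.prod_filter]
    congr 1
    ext s
    simp [mem_block, and_comm]
  rw [e, e]
  have e2 : Finset.univ \ {k} = insert l (insert l.rev (Finset.univ \ {k, l, l.rev})) := by
    ext s
    simp only [Finset.mem_sdiff, Finset.mem_univ, Finset.mem_singleton, true_and,
      Finset.mem_insert, not_or]
    by_cases a : s = l
    · subst a; simp [h1]
    · by_cases b : s = l.rev
      · subst b; simp [h3]
      · simp [a, b]
  rw [e2, Finset.prod_insert, Finset.prod_insert, mul_assoc]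
  · simp
  · simp [(rev_ne_self l).symm]

theorem Phi_shift (I : SymPart n d) (i : Fin (2 * n)) (b : Fin (2 * n + 1)) (z : L)
    (k l : Fin (2 * d)) :
    Phi h x ((shift i l I).block b \ {k, l, l.rev}) z = Phi h x (I.block b \ {k, l, l.rev}) z := by
  congr 1
  ext s
  simp only [Finset.mem_sdiff, Finset.mem_insert, Finset.mem_singleton, not_or, mem_block]
  constructor
  · rintro ⟨a, b, c, e⟩
    rw [shift_of_ne i I c e] at a
    exact ⟨a, b, c, e⟩
  · rintro ⟨a, b, c, e⟩
    rw [← shift_of_ne i I c e] at a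
    exact ⟨a, b, c, e⟩

theorem weight_split {I : SymPart n d} {i : Fin (2 * n)} {k l : Fin (2 * d)}
    (hk : I.val k = i.castSucc) (h1 : l ≠ k) (h2 : l ≠ k.rev) :
    weight h x I i k = (if I.val l = i.castSucc then phi h (x l - x k) else 1) *
      (if I.val l.rev = i.castSucc then phi h (x l.rev - x k) else 1) *
      Phi h x (I.block i.castSucc \ {k, l, l.rev}) (x k) := by
  rw [weight_of_eq hk, Phi_split I _ _ h1 h2]

theorem weight_shift_split {I : SymPart n d} {i j : Fin (2 * n)} {k l : Fin (2 * d)}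
    (hk : I.val k = i.castSucc) (h1 : l ≠ k) (h2 : l ≠ k.rev) :
    weight h x (shift j l I) i k = (if j.succ = i.castSucc then phi h (x l - x k) else 1) *
      (if j.rev = i then phi h (x l.rev - x k) else 1) *
      Phi h x (I.block i.castSucc \ {k, l, l.rev}) (x k) := by
  have h3 : k ≠ l.rev := fun h => h2 (by rw [h, Fin.rev_rev])
  have hk' : (shift j l I).val k = i.castSucc := by rw [shift_of_ne j I h1.symm h3, hk]
  rw [weight_split hk' h1 h2, shift_self, shift_rev, Phi_shift]
  simp only [Fin.castSucc_inj]

/-- In both orders of the moves the letters other than `k`, `l` and their mirrors contribute the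
same factors, and the factors of the mirror letters are `φ(-x_k - x_l)` on both sides. What remains
is an identity in `x_k - x_l`, checked for each value of `c_{ij}`; the shift by `h / 2` between
adjacent indices is what makes it uniform. -/
theorem weight_comm [CharZero L] (hx : Generic h x) {I : SymPart n d} {i j : Fin (2 * n)}
    {k l : Fin (2 * d)} (hk : I.val k = i.castSucc) (hl : I.val l = j.castSucc)
    (h1 : l ≠ k) (h2 : l ≠ k.rev) :
    (spec h x i k - spec h x j l - cart L i j * h / 2) *
        (weight h x I i k * weight h x (shift i k I) j l) =
      (spec h x i k - spec h x j l + cart L i j * h / 2) *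
        (weight h x I j l * weight h x (shift j l I) i k) := by
  have h3 : k ≠ l.rev := fun h => h2 (by rw [h, Fin.rev_rev])
  have hz := hx.sub_ne_zero h1
  have hz2 := hx.sub_ne_zero h1.symm
  rw [weight_split hk h1 h2, weight_shift_split hk h1 h2, weight_split hl h1.symm h3,
    weight_shift_split hl h1.symm h3, I.symm, I.symm, hk, hl, hx.rev, hx.rev]
  have a1 : (j.castSucc.rev = i.castSucc) ↔ (i.castSucc.rev = j.castSucc) := by
    rw [← Fin.rev_inj, Fin.rev_rev, eq_comm]
  have a2 : (j.rev = i) ↔ (i.rev = j) := by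
    rw [← Fin.rev_inj, Fin.rev_rev, eq_comm]
  simp only [a1, a2]
  have a3 : -x l - x k = -x k - x l := by ring
  rw [a3]
  generalize (if i.castSucc.rev = j.castSucc then phi h (-x k - x l) else 1) = P
  generalize (if i.rev = j then phi h (-x k - x l) else 1) = Q
  generalize Phi h x (I.block i.castSucc \ {k, l, l.rev}) (x k) = R
  generalize Phi h x (I.block j.castSucc \ {l, k, k.rev}) (x l) = S
  have b1 : (i.succ = j.castSucc) ↔ (i : ℕ) + 1 = j := by simp [Fin.ext_iff]
  have b2 : (j.succ = i.castSucc) ↔ (j : ℕ) + 1 = i := by simp [Fin.ext_iff]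
  simp only [b1, b2, Fin.castSucc_inj, spec]
  by_cases c1 : i = j
  · subst c1
    simp only [if_true, cart_self, phi]
    rw [if_neg (by omega), if_neg (by omega)]
    field_simp
    ring
  by_cases c2 : (i : ℕ) + 1 = j
  · rw [cart_succ c2, if_neg (Ne.symm c1), if_pos c2, if_neg c1, if_neg (by omega),
      hshift_succ h c2, phi]
    field_simp
    ring
  by_cases c3 : (j : ℕ) + 1 = i
  · rw [cart_pred c3, if_neg (Ne.symm c1), if_neg c2, if_neg c1, if_pos c3,
      hshift_succ h c3, phi]
    field_simp
    ring
  rw [cart_of_ne c1 c2 c3, if_neg (Ne.symm c1), if_neg c2, if_neg c1, if_neg c3]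
  ring

/-- The left factor of a product moves its letter first. After it `k` lies in the block `i + 1`, so
a second move of `k` must have index `i + 1`. -/
theorem move_mul_move_self {i j : Fin (2 * n)} (hij : (i : ℕ) + 1 ≠ j) (k : Fin (2 * d)) :
    (move h x i k * move h x j k : Module.End L (SymPart n d → L)) = 0 := by
  ext F I
  simp only [Module.End.mul_apply, move_apply, LinearMap.zero_apply, Pi.zero_apply]
  rw [weight_of_ne (I := shift i k I) (i := j)]
  · simp
  · rw [shift_self]
    simpa [Fin.ext_iff] using hij

theorem move_mul_move_rev {i j : Fin (2 * n)} (hij : j ≠ i.rev) (k : Fin (2 * d)) :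
    (move h x i k * move h x j k.rev : Module.End L (SymPart n d → L)) = 0 := by
  ext F I
  simp only [Module.End.mul_apply, move_apply, LinearMap.zero_apply, Pi.zero_apply]
  rw [weight_of_ne (I := shift i k I) (i := j)]
  · simp
  · rw [shift_rev]
    simpa using hij.symm

/-- After the first move `k` is in block `i + 1` and `k'` in block `τ i`. Moving `l` does not
disturb this, and neither block is `i`, because `τ` has no fixed point on an even number of indices.
-/
theorem move_mul_move_mul_move {i j : Fin (2 * n)} {k l m : Fin (2 * d)} (h1 : l ≠ k)
    (h2 : l ≠ k.rev) (hm : m = k ∨ m = k.rev) :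
    (move h x i k * move h x j l * move h x i m : Module.End L (SymPart n d → L)) = 0 := by
  have h3 : l.rev ≠ k := fun h => h2 (by rw [← h, Fin.rev_rev])
  have h4 : l.rev ≠ k.rev := fun h => h1 (Fin.rev_injective h)
  ext F I
  simp only [Module.End.mul_apply, move_apply, LinearMap.zero_apply, Pi.zero_apply]
  rw [weight_of_ne (I := shift j l (shift i k I)) (i := i)]
  · simp
  · rcases hm with rfl | rfl
    · rw [shift_of_ne _ _ h1.symm h3.symm, shift_self]
      simp [Fin.ext_iff]
    · rw [shift_of_ne _ _ h2.symm h4.symm, shift_rev]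
      intro h
      have := congrArg Fin.val h
      simp only [Fin.val_castSucc, Fin.val_rev] at this
      omega

/-- This is the relation between `b_i` and `b_j` letter by letter. Coinciding or opposite letters
are admitted as long as the pair is not exceptional, which is what allows unrestricted summation
later. -/
theorem move_comm [CharZero L] (hx : Generic h x) (i j : Fin (2 * n)) (k l : Fin (2 * d))
    (hkl : l ≠ k.rev ∨ j ≠ i.rev) :
    (spec h x i k - spec h x j l - cart L i j * h / 2) • (move h x i k * move h x j l) =
      (spec h x i k - spec h x j l + cart L i j * h / 2) •
        (move h x j l * move h x i k : Module.End L (SymPart n d → L)) := by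
  by_cases h1 : l = k
  · subst h1
    -- For one letter and adjacent indices, one product vanishes; the scalar in front of the other
    -- is zero, because adjacent spectral parameters of a letter differ by `h / 2`.
    by_cases c2 : (i : ℕ) + 1 = j
    · rw [move_mul_move_self (i := j) (j := i) (by omega), smul_zero, spec, spec,
        hshift_succ h c2, cart_succ c2]
      convert zero_smul L _ using 2
      ring
    by_cases c3 : (j : ℕ) + 1 = i
    · rw [move_mul_move_self (i := i) (j := j) (by omega), smul_zero, spec, spec,
        hshift_succ h c3, cart_pred c3]
      symm
      convert zero_smul L _ using 2
      ring
    rw [move_mul_move_self c2, move_mul_move_self c3, smul_zero, smul_zero]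
  by_cases h2 : l = k.rev
  · subst h2
    have hij : j ≠ i.rev := by tauto
    have h5 : i ≠ j.rev := fun h => hij (by rw [h, Fin.rev_rev])
    have := move_mul_move_rev (h := h) (x := x) h5 k.rev
    rw [Fin.rev_rev] at this
    rw [move_mul_move_rev hij, this, smul_zero, smul_zero]
  have h3 : k ≠ l.rev := fun h => h2 (by rw [h, Fin.rev_rev])
  ext F I
  simp only [Module.End.mul_apply, move_apply, LinearMap.smul_apply, Pi.smul_apply, smul_eq_mul]
  rw [shift_comm j i I (Ne.symm h1) h3]
  by_cases hk : I.val k = i.castSucc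
  · by_cases hl : I.val l = j.castSucc
    · have := weight_comm hx hk hl h1 h2
      linear_combination F (shift i k (shift j l I)) * this
    · rw [weight_of_ne hl, weight_of_ne (i := j) (k := l)]
      · simp
      · rwa [shift_of_ne _ _ h1 h2]
  · rw [weight_of_ne hk, weight_of_ne (i := i) (k := k) (I := shift j l I)]
    · simp
    · rwa [shift_of_ne _ _ (Ne.symm h1) h3]

end Operators

/-! ### The series `H_i(u)` -/

section Series

variable {n d : ℕ}

/-- The power series in `u⁻¹` that gives the expansion of `H_i(u)` on a partition, over a ring that
contains the spectral parameters `a`. -/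
def hPow {R : Type*} [CommRing R] (h δ : R) (a : Fin (2 * d) → R) (i : Fin (2 * n))
    (I : SymPart n d) : PowerSeries R :=
  (1 - PowerSeries.C δ * PowerSeries.X) * ∏ t, if I.val t = i.castSucc then
    1 + PowerSeries.C h * PowerSeries.X * PowerSeries.mk fun k => a t ^ k
    else if I.val t = i.succ then
      1 - PowerSeries.C h * PowerSeries.X * PowerSeries.mk fun k => a t ^ k
    else 1

theorem map_mk_pow {R S : Type*} [CommRing R] [CommRing S] (f : R →+* S) (a : R) :
    PowerSeries.map f (PowerSeries.mk fun k => a ^ k) = PowerSeries.mk fun k => f a ^ k := by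
  ext k; simp

theorem hPow_map {R S : Type*} [CommRing R] [CommRing S] (f : R →+* S) (h δ : R)
    (a : Fin (2 * d) → R) (i : Fin (2 * n)) (I : SymPart n d) :
    PowerSeries.map f (hPow h δ a i I) = hPow (f h) (f δ) (fun t => f (a t)) i I := by
  rw [hPow, hPow, map_mul, map_prod]
  simp only [apply_ite (PowerSeries.map f), map_sub, map_add, map_mul, map_one, map_mk_pow,
    PowerSeries.map_C, PowerSeries.map_X]

/-- The elements congruent to 1 modulo `h X` are closed under products. This makes the coefficients
of positive degree divisible by `ħ`, and gives constant term 1. -/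
theorem hPow_eq_one_add {R : Type*} [CommRing R] (h δ : R)
    (a : Fin (2 * d) → R) (i : Fin (2 * n)) (I : SymPart n d) :
    ∃ G, hPow h (δ * h) a i I = 1 + PowerSeries.C h * PowerSeries.X * G := by
  have key : ∀ {ι : Type} (s : Finset ι) (f : ι → PowerSeries R),
      (∀ t ∈ s, ∃ G, f t = 1 + PowerSeries.C h * PowerSeries.X * G) →
      ∃ G, ∏ t ∈ s, f t = 1 + PowerSeries.C h * PowerSeries.X * G := by
    intro ι s f hf
    classical
    induction s using Finset.induction_on with
    | empty => exact ⟨0, by simp⟩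
    | insert t s ht ih =>
      obtain ⟨G, hG⟩ := ih fun t' ht' => hf t' (Finset.mem_insert_of_mem ht')
      obtain ⟨G', hG'⟩ := hf t (Finset.mem_insert_self _ _)
      refine ⟨G + G' + PowerSeries.C h * PowerSeries.X * G * G', ?_⟩
      rw [Finset.prod_insert ht, hG, hG']
      ring
  obtain ⟨G, hG⟩ := key Finset.univ (fun t => if I.val t = i.castSucc then
    1 + PowerSeries.C h * PowerSeries.X * PowerSeries.mk fun k => a t ^ k
    else if I.val t = i.succ then
      1 - PowerSeries.C h * PowerSeries.X * PowerSeries.mk fun k => a t ^ k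
    else 1) (by
      intro t _
      split_ifs
      · exact ⟨_, rfl⟩
      · exact ⟨-PowerSeries.mk fun k => a t ^ k, by ring⟩
      · exact ⟨0, by simp⟩)
  refine ⟨G - PowerSeries.C δ - PowerSeries.C δ * (PowerSeries.C h * PowerSeries.X * G), ?_⟩
  rw [hPow, hG, map_mul]
  ring

variable {L : Type*} [Field L] (h : L) (x : Fin (2 * d) → L)

/-- The expansion of `H_i(u)` on an arbitrary partition. -/
def hSer (i : Fin (2 * n)) (I : SymPart n d) : LaurentSeries L :=
  (1 - deltaSign i / (4 * lu L) * HahnSeries.C h) *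
    Phi (HahnSeries.C h) (fun s => HahnSeries.C (x s)) (I.block i.castSucc)
      (-lu L - hshift (HahnSeries.C h) i) *
    Phi (HahnSeries.C h) (fun s => HahnSeries.C (x s)) (I.block i.rev.castSucc)
      (lu L + hshift (HahnSeries.C h) i)

/-- The factor of `H_i(u)` that belongs to an element `t` of the block `l`. -/
def hFactor (i : Fin (2 * n)) (l : Fin (2 * n + 1)) (t : Fin (2 * d)) : LaurentSeries L :=
  if l = i.castSucc then 1 + HahnSeries.C h / (lu L - HahnSeries.C (spec h x i t))
  else if l = i.succ then 1 - HahnSeries.C h / (lu L - HahnSeries.C (spec h x i t))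
  else 1

theorem C_hshift (i : Fin (2 * n)) :
    hshift (HahnSeries.C h : LaurentSeries L) i = HahnSeries.C (hshift h i) := by
  simp only [hshift, map_add, map_mul, map_div₀, map_sub, map_natCast, map_one, map_ofNat]

variable {h x}

/-- The mirror `t ↦ t'` carries the block `τ i` to the block `i + 1` and changes the sign of `x_t`.
Both products of `Φ` thereby acquire poles at the same spectral parameters `spec h x i t`, with
residues of opposite sign. -/
theorem hSer_eq (hx : Generic h x) (i : Fin (2 * n)) (I : SymPart n d) :
    hSer h x i I = (1 - deltaSign i / (4 * lu L) * HahnSeries.C h) *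
      ∏ t, hFactor h x i (I.val t) t := by
  have e1 : ∏ t, hFactor h x i (I.val t) t =
      (∏ t ∈ I.block i.castSucc, (1 + HahnSeries.C h / (lu L - HahnSeries.C (spec h x i t)))) *
      ∏ t ∈ I.block i.succ, (1 - HahnSeries.C h / (lu L - HahnSeries.C (spec h x i t))) := by
    rw [SymPart.block, SymPart.block, Finset.prod_filter, Finset.prod_filter,
      ← Finset.prod_mul_distrib]
    refine Finset.prod_congr rfl fun t _ => ?_
    rw [hFactor]
    by_cases a : I.val t = i.castSucc
    · rw [if_pos a, if_pos a, if_neg, mul_one]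
      rw [a]; simp [Fin.ext_iff]
    · rw [if_neg a, if_neg a, one_mul]
  rw [e1, hSer, ← mul_assoc, Phi, Phi, C_hshift]
  refine congrArg₂ _ (congrArg₂ _ rfl ?_) ?_
  · refine Finset.prod_congr rfl fun t _ => ?_
    rw [phi, spec, map_sub, map_neg]
    congr 2
    ring
  · refine Finset.prod_bij (fun t _ => t.rev) ?_ ?_ ?_ ?_
    · intro t ht
      rw [mem_block] at ht ⊢
      rw [I.symm, ht, Fin.rev_castSucc, Fin.rev_rev]
    · intro a _ b _ hab
      exact Fin.rev_injective hab
    · intro t ht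
      rw [mem_block] at ht
      refine ⟨t.rev, ?_, Fin.rev_rev t⟩
      rw [mem_block, I.symm, ht, Fin.rev_succ]
    · intro t _
      rw [phi, spec, hx.rev, map_sub, map_neg, map_neg, sub_eq_add_neg 1, ← div_neg]
      congr 2
      ring

theorem deltaSign_C (i : Fin (2 * n)) :
    (deltaSign i : LaurentSeries L) = HahnSeries.C (deltaSign i) := by
  simp only [deltaSign, map_sub, apply_ite (HahnSeries.C : L →+* LaurentSeries L), map_one,
    map_zero]

theorem inv_lu : (lu L)⁻¹ = HahnSeries.ofPowerSeries ℤ L PowerSeries.X := by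
  apply inv_eq_of_mul_eq_one_right
  rw [lu, HahnSeries.ofPowerSeries_X, HahnSeries.single_mul_single]
  simp

theorem ofPowerSeries_C (a : L) :
    HahnSeries.ofPowerSeries ℤ L (PowerSeries.C a) = HahnSeries.C a := by simp

theorem geom_eq (a : L) : geom a =
    HahnSeries.ofPowerSeries ℤ L (PowerSeries.X * PowerSeries.mk fun k => a ^ k) := by
  rw [map_mul, HahnSeries.ofPowerSeries_X, geom]

theorem hSer_eq_ofPowerSeries (hx : Generic h x) (i : Fin (2 * n)) (I : SymPart n d) :
    hSer h x i I =
      HahnSeries.ofPowerSeries ℤ L (hPow h (deltaSign i / 4 * h) (spec h x i) i I) := by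
  rw [hSer_eq hx, hPow, map_mul, map_prod]
  congr 1
  · rw [map_sub, map_one, map_mul, ofPowerSeries_C, ← inv_lu, deltaSign_C, map_mul, map_div₀]
    congr 1
    have : (HahnSeries.C (4 : L) : LaurentSeries L) = 4 := map_ofNat _ 4
    rw [this]
    ring
  · refine Finset.prod_congr rfl fun t _ => ?_
    rw [hFactor, apply_ite (HahnSeries.ofPowerSeries ℤ L), apply_ite (HahnSeries.ofPowerSeries ℤ L)]
    simp only [div_eq_mul_inv, inv_lu_sub_C, geom_eq]
    rw [map_add, map_sub, map_one, mul_assoc, map_mul (HahnSeries.ofPowerSeries ℤ L)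
      (PowerSeries.C h), ofPowerSeries_C]

theorem coeff_ofPowerSeries_natCast (G : PowerSeries L) (k : ℕ) :
    (HahnSeries.ofPowerSeries ℤ L G).coeff k = PowerSeries.coeff k G :=
  HahnSeries.ofPowerSeries_apply_coeff G k

theorem coeff_ofPowerSeries_neg (G : PowerSeries L) {k : ℤ} (hk : k < 0) :
    (HahnSeries.ofPowerSeries ℤ L G).coeff k = 0 := by
  rw [HahnSeries.ofPowerSeries_apply]
  apply HahnSeries.embDomain_of_notMem_range
  rintro ⟨m, hm⟩
  simp at hm
  omega

theorem hSer_coeff_neg (hx : Generic h x) (i : Fin (2 * n)) (I : SymPart n d) {k : ℤ}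
    (hk : k < 0) : (hSer h x i I).coeff k = 0 := by
  rw [hSer_eq_ofPowerSeries hx, coeff_ofPowerSeries_neg _ hk]

theorem hSer_coeff_zero (hx : Generic h x) (i : Fin (2 * n)) (I : SymPart n d) :
    (hSer h x i I).coeff 0 = 1 := by
  obtain ⟨G, hG⟩ := hPow_eq_one_add h (deltaSign i / 4) (spec h x i) i I
  have := coeff_ofPowerSeries_natCast (hPow h (deltaSign i / 4 * h) (spec h x i) i I) 0
  rw [hSer_eq_ofPowerSeries hx]
  rw [Nat.cast_zero] at this
  rw [this, hG, mul_assoc, map_add, PowerSeries.coeff_C_mul]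
  simp

/-- For `i = j` the factor changes from `(u - s + h)/(u - s)` to `(u - s - h)/(u - s)`. For adjacent
indices only one of the two blocks contributes, and the offset `h / 2` of the spectral parameters
brings the ratio to the same form. -/
theorem hFactor_move [CharZero L] (i j : Fin (2 * n)) (t : Fin (2 * d)) :
    hFactor h x i j.castSucc t * (lu L - HahnSeries.C (spec h x j t + cart L i j * h / 2)) =
      hFactor h x i j.succ t * (lu L - HahnSeries.C (spec h x j t - cart L i j * h / 2)) := by
  have b1 : (j.castSucc = i.succ) ↔ (i : ℕ) + 1 = j := by simp [Fin.ext_iff, eq_comm]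
  have b2 : (j.succ = i.castSucc) ↔ (j : ℕ) + 1 = i := by simp [Fin.ext_iff]
  have hne := lu_sub_C_ne_zero (spec h x i t)
  rw [hFactor, hFactor]
  simp only [b1, b2, Fin.castSucc_inj, Fin.succ_inj]
  by_cases c1 : i = j
  · subst c1
    rw [if_pos rfl, if_neg (by omega), if_pos rfl, cart_self, map_add, map_sub]
    have : (2 : L) * h / 2 = h := by field_simp
    rw [this]
    field_simp
    ring
  by_cases c2 : (i : ℕ) + 1 = j
  · have e : spec h x j t = spec h x i t + h / 2 := by
      rw [spec, spec, hshift_succ h c2]; ring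
    rw [if_neg (Ne.symm c1), if_pos c2, if_neg (by omega), if_neg (Ne.symm c1), cart_succ c2, e]
    have e1 : spec h x i t + h / 2 + -1 * h / 2 = spec h x i t := by ring
    have e2 : spec h x i t + h / 2 - -1 * h / 2 = spec h x i t + h := by ring
    rw [e1, e2, map_add]
    field_simp
    ring
  by_cases c3 : (j : ℕ) + 1 = i
  · have e : spec h x j t = spec h x i t - h / 2 := by
      rw [spec, spec, hshift_succ h c3]; ring
    rw [if_neg (Ne.symm c1), if_neg c2, if_pos c3, cart_pred c3, e]
    have e1 : spec h x i t - h / 2 + -1 * h / 2 = spec h x i t - h := by ring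
    have e2 : spec h x i t - h / 2 - -1 * h / 2 = spec h x i t := by ring
    rw [e1, e2, map_sub]
    field_simp
    ring
  rw [if_neg (Ne.symm c1), if_neg c2, if_neg c3, if_neg (Ne.symm c1), cart_of_ne c1 c2 c3]
  simp

theorem univ_eq_insert_pair (m : Fin (2 * d)) :
    (Finset.univ : Finset (Fin (2 * d))) = insert m (insert m.rev (Finset.univ \ {m, m.rev})) := by
  ext s
  simp only [Finset.mem_univ, Finset.mem_insert, Finset.mem_sdiff, Finset.mem_singleton, true_and,
    true_iff]
  tauto

theorem prod_univ_eq_pair {M : Type*} [CommMonoid M] (f : Fin (2 * d) → M) (m : Fin (2 * d)) :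
    ∏ t, f t = f m * f m.rev * ∏ t ∈ Finset.univ \ {m, m.rev}, f t := by
  conv_lhs => rw [univ_eq_insert_pair m]
  rw [Finset.prod_insert, Finset.prod_insert, mul_assoc]
  · simp
  · simp [(rev_ne_self m).symm]

/-- A shift moves `m` with index `j` and `m'` with index `τ j`. The two applications of
`hFactor_move` have opposite spectral parameters, which produces the two linear factors on each
side. -/
theorem hSer_shift [CharZero L] (hx : Generic h x) (i j : Fin (2 * n)) (m : Fin (2 * d))
    (I : SymPart n d) (hm : I.val m = j.castSucc) :
    hSer h x i I * ((lu L - HahnSeries.C (spec h x j m + cart L i j * h / 2)) *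
        (lu L - HahnSeries.C (-spec h x j m - cart L i.rev j * h / 2))) =
      hSer h x i (shift j m I) * ((lu L - HahnSeries.C (spec h x j m - cart L i j * h / 2)) *
        (lu L - HahnSeries.C (-spec h x j m + cart L i.rev j * h / 2))) := by
  have h1 := hFactor_move (h := h) (x := x) i j m
  have h2 := hFactor_move (h := h) (x := x) i j.rev m.rev
  rw [spec_rev hx, ← cart_rev_left] at h2
  rw [hSer_eq hx, hSer_eq hx, prod_univ_eq_pair _ m, prod_univ_eq_pair _ m, shift_self, shift_rev,
    I.symm, hm, Fin.rev_castSucc]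
  have e : ∏ t ∈ Finset.univ \ {m, m.rev}, hFactor h x i ((shift j m I).val t) t =
      ∏ t ∈ Finset.univ \ {m, m.rev}, hFactor h x i (I.val t) t := by
    refine Finset.prod_congr rfl fun t ht => ?_
    simp only [Finset.mem_sdiff, Finset.mem_insert, Finset.mem_singleton, not_or] at ht
    rw [shift_of_ne _ _ ht.2.1 ht.2.2]
  rw [e]
  linear_combination (1 - deltaSign i / (4 * lu L) * HahnSeries.C h) *
    (∏ t ∈ Finset.univ \ {m, m.rev}, hFactor h x i (I.val t) t) *
    (hFactor h x i j.rev.succ m.rev *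
      (lu L - HahnSeries.C (-spec h x j m - cart L i.rev j * h / 2)) * h1 -
    hFactor h x i j.succ m * (lu L - HahnSeries.C (spec h x j m - cart L i j * h / 2)) * h2)

theorem coeff_mul_quadratic (F : LaurentSeries L) (a b : L) (k : ℤ) :
    (F * ((lu L - HahnSeries.C a) * (lu L - HahnSeries.C b))).coeff k =
      F.coeff (k + 2) - (a + b) * F.coeff (k + 1) + a * b * F.coeff k := by
  have e : F * ((lu L - HahnSeries.C a) * (lu L - HahnSeries.C b)) =
      lu L * (lu L * F) - HahnSeries.C (a + b) * (lu L * F) + HahnSeries.C (a * b) * F := by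
    rw [map_add, map_mul]; ring
  rw [e, HahnSeries.coeff_add, HahnSeries.coeff_sub, coeff_C_mul, coeff_C_mul, coeff_lu_mul,
    coeff_lu_mul, coeff_lu_mul]
  ring_nf

/-- The relations between `h` and `b` are all read off here: `k = -1` and `k = 0` give those for
`h_{i,0}` and `h_{i,1}`, and `k = r + 1` gives the recursive one. -/
theorem hSer_shift_coeff [CharZero L] (hx : Generic h x) (i j : Fin (2 * n)) (m : Fin (2 * d))
    (I : SymPart n d) (hm : I.val m = j.castSucc) (k : ℤ) :
    (hSer h x i I).coeff (k + 2) - (hSer h x i (shift j m I)).coeff (k + 2) =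
      (cart L i j - cart L i.rev j) / 2 * h *
        ((hSer h x i I).coeff (k + 1) + (hSer h x i (shift j m I)).coeff (k + 1)) +
      (spec h x j m ^ 2 + cart L i j * cart L i.rev j / 4 * h ^ 2) *
        ((hSer h x i I).coeff k - (hSer h x i (shift j m I)).coeff k) +
      (cart L i j + cart L i.rev j) / 2 * h * spec h x j m *
        ((hSer h x i I).coeff k + (hSer h x i (shift j m I)).coeff k) := by
  have := congrArg (fun F : LaurentSeries L => F.coeff k) (hSer_shift hx i j m I hm)
  simp only [coeff_mul_quadratic] at this
  linear_combination this

end Series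

section Diagonal

variable {L : Type*} [Field L] {n d : ℕ} {h : L} {x : Fin (2 * d) → L}

/-! ### Residues of `H_i(u)` -/

/-- The sign with which a letter in the block `l` contributes to `H_i(u)`. -/
def sgn (L : Type*) [Field L] {n : ℕ} (i : Fin (2 * n)) (l : Fin (2 * n + 1)) : L :=
  if l = i.castSucc then 1 else if l = i.succ then -1 else 0

theorem sgn_castSucc (i : Fin (2 * n)) : sgn L i i.castSucc = 1 := if_pos rfl

theorem sgn_succ (i : Fin (2 * n)) : sgn L i i.succ = -1 := by
  rw [sgn, if_neg, if_pos rfl]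
  simp [Fin.ext_iff]

theorem sgn_rev_rev (i : Fin (2 * n)) (l : Fin (2 * n + 1)) : sgn L i.rev l.rev = -sgn L i l := by
  have a1 : (l.rev = i.rev.castSucc) ↔ l = i.succ := by
    rw [← Fin.rev_succ, Fin.rev_inj]
  have a2 : (l.rev = i.rev.succ) ↔ l = i.castSucc := by
    rw [← Fin.rev_castSucc, Fin.rev_inj]
  rw [sgn, sgn]
  simp only [a1, a2]
  have a3 : i.castSucc ≠ i.succ := by simp [Fin.ext_iff]
  by_cases b : l = i.castSucc
  · rw [if_neg (by rw [b]; exact a3), if_pos b, if_pos b]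
  · by_cases c : l = i.succ
    · rw [if_pos c, if_neg b, if_pos c, neg_neg]
    · rw [if_neg c, if_neg b, if_neg b, if_neg c, neg_zero]

theorem hFactor_eq (i : Fin (2 * n)) (l : Fin (2 * n + 1)) (t : Fin (2 * d)) :
    hFactor h x i l t =
      1 + HahnSeries.C (sgn L i l * h) / (lu L - HahnSeries.C (spec h x i t)) := by
  rw [hFactor, sgn]
  split_ifs
  · rw [one_mul]
  · rw [neg_one_mul, map_neg, neg_div, ← sub_eq_add_neg]
  · simp

variable (h x) in
/-- The regular part of the residue of `H_i(u)` at the spectral parameter of `t`. -/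
def resid (i : Fin (2 * n)) (t : Fin (2 * d)) (I : SymPart n d) : L :=
  ∏ s ∈ Finset.univ \ {t}, (1 + sgn L i (I.val s) * h / (x s - x t))

theorem resid_rev (hx : Generic h x) (i : Fin (2 * n)) (t : Fin (2 * d)) (I : SymPart n d) :
    resid h x i.rev t.rev I = resid h x i t I := by
  rw [resid, resid]
  refine Finset.prod_bij (fun s _ => s.rev) ?_ ?_ ?_ ?_
  · intro s hs
    simp only [Finset.mem_sdiff, Finset.mem_univ, Finset.mem_singleton, true_and] at hs ⊢
    intro h
    exact hs (by rw [← h, Fin.rev_rev])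
  · intro a _ b _ hab
    exact Fin.rev_injective hab
  · intro s hs
    refine ⟨s.rev, ?_, Fin.rev_rev s⟩
    simpa using hs
  · intro s _
    have := sgn_rev_rev (L := L) i (I.val s.rev)
    rw [I.symm, Fin.rev_rev] at this
    have h2 := hx.rev s.rev
    rw [Fin.rev_rev] at h2
    rw [this, h2, hx.rev t, I.symm, ← neg_div_neg_eq (sgn L i (I.val s).rev * h)]
    congr 2 <;> ring

theorem spec_sub_spec (i : Fin (2 * n)) (s t : Fin (2 * d)) :
    spec h x i t - spec h x i s = x s - x t := by
  rw [spec, spec]; ring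

theorem spec_injective (hx : Generic h x) (i : Fin (2 * n)) :
    Function.Injective (spec h x i) := by
  intro s t hst
  have := spec_sub_spec (h := h) (x := x) i t s
  rw [hst, sub_self] at this
  exact (hx.inj (sub_eq_zero.1 this.symm)).symm

/-- Partial fractions for `p(u) ∏ hFactor / ((u - α) (u - β))`, where the zeros `α` and `β` of the
denominator are cancelled by the factors of `m₁` and `m₂`. -/
theorem coeff_of_mul_quadratic_eq (hx : Generic h x) (i : Fin (2 * n)) (I : SymPart n d)
    (p : L[X]) (F : LaurentSeries L) (M : Finset (Fin (2 * d)))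
    (hM : ∀ m ∈ M, sgn L i (I.val m) ≠ 0)
    (hF : F * ∏ m ∈ M, (lu L - HahnSeries.C (spec h x i m - sgn L i (I.val m) * h)) =
      p.eval₂ HahnSeries.C (lu L) * ∏ t, hFactor h x i (I.val t) t) (q : ℕ) :
    F.coeff (q + 1) = ∑ t, sgn L i (I.val t) * h * spec h x i t ^ q * p.eval (spec h x i t) *
      resid h x i t I *
      ∏ m ∈ M, (spec h x i t - (spec h x i m - sgn L i (I.val m) * h))⁻¹ := by
  have hcases : ∀ l, sgn L i l = 1 ∨ sgn L i l = -1 ∨ sgn L i l = 0 := by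
    intro l; rw [sgn]; split_ifs <;> simp
  have hne : ∀ t m, m ∈ M → spec h x i t - (spec h x i m - sgn L i (I.val m) * h) ≠ 0 := by
    intro t m hm
    have e : spec h x i t - (spec h x i m - sgn L i (I.val m) * h) =
        x m - x t + sgn L i (I.val m) * h := by rw [spec, spec]; ring
    rw [e]
    intro h0
    rcases hcases (I.val m) with a | a | a
    · rw [a] at h0
      apply hx.sub_ne m t (-1) (by norm_num)
      push_cast
      linear_combination h0
    · rw [a] at h0
      apply hx.sub_ne m t 1 (by norm_num)
      push_cast
      linear_combination h0
    · exact hM m hm a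
  classical
  set T : Finset (Fin (2 * d)) := Finset.univ.filter fun t => sgn L i (I.val t) ≠ 0 with hT
  have hMT : M ⊆ T := fun m hm => by simpa [hT] using hM m hm
  have hneM : ∏ m ∈ M, (lu L - HahnSeries.C (spec h x i m - sgn L i (I.val m) * h)) ≠ 0 :=
    Finset.prod_ne_zero_iff.2 fun m _ => lu_sub_C_ne_zero _
  have hprod : (∏ t, hFactor h x i (I.val t) t) * ∏ t ∈ T, (lu L - HahnSeries.C (spec h x i t)) =
      ∏ t ∈ T, (lu L - HahnSeries.C (spec h x i t - sgn L i (I.val t) * h)) := by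
    have : ∏ t, hFactor h x i (I.val t) t = ∏ t ∈ T, hFactor h x i (I.val t) t := by
      symm
      apply Finset.prod_subset (Finset.subset_univ _)
      intro t _ ht
      have : sgn L i (I.val t) = 0 := by simpa [hT] using ht
      rw [hFactor_eq, this]
      simp
    rw [this, ← Finset.prod_mul_distrib]
    refine Finset.prod_congr rfl fun t _ => ?_
    have := lu_sub_C_ne_zero (spec h x i t)
    rw [hFactor_eq, map_sub]
    field_simp
    ring
  -- Relative to the denominators `u - spec t`, the product of the `hFactor` has numerator `∏ (u -
  -- spec t + sgn · h)`. The factors of the letters in `M` cancel the extra denominator of `F`, so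
  -- only the simple poles at the spectral parameters remain.
  have hN : F * ∏ t ∈ T, (lu L - HahnSeries.C (spec h x i t)) =
      (p * ∏ t ∈ T \ M, (X - C (spec h x i t - sgn L i (I.val t) * h))).eval₂
        HahnSeries.C (lu L) := by
    apply mul_right_cancel₀ hneM
    rw [mul_right_comm, hF, mul_assoc, hprod, eval₂_mul, eval₂_finsetProd, mul_assoc,
      ← Finset.prod_sdiff hMT]
    simp only [eval₂_sub, eval₂_X, eval₂_C]
  rw [coeff_of_mul_prod_eq T _ (spec_injective hx i).injOn _ F hN]
  have : ∀ t, sgn L i (I.val t) * h * spec h x i t ^ q * p.eval (spec h x i t) *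
      resid h x i t I * ∏ m ∈ M, (spec h x i t - (spec h x i m - sgn L i (I.val m) * h))⁻¹ ≠ 0 →
      t ∈ T := by
    intro t ht
    simp only [hT, Finset.mem_filter, Finset.mem_univ, true_and]
    intro h0
    rw [h0] at ht
    simp at ht
  rw [← Finset.sum_subset (Finset.subset_univ T) (fun t _ ht => by
    by_contra h0; exact ht (this t h0))]
  refine Finset.sum_congr rfl fun t ht => ?_
  have hres : resid h x i t I = ∏ s ∈ T \ {t}, ((spec h x i t -
      (spec h x i s - sgn L i (I.val s) * h)) * (spec h x i t - spec h x i s)⁻¹) := by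
    rw [resid]
    symm
    rw [← Finset.prod_subset (s₁ := T \ {t}) (s₂ := Finset.univ \ {t})]
    · refine Finset.prod_congr rfl fun s hs => ?_
      have hst : s ≠ t := by
        rintro rfl
        simp at hs
      have := hx.sub_ne_zero hst
      have e : spec h x i t - (spec h x i s - sgn L i (I.val s) * h) =
        x s - x t + sgn L i (I.val s) * h := by rw [spec, spec]; ring
      rw [spec_sub_spec, e]
      field_simp
    · exact Finset.sdiff_subset_sdiff (Finset.subset_univ _) le_rfl
    · intro s hs hs2
      have : sgn L i (I.val s) = 0 := by
        simp only [Finset.mem_sdiff, Finset.mem_univ, true_and, Finset.mem_singleton] at hs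
        simp only [Finset.mem_sdiff, Finset.mem_singleton, hs, not_false_eq_true, and_true] at hs2
        simpa [hT] using hs2
      rw [this]
      simp
  have hev : (∏ t' ∈ T \ M, (X - C (spec h x i t' - sgn L i (I.val t') * h))).eval
      (spec h x i t) = (sgn L i (I.val t) * h) * (∏ s ∈ T \ {t}, (spec h x i t -
      (spec h x i s - sgn L i (I.val s) * h))) *
      ∏ m ∈ M, (spec h x i t - (spec h x i m - sgn L i (I.val m) * h))⁻¹ := by
    rw [eval_prod]
    simp only [eval_sub, eval_X, eval_C]
    have h1 : (∏ s ∈ T, (spec h x i t - (spec h x i s - sgn L i (I.val s) * h))) =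
        (sgn L i (I.val t) * h) * ∏ s ∈ T \ {t}, (spec h x i t -
        (spec h x i s - sgn L i (I.val s) * h)) := by
      rw [Finset.sdiff_singleton_eq_erase, ← Finset.mul_prod_erase T _ ht]
      congr 1
      ring
    rw [← h1, ← Finset.prod_sdiff hMT, mul_assoc, ← Finset.prod_mul_distrib]
    rw [Finset.prod_congr (s₂ := M) rfl (fun m hm => mul_inv_cancel₀ (hne t m hm))]
    simp
  rw [eval_mul, hev, hres, Finset.prod_mul_distrib]
  ring

/-- The prefactor `1 - δ h / (4u)` may have a pole at `u = 0`. Multiplication by `u` turns it into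
the polynomial `u - δ h / 4` and costs one step in the index, which is why the coefficient `q + 2`
appears. -/
theorem coeff_add_two_hSer [CharZero L] (hx : Generic h x) (i : Fin (2 * n)) (I : SymPart n d)
    (q : ℕ) : (hSer h x i I).coeff (q + 2) = ∑ t, sgn L i (I.val t) * h * spec h x i t ^ q *
      (spec h x i t - deltaSign i / 4 * h) * resid h x i t I := by
  have e : (hSer h x i I).coeff (q + 2) = (lu L * hSer h x i I).coeff (q + 1) := by
    rw [coeff_lu_mul]; ring_nf
  have := coeff_of_mul_quadratic_eq hx i I (X - C (deltaSign i / 4 * h)) (lu L * hSer h x i I) ∅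
    (by simp) (by
      have hu := lu_ne_zero (L := L)
      have h4 : (4 : LaurentSeries L) ≠ 0 := by
        rw [← map_ofNat (HahnSeries.C : L →+* LaurentSeries L) 4]
        exact (_root_.map_ne_zero _).2 (by norm_num)
      rw [hSer_eq hx, Finset.prod_empty, mul_one, ← mul_assoc, eval₂_sub, eval₂_X, eval₂_C,
        map_mul, map_div₀, map_ofNat, ← deltaSign_C]
      congr 1
      field_simp) q
  rw [e, this]
  simp

/-- Without the prefactor there is no pole at `u = 0`, so the partial fractions reach one
coefficient further. -/
theorem coeff_add_one_hSer (hx : Generic h x) {i : Fin (2 * n)}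
    (hi : (deltaSign i : L) = 0) (I : SymPart n d) (q : ℕ) :
    (hSer h x i I).coeff (q + 1) = ∑ t, sgn L i (I.val t) * h * spec h x i t ^ q *
      resid h x i t I := by
  have := coeff_of_mul_quadratic_eq hx i I 1 (hSer h x i I) ∅
    (by simp) (by rw [hSer_eq hx, deltaSign_C, hi]; simp) q
  rw [this]
  simp

/-! ### Moving a letter back and forth -/

theorem shift_shift_rev {i : Fin (2 * n)} {k : Fin (2 * d)} {I : SymPart n d}
    (hk : I.val k = i.castSucc) : shift i.rev k.rev (shift i k I) = I := by
  ext s : 2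
  by_cases a : s = k.rev
  · subst a
    rw [shift_self, I.symm, hk, Fin.rev_castSucc]
  by_cases b : s = k
  · subst b
    have := shift_rev i.rev s.rev (shift i s I)
    rw [Fin.rev_rev, Fin.rev_rev] at this
    rw [this, hk]
  rw [shift_of_ne _ _ a (by rwa [Fin.rev_rev]), shift_of_ne _ _ b a]

/-- The first weight collects the block `i`; the second, read through the mirror, collects the block
`i + 1` after the move. Together they form the residue at `k`. The only discrepancy is the letter
`k'`, which has entered the block `i + 1` exactly when `i + 1 = τ i`. -/
theorem weight_mul_weight_rev [CharZero L] (hx : Generic h x) {i : Fin (2 * n)} {k : Fin (2 * d)}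
    {I : SymPart n d} (hk : I.val k = i.castSucc) :
    weight h x I i k * weight h x (shift i k I) i.rev k.rev =
      resid h x i k I * if (i : ℕ) + 1 = i.rev then 1 + h / (2 * x k) else 1 := by
  have hk2 : (shift i k I).val k.rev = i.rev.castSucc := shift_rev _ _ _
  rw [weight_of_eq hk, weight_of_eq hk2, Phi, Phi]
  have e1 : ∏ s ∈ I.block i.castSucc \ {k}, phi h (x s - x k) =
      ∏ s ∈ Finset.univ \ {k}, if I.val s = i.castSucc then phi h (x s - x k) else 1 := by
    rw [← Finset.prod_filter]
    refine Finset.prod_congr ?_ fun _ _ => rfl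
    ext s
    simp [mem_block, and_comm]
  have e2 : ∏ s ∈ (shift i k I).block i.rev.castSucc \ {k.rev}, phi h (x s - x k.rev) =
      ∏ s ∈ Finset.univ \ {k}, if (shift i k I).val s = i.succ then phi h (x k - x s) else 1 := by
    rw [← Finset.prod_filter]
    refine Finset.prod_bij (fun s _ => s.rev) ?_ ?_ ?_ ?_
    · intro s hs
      simp only [Finset.mem_sdiff, Finset.mem_singleton, mem_block] at hs
      simp only [Finset.mem_filter, Finset.mem_sdiff, Finset.mem_singleton, Finset.mem_univ,
        true_and]
      refine ⟨fun h => hs.2 (by rw [← h, Fin.rev_rev]), ?_⟩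
      rw [(shift i k I).symm, hs.1, Fin.rev_castSucc, Fin.rev_rev]
    · intro a _ b _ hab
      exact Fin.rev_injective hab
    · intro s hs
      simp only [Finset.mem_filter, Finset.mem_sdiff, Finset.mem_singleton, Finset.mem_univ,
        true_and] at hs
      refine ⟨s.rev, ?_, Fin.rev_rev s⟩
      simp only [Finset.mem_sdiff, Finset.mem_singleton, mem_block]
      refine ⟨?_, fun h => hs.1 (Fin.rev_injective h)⟩
      rw [(shift i k I).symm, hs.2, Fin.rev_succ]
    · intro s _
      rw [hx.rev, hx.rev]
      congr 1
      ring
  have hkr : k.rev ∈ Finset.univ \ {k} := by simp [rev_ne_self]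
  rw [e1, e2, ← Finset.prod_mul_distrib, resid, ← Finset.mul_prod_erase _ _ hkr,
    ← Finset.mul_prod_erase _ _ hkr]
  have hxk := hx.apply_ne_zero k
  have e3 : ∏ s ∈ (Finset.univ \ {k}).erase k.rev,
        ((if I.val s = i.castSucc then phi h (x s - x k) else 1) *
        if (shift i k I).val s = i.succ then phi h (x k - x s) else 1) =
      ∏ s ∈ (Finset.univ \ {k}).erase k.rev, (1 + sgn L i (I.val s) * h / (x s - x k)) := by
    refine Finset.prod_congr rfl fun s hs => ?_
    simp only [Finset.mem_erase, Finset.mem_sdiff, Finset.mem_univ, Finset.mem_singleton,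
      true_and] at hs
    have := hx.sub_ne_zero hs.2
    have := hx.sub_ne_zero (Ne.symm hs.2)
    rw [shift_of_ne _ _ hs.2 hs.1, sgn, phi, phi]
    by_cases a : I.val s = i.castSucc
    · have : I.val s ≠ i.succ := by rw [a]; simp [Fin.ext_iff]
      rw [if_pos a, if_neg this, if_pos a]
      ring
    · by_cases b : I.val s = i.succ
      · rw [if_neg a, if_pos b, if_neg a, if_pos b]
        field_simp
        ring
      · simp [a, b]
  rw [e3, shift_rev, I.symm, hk, sgn, hx.rev, phi, phi]
  have a1 : (i.rev.castSucc = i.succ) ↔ (i : ℕ) + 1 = i.rev := by simp [Fin.ext_iff, eq_comm]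
  have a2 : i.castSucc.rev ≠ i.succ := by
    rw [Fin.rev_castSucc]
    simp only [ne_eq, Fin.succ_inj]
    intro h
    have := congrArg Fin.val h
    rw [Fin.val_rev] at this
    omega
  simp only [a1, if_neg a2]
  split_ifs
  · field_simp
    ring
  · field_simp
  · field_simp
    ring
  · simp

theorem move_mul_move_rev_apply [CharZero L] (hx : Generic h x) (i : Fin (2 * n))
    (k : Fin (2 * d)) (F : SymPart n d → L) (I : SymPart n d) :
    (move h x i k * move h x i.rev k.rev) F I = (if I.val k = i.castSucc then
      resid h x i k I * (if (i : ℕ) + 1 = i.rev then 1 + h / (2 * x k) else 1) else 0) * F I := by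
  simp only [Module.End.mul_apply, move_apply]
  by_cases hk : I.val k = i.castSucc
  · rw [if_pos hk, shift_shift_rev hk, ← mul_assoc, weight_mul_weight_rev hx hk]
  · rw [if_neg hk, weight_of_ne hk]
    simp

end Diagonal

/-! ### Commutators with linear combinations -/

section Bilinear

variable {L A : Type*} [Field L] [Ring A] [Algebra L A] {ι : Type*} [Fintype ι]

theorem comm_smul_sum (T : A) (c : L) (a : ι → L) (e : ι → A) :
    comm T (c • ∑ k, a k • e k) = c • ∑ k, a k • comm T (e k) := by
  simp only [comm, mul_smul_comm, smul_mul_assoc, Finset.mul_sum, Finset.sum_mul, smul_sub,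
    Finset.sum_sub_distrib]

theorem anti_smul_sum (T : A) (c : L) (a : ι → L) (e : ι → A) :
    anti T (c • ∑ k, a k • e k) = c • ∑ k, a k • anti T (e k) := by
  simp only [anti, mul_smul_comm, smul_mul_assoc, Finset.mul_sum, Finset.sum_mul, smul_add,
    Finset.sum_add_distrib]

theorem smul_sum_comm (T : A) (c : L) (a : ι → L) (e : ι → A) :
    comm (c • ∑ k, a k • e k) T = c • ∑ k, a k • comm (e k) T := by
  simp only [comm, mul_smul_comm, smul_mul_assoc, Finset.mul_sum, Finset.sum_mul, smul_sub,
    Finset.sum_sub_distrib]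

theorem smul_smul_sum (a' c : L) (e : ι → A) : a' • c • ∑ k, e k = c • ∑ k, a' • e k := by
  rw [smul_comm, Finset.smul_sum]

end Bilinear

/-! ### The operators on functions of partitions and the relations that involve `hOp` -/

section Relations

variable {L : Type*} [Field L] {n d : ℕ} (h : L) (x : Fin (2 * d) → L)

/-- The operator `B_{i,r}` on functions of partitions, with `√-1` replaced by `c`. -/
def bOp (c : L) (i : Fin (2 * n)) (r : ℕ) : Module.End L (SymPart n d → L) :=
  c • ∑ k, spec h x i k ^ r • move h x i k

/-- Multiplication by a function of partitions. -/
def diag (g : SymPart n d → L) : Module.End L (SymPart n d → L) where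
  toFun F I := g I * F I
  map_add' F G := by ext I; simp [mul_add]
  map_smul' c F := by ext I; simp; ring

/-- The operator `H_{i,r}` on functions of partitions. -/
def hOp (i : Fin (2 * n)) (r : ℕ) : Module.End L (SymPart n d → L) :=
  diag fun I => (hSer h x i I).coeff (r + 1) / h

variable {h x}

theorem diag_apply (g F : SymPart n d → L) (I : SymPart n d) : diag g F I = g I * F I := rfl

theorem hOp_apply (i : Fin (2 * n)) (r : ℕ) (F : SymPart n d → L) (I : SymPart n d) :
    hOp h x i r F I = (hSer h x i I).coeff (r + 1) / h * F I := rfl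

theorem comm_hOp_hOp (i j : Fin (2 * n)) (r s : ℕ) :
    comm (hOp h x i r) (hOp h x j s : Module.End L (SymPart n d → L)) = 0 := by
  ext F I
  simp only [comm, LinearMap.sub_apply, Module.End.mul_apply, Pi.sub_apply, hOp_apply,
    LinearMap.zero_apply, Pi.zero_apply]
  ring

theorem coeff_one_prod_one_add {R : Type*} [CommRing R] {ι : Type*} [DecidableEq ι]
    (s : Finset ι) (f : ι → PowerSeries R) (hf : ∀ t ∈ s, PowerSeries.coeff 0 (f t) = 1) :
    PowerSeries.coeff 0 (∏ t ∈ s, f t) = 1 ∧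
      PowerSeries.coeff 1 (∏ t ∈ s, f t) = ∑ t ∈ s, PowerSeries.coeff 1 (f t) := by
  induction s using Finset.induction_on with
  | empty => simp [PowerSeries.coeff_one]
  | insert t s ht ih =>
    obtain ⟨h0, h1⟩ := ih fun t' ht' => hf t' (Finset.mem_insert_of_mem ht')
    have ht0 := hf t (Finset.mem_insert_self _ _)
    rw [PowerSeries.coeff_zero_eq_constantCoeff_apply] at h0 ht0 ⊢
    rw [Finset.prod_insert ht, Finset.sum_insert ht, PowerSeries.coeff_one_mul, map_mul, h0, h1,
      ht0]
    simp

theorem coeff_one_hSer (hx : Generic h x) (i : Fin (2 * n)) (I : SymPart n d) :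
    (hSer h x i I).coeff 1 = (∑ t, sgn L i (I.val t) - deltaSign i / 4) * h := by
  have := coeff_ofPowerSeries_natCast (hPow h (deltaSign i / 4 * h) (spec h x i) i I) 1
  rw [Nat.cast_one] at this
  rw [hSer_eq_ofPowerSeries hx, this, hPow]
  have e : ∀ t, (if I.val t = i.castSucc then
      1 + PowerSeries.C h * PowerSeries.X * PowerSeries.mk fun k => spec h x i t ^ k
      else if I.val t = i.succ then
      1 - PowerSeries.C h * PowerSeries.X * PowerSeries.mk fun k => spec h x i t ^ k
      else 1) = 1 + PowerSeries.X *
        (PowerSeries.C (sgn L i (I.val t) * h) * PowerSeries.mk fun k => spec h x i t ^ k) := by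
    intro t
    rw [sgn]
    split_ifs
    · rw [one_mul]; ring
    · rw [neg_one_mul, map_neg]; ring
    · simp
  simp only [e]
  have e1 : ∀ G : PowerSeries L, PowerSeries.coeff 1 (1 + PowerSeries.X * G) =
      PowerSeries.coeff 0 G := by
    intro G
    rw [map_add, PowerSeries.coeff_one, if_neg one_ne_zero, zero_add]
    exact PowerSeries.coeff_succ_X_mul 0 G
  have e0 : ∀ G : PowerSeries L, PowerSeries.coeff 0 (1 + PowerSeries.X * G) = 1 := by
    intro G; simp
  have h1 := coeff_one_prod_one_add Finset.univ (fun t => 1 + PowerSeries.X *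
        (PowerSeries.C (sgn L i (I.val t) * h) * PowerSeries.mk fun k => spec h x i t ^ k))
    (fun t _ => e0 _)
  -- A product over `Bool` applies the same lemma to the prefactor times the product over letters.
  have h2 := coeff_one_prod_one_add Finset.univ
    (fun b : Bool => if b then 1 - PowerSeries.C (deltaSign i / 4 * h) * PowerSeries.X else
      ∏ t, (1 + PowerSeries.X *
        (PowerSeries.C (sgn L i (I.val t) * h) * PowerSeries.mk fun k => spec h x i t ^ k)))
    (by
      rintro (_ | _) _
      · exact h1.1
      · simp)
  have h3 := h2.2
  rw [Fintype.prod_bool, Fintype.sum_bool] at h3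
  simp only [if_true, Bool.false_eq_true, if_false] at h3
  rw [h3, h1.2]
  simp only [e1]
  have e4 : PowerSeries.coeff 1 (1 - PowerSeries.C (deltaSign i / 4 * h) * PowerSeries.X) =
      -(deltaSign i / 4 * h) := by
    rw [map_sub, PowerSeries.coeff_one, if_neg one_ne_zero, PowerSeries.coeff_C_mul,
      PowerSeries.coeff_one_X]
    ring
  rw [e4]
  simp only [PowerSeries.coeff_C_mul, PowerSeries.coeff_mk, pow_zero, mul_one, ← Finset.sum_mul]
  ring

theorem deltaSign_rev (i : Fin (2 * n)) : (deltaSign i.rev : L) = -deltaSign i := by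
  have hr := Fin.val_rev i
  have e1 : ((i.rev : ℕ) + 1 = n) ↔ (i : ℕ) + 1 = n + 1 := by omega
  have e2 : ((i.rev : ℕ) + 1 = n + 1) ↔ (i : ℕ) + 1 = n := by omega
  rw [deltaSign, deltaSign]
  simp only [e1, e2]
  ring

theorem hOp_rev_zero (hx : Generic h x) (i : Fin (2 * n)) :
    (hOp h x i.rev 0 : Module.End L (SymPart n d → L)) = -hOp h x i 0 := by
  ext F I
  rw [LinearMap.neg_apply, Pi.neg_apply, hOp_apply, hOp_apply, Nat.cast_zero, zero_add,
    coeff_one_hSer hx, coeff_one_hSer hx, deltaSign_rev]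
  have : ∑ t, sgn L i.rev (I.val t) = -∑ t, sgn L i (I.val t) := by
    rw [← Finset.sum_neg_distrib, ← Equiv.sum_comp Fin.revPerm]
    refine Finset.sum_congr rfl fun t _ => ?_
    rw [Fin.revPerm_apply, I.symm, sgn_rev_rev]
  rw [this]
  ring

theorem move_diag_apply (g : SymPart n d → L) (j : Fin (2 * n)) (m : Fin (2 * d))
    (F : SymPart n d → L) (I : SymPart n d) :
    (move h x j m * diag g) F I = g (shift j m I) * (weight h x I j m * F (shift j m I)) := by
  rw [Module.End.mul_apply, move_apply, diag_apply]
  ring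

theorem diag_move_apply (g : SymPart n d → L) (j : Fin (2 * n)) (m : Fin (2 * d))
    (F : SymPart n d → L) (I : SymPart n d) :
    (diag g * move h x j m) F I = g I * (weight h x I j m * F (shift j m I)) := by
  rw [Module.End.mul_apply, diag_apply, move_apply]

theorem comm_diag_move_apply (g : SymPart n d → L) (j : Fin (2 * n)) (m : Fin (2 * d))
    (F : SymPart n d → L) (I : SymPart n d) :
    comm (diag g) (move h x j m) F I =
      (g I - g (shift j m I)) * (weight h x I j m * F (shift j m I)) := by
  rw [comm, LinearMap.sub_apply, Pi.sub_apply, move_diag_apply, diag_move_apply]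
  ring

theorem anti_diag_move_apply (g : SymPart n d → L) (j : Fin (2 * n)) (m : Fin (2 * d))
    (F : SymPart n d → L) (I : SymPart n d) :
    anti (diag g) (move h x j m) F I =
      (g I + g (shift j m I)) * (weight h x I j m * F (shift j m I)) := by
  rw [anti, LinearMap.add_apply, Pi.add_apply, move_diag_apply, diag_move_apply]
  ring

theorem bOp_mul_bOp (c : L) (i j : Fin (2 * n)) (r s : ℕ) :
    (bOp h x c i r * bOp h x c j s : Module.End L (SymPart n d → L)) =
      c ^ 2 • ∑ k, ∑ l, (spec h x i k ^ r * spec h x j l ^ s) • (move h x i k * move h x j l) := by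
  rw [bOp, bOp, smul_mul_smul_comm, ← pow_two, Finset.sum_mul_sum]
  simp only [smul_mul_smul_comm]

theorem bOp_mul_bOp' (c : L) (i j : Fin (2 * n)) (r s : ℕ) :
    (bOp h x c j s * bOp h x c i r : Module.End L (SymPart n d → L)) =
      c ^ 2 • ∑ k, ∑ l, (spec h x i k ^ r * spec h x j l ^ s) • (move h x j l * move h x i k) := by
  rw [bOp_mul_bOp, Finset.sum_comm]
  simp only [mul_comm]

theorem cart_rev_self (i : Fin (2 * n)) :
    cart L i i.rev = if (i : ℕ) + 1 = i.rev ∨ (i.rev : ℕ) + 1 = i then -1 else 0 := by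
  have : i ≠ i.rev := by
    intro h
    have := congrArg Fin.val h
    rw [Fin.val_rev] at this
    omega
  split_ifs with hi
  · rcases hi with hi | hi
    · exact cart_succ hi
    · exact cart_pred hi
  · exact cart_of_ne this (by tauto) (by tauto)

theorem deltaSign_eq (i : Fin (2 * n)) : (deltaSign i : L) =
    (if (i : ℕ) + 1 = i.rev then 1 else 0) - (if (i.rev : ℕ) + 1 = i then 1 else 0) := by
  have hr := Fin.val_rev i
  have e1 : ((i : ℕ) + 1 = n) ↔ (i : ℕ) + 1 = i.rev := by omega
  have e2 : ((i : ℕ) + 1 = n + 1) ↔ (i.rev : ℕ) + 1 = i := by omega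
  rw [deltaSign]
  simp only [e1, e2]

variable [CharZero L]

theorem comm_hOp_zero_move (hx : Generic h x) (i j : Fin (2 * n)) (m : Fin (2 * d)) :
    comm (hOp h x i 0) (move h x j m) = (cart L i j - cart L i.rev j) •
      (move h x j m : Module.End L (SymPart n d → L)) := by
  ext F I
  rw [hOp, comm_diag_move_apply, LinearMap.smul_apply, Pi.smul_apply, move_apply, smul_eq_mul]
  by_cases hm : I.val m = j.castSucc
  · congr 1
    -- At `k = -1` the coefficients of index `-1` vanish and those of index 0 are 1, so only the
    -- constant term of the commutator survives.
    have := hSer_shift_coeff hx i j m I hm (-1)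
    rw [hSer_coeff_neg hx i I (k := -1) (by norm_num),
      hSer_coeff_neg hx i _ (k := -1) (by norm_num), show (-1 : ℤ) + 2 = 1 from rfl,
      show (-1 : ℤ) + 1 = 0 from rfl, hSer_coeff_zero hx, hSer_coeff_zero hx] at this
    have h0 := hx.ne_zero
    rw [Nat.cast_zero, zero_add, ← sub_div, this]
    field_simp
    ring
  · rw [weight_of_ne hm]; simp

theorem comm_hOp_one_move (hx : Generic h x) (i j : Fin (2 * n)) (m : Fin (2 * d)) :
    comm (hOp h x i 1) (move h x j m) =
      ((cart L i j + cart L i.rev j) * spec h x j m) • move h x j m +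
      ((cart L i j - cart L i.rev j) / 2 * h) • anti (hOp h x i 0)
      (move h x j m : Module.End L (SymPart n d → L)) := by
  ext F I
  rw [hOp, hOp, comm_diag_move_apply, LinearMap.add_apply, Pi.add_apply, LinearMap.smul_apply,
    Pi.smul_apply, LinearMap.smul_apply, Pi.smul_apply, move_apply, smul_eq_mul, smul_eq_mul,
    anti_diag_move_apply]
  by_cases hm : I.val m = j.castSucc
  · have := hSer_shift_coeff hx i j m I hm 0
    rw [hSer_coeff_zero hx, hSer_coeff_zero hx] at this
    have h0 := hx.ne_zero
    rw [Nat.cast_zero, Nat.cast_one, one_add_one_eq_two]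
    rw [zero_add] at this
    rw [← sub_div, this]
    field_simp
    ring
  · rw [weight_of_ne hm]; simp

theorem comm_hOp_move (hx : Generic h x) (i j : Fin (2 * n)) (m : Fin (2 * d)) (r : ℕ) :
    comm (hOp h x i (r + 2)) (move h x j m) - spec h x j m ^ 2 • comm (hOp h x i r) (move h x j m) =
      ((cart L i j - cart L i.rev j) / 2 * h) • anti (hOp h x i (r + 1)) (move h x j m) +
      ((cart L i j + cart L i.rev j) / 2 * h * spec h x j m) •
        anti (hOp h x i r) (move h x j m) +
      (cart L i j * cart L i.rev j / 4 * h ^ 2) • comm (hOp h x i r)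
      (move h x j m : Module.End L (SymPart n d → L)) := by
  ext F I
  simp only [hOp, LinearMap.add_apply, Pi.add_apply, LinearMap.smul_apply, LinearMap.sub_apply,
    Pi.sub_apply, Pi.smul_apply, smul_eq_mul, comm_diag_move_apply, anti_diag_move_apply]
  by_cases hm : I.val m = j.castSucc
  · have := hSer_shift_coeff hx i j m I hm (r + 1)
    have e1 : ((r + 2 : ℕ) : ℤ) + 1 = r + 1 + 2 := by push_cast; ring
    have e2 : ((r + 1 : ℕ) : ℤ) + 1 = r + 1 + 1 := by push_cast; ring
    rw [e1, e2]
    have h0 := hx.ne_zero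
    rw [← sub_div, this]
    field_simp
    ring
  · rw [weight_of_ne hm]; simp

theorem comm_hOp_zero_bOp (hx : Generic h x) (c : L) (i j : Fin (2 * n)) (r : ℕ) :
    comm (hOp h x i 0) (bOp h x c j r) = (cart L i j - cart L i.rev j) •
      (bOp h x c j r : Module.End L (SymPart n d → L)) := by
  rw [bOp, comm_smul_sum, smul_smul_sum]
  congr 1
  refine Finset.sum_congr rfl fun k _ => ?_
  rw [comm_hOp_zero_move hx, smul_comm]

theorem comm_hOp_one_bOp (hx : Generic h x) (c : L) (i j : Fin (2 * n)) (r : ℕ) :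
    comm (hOp h x i 1) (bOp h x c j r) =
      (cart L i j + cart L i.rev j) • bOp h x c j (r + 1) +
      ((cart L i j - cart L i.rev j) / 2 * h) • anti (hOp h x i 0)
      (bOp h x c j r : Module.End L (SymPart n d → L)) := by
  simp only [bOp, comm_smul_sum, anti_smul_sum, smul_smul_sum, ← smul_add,
    ← Finset.sum_add_distrib]
  congr 1
  refine Finset.sum_congr rfl fun k _ => ?_
  rw [comm_hOp_one_move hx, pow_succ]
  module

theorem comm_hOp_bOp (hx : Generic h x) (c : L) (i j : Fin (2 * n)) (r s : ℕ) :
    comm (hOp h x i (r + 2)) (bOp h x c j s) - comm (hOp h x i r) (bOp h x c j (s + 2)) =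
      ((cart L i j - cart L i.rev j) / 2 * h) • anti (hOp h x i (r + 1)) (bOp h x c j s) +
      ((cart L i j + cart L i.rev j) / 2 * h) • anti (hOp h x i r) (bOp h x c j (s + 1)) +
      (cart L i j * cart L i.rev j / 4 * h ^ 2) • comm (hOp h x i r)
      (bOp h x c j s : Module.End L (SymPart n d → L)) := by
  simp only [bOp, comm_smul_sum, anti_smul_sum, smul_smul_sum, ← smul_add, ← smul_sub,
    ← Finset.sum_add_distrib, ← Finset.sum_sub_distrib]
  congr 1
  refine Finset.sum_congr rfl fun k _ => ?_
  have := comm_hOp_move hx i j k r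
  calc _ = spec h x j k ^ s • (comm (hOp h x i (r + 2)) (move h x j k) -
        spec h x j k ^ 2 • comm (hOp h x i r) (move h x j k)) := by
        rw [smul_sub, smul_smul, pow_add]
    _ = _ := by
        rw [this, pow_succ]
        module

/-! ### The relations between the operators `B` -/

/-- The expression is `x_l - x_k` plus a rational multiple of `h`. By genericity it can vanish only
if the rational coefficient is zero and `k = l`; the hypothesis excludes this. -/
theorem spec_sub_spec_add_ne (hx : Generic h x) (i j : Fin (2 * n)) (k l : Fin (2 * d)) (q : ℚ)
    (hq : q ≠ ((j : ℚ) - i) / 2 ∨ k ≠ l) : spec h x i k - spec h x j l + q * h ≠ 0 := by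
  have e : spec h x i k - spec h x j l + q * h =
      x l - x k + ((q + ((i : ℚ) - j) / 2 : ℚ) : L) * h := by
    rw [spec, spec, hshift, hshift]
    push_cast
    field_simp
    ring
  rw [e]
  by_cases h0 : q + ((i : ℚ) - j) / 2 = 0
  · rw [h0]
    have : k ≠ l := by
      rcases hq with hq | hq
      · exact absurd (by linear_combination h0) hq
      · exact hq
    simpa using hx.sub_ne_zero (Ne.symm this)
  · intro h1
    apply hx.sub_ne l k (-(q + ((i : ℚ) - j) / 2)) (neg_ne_zero.2 h0)
    rw [Rat.cast_neg]
    linear_combination h1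

theorem move_rev_mul_move_apply (hx : Generic h x) (i : Fin (2 * n))
    (k : Fin (2 * d)) (F : SymPart n d → L) (I : SymPart n d) :
    (move h x i.rev k.rev * move h x i k) F I = (if I.val k = i.succ then
      resid h x i k I * (if (i.rev : ℕ) + 1 = i then 1 - h / (2 * x k) else 1) else 0) * F I := by
  have := move_mul_move_rev_apply hx i.rev k.rev F I
  rw [Fin.rev_rev, Fin.rev_rev, I.symm, resid_rev hx, hx.rev] at this
  rw [this]
  have e : ((I.val k).rev = i.rev.castSucc) ↔ I.val k = i.succ := by
    rw [← Fin.rev_succ, Fin.rev_inj]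
  simp only [e]
  congr 3
  rw [mul_neg, div_neg, sub_eq_add_neg]

theorem hshift_of_succ_eq_rev {i : Fin (2 * n)} (hi : (i : ℕ) + 1 = i.rev) :
    hshift h i = h / 4 := by
  have := hshift_succ h hi
  rw [hshift_rev] at this
  linear_combination this / 2

/-- Both products are diagonal, with the common factor `resid`. If `i` and `τ i` are adjacent, the
correction `1 ± h / (2 x_k)` in one of them combines with its scalar to `2 (spec - δ h / 4)`, the
value that the other one has without correction. This is the origin of the prefactor in
`H_{i,v}(u)`. -/
theorem move_mul_move_rev_comm (hx : Generic h x) (i : Fin (2 * n)) (k : Fin (2 * d))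
    (F : SymPart n d → L) (I : SymPart n d) :
    (2 * spec h x i k - cart L i i.rev * h / 2) * (move h x i k * move h x i.rev k.rev) F I -
      (2 * spec h x i k + cart L i i.rev * h / 2) * (move h x i.rev k.rev * move h x i k) F I =
    2 * sgn L i (I.val k) * (spec h x i k - deltaSign i / 4 * h) * resid h x i k I * F I := by
  have hr := Fin.val_rev i
  have hxk := hx.apply_ne_zero k
  rw [move_mul_move_rev_apply hx, move_rev_mul_move_apply hx, cart_rev_self, deltaSign_eq, sgn]
  have a1 : i.castSucc ≠ i.succ := by simp [Fin.ext_iff]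
  have d0 : ¬((i : ℕ) + 1 = i.rev ∧ (i.rev : ℕ) + 1 = i) := by omega
  by_cases b1 : (i : ℕ) + 1 = i.rev
  · have b2 : ¬((i.rev : ℕ) + 1 = i) := fun b2 => d0 ⟨b1, b2⟩
    simp only [b1, b2, true_or, if_true, if_false, spec, hshift_of_succ_eq_rev b1]
    by_cases c1 : I.val k = i.castSucc
    · simp only [c1, a1, if_true, if_false]
      field_simp
      ring
    · by_cases c2 : I.val k = i.succ
      · simp only [c2, a1.symm, if_true, if_false]
        ring
      · simp only [c1, c2, if_false]
        ring
  by_cases b2 : (i.rev : ℕ) + 1 = i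
  · have h1 := hshift_of_succ_eq_rev (h := h) (i := i.rev) (by rw [Fin.rev_rev]; exact b2)
    rw [hshift_rev] at h1
    have h2 : hshift h i = -(h / 4) := by linear_combination -h1
    simp only [b1, b2, or_true, if_true, if_false, spec, h2]
    by_cases c1 : I.val k = i.castSucc
    · simp only [c1, a1, if_true, if_false]
      ring
    · by_cases c2 : I.val k = i.succ
      · simp only [c2, a1.symm, if_true, if_false]
        field_simp
        ring
      · simp only [c1, c2, if_false]
        ring
  simp only [b1, b2, or_false, if_false]
  by_cases c1 : I.val k = i.castSucc
  · simp only [c1, a1, if_true, if_false]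
    ring
  · by_cases c2 : I.val k = i.succ
    · simp only [c2, a1.symm, if_true, if_false]
      ring
    · simp only [c1, c2, if_false]
      ring

theorem sum_spec_pow_resid_rev (hx : Generic h x) (i : Fin (2 * n)) (I : SymPart n d)
    (g : L → L) : ∑ k, sgn L i (I.val k) * g (spec h x i k) * resid h x i k I =
      ∑ t, -sgn L i.rev (I.val t) * g (-spec h x i.rev t) * resid h x i.rev t I := by
  rw [← Equiv.sum_comp Fin.revPerm]
  refine Finset.sum_congr rfl fun t _ => ?_
  have h1 := sgn_rev_rev (L := L) i.rev (I.val t)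
  have h2 := spec_rev hx i.rev t
  have h3 := resid_rev hx i.rev t I
  rw [Fin.rev_rev] at h1 h2 h3
  rw [Fin.revPerm_apply, I.symm, h1, h2, h3]

/-- Expanded in letters, all terms cancel by `move_comm` except those with `l = k'` in the case `j =
τ i`. These are residues, and their sum is a coefficient of `H_{τi}(u)`. -/
theorem bOp_bOp (hx : Generic h x) {c : L} (hc : c ^ 2 = -1) (i j : Fin (2 * n)) (r s : ℕ) :
    comm (bOp h x c i (r + 1)) (bOp h x c j s) - comm (bOp h x c i r) (bOp h x c j (s + 1)) =
      (cart L i j / 2 * h) • anti (bOp h x c i r) (bOp h x c j s) -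
      if i.rev = j then (2 * (-1) ^ r : L) • hOp h x j (r + s + 1)
        else (0 : Module.End L (SymPart n d → L)) := by
  have key : comm (bOp h x c i (r + 1)) (bOp h x c j s) -
      comm (bOp h x c i r) (bOp h x c j (s + 1)) -
      (cart L i j / 2 * h) • anti (bOp h x c i r) (bOp h x c j s) =
      -∑ k, ∑ l, (spec h x i k ^ r * spec h x j l ^ s) •
        ((spec h x i k - spec h x j l - cart L i j * h / 2) • (move h x i k * move h x j l) -
          (spec h x i k - spec h x j l + cart L i j * h / 2) •
          (move h x j l * move h x i k : Module.End L (SymPart n d → L))) := by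
    simp only [comm, anti, bOp_mul_bOp c i j, bOp_mul_bOp' c i j, hc, neg_smul, one_smul, smul_neg, ← neg_add,
      Finset.smul_sum, ← Finset.sum_neg_distrib, ← Finset.sum_sub_distrib,
      ← Finset.sum_add_distrib]
    refine Finset.sum_congr rfl fun k _ => Finset.sum_congr rfl fun l _ => ?_
    rw [pow_succ, pow_succ]
    module
  rw [sub_eq_iff_eq_add] at key
  rw [key, add_comm, sub_eq_add_neg]
  congr 2
  have hz : ∀ k l, (l ≠ k.rev ∨ j ≠ i.rev) →
      (spec h x i k - spec h x j l - cart L i j * h / 2) • (move h x i k * move h x j l) -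
          (spec h x i k - spec h x j l + cart L i j * h / 2) •
          (move h x j l * move h x i k : Module.End L (SymPart n d → L)) = 0 :=
    fun k l hkl => sub_eq_zero.2 (move_comm hx i j k l hkl)
  split_ifs with hij
  · subst hij
    ext F I
    rw [LinearMap.smul_apply, Pi.smul_apply, hOp_apply, smul_eq_mul]
    have e1 : ((r + s + 1 : ℕ) : ℤ) + 1 = ((r + s : ℕ) : ℤ) + 2 := by push_cast; ring
    rw [e1, coeff_add_two_hSer hx]
    have e2 : ∀ k, ∑ l, (spec h x i k ^ r * spec h x i.rev l ^ s) •
        ((spec h x i k - spec h x i.rev l - cart L i i.rev * h / 2) •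
          (move h x i k * move h x i.rev l) -
          (spec h x i k - spec h x i.rev l + cart L i i.rev * h / 2) •
          (move h x i.rev l * move h x i k : Module.End L (SymPart n d → L))) =
        (spec h x i k ^ r * (-spec h x i k) ^ s) •
        ((2 * spec h x i k - cart L i i.rev * h / 2) • (move h x i k * move h x i.rev k.rev) -
          (2 * spec h x i k + cart L i i.rev * h / 2) •
          (move h x i.rev k.rev * move h x i k)) := by
      intro k
      rw [Finset.sum_eq_single k.rev]
      · rw [spec_rev hx, sub_neg_eq_add, ← two_mul]
      · intro l _ hl
        rw [hz k l (Or.inl hl), smul_zero]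
      · simp
    simp only [e2, LinearMap.sum_apply, Finset.sum_apply, LinearMap.smul_apply, Pi.smul_apply,
      LinearMap.sub_apply, Pi.sub_apply, smul_eq_mul, move_mul_move_rev_comm hx]
    -- The mirror replaces the residues of `H_i(u)` by those of `H_{τi}(u)` and negates the spectral
    -- parameter, which is the source of the sign `(-1)^r`.
    have e3 := sum_spec_pow_resid_rev hx i I
      (fun z => z ^ r * (-z) ^ s * (2 * (z - deltaSign i / 4 * h)))
    have h0 := hx.ne_zero
    calc _ = (∑ k, sgn L i (I.val k) * (spec h x i k ^ r * (-spec h x i k) ^ s *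
          (2 * (spec h x i k - deltaSign i / 4 * h))) * resid h x i k I) * F I := by
          rw [Finset.sum_mul]
          exact Finset.sum_congr rfl fun k _ => by ring
      _ = _ := by
          rw [e3, Finset.sum_div, ← mul_assoc, Finset.mul_sum, Finset.sum_mul, Finset.sum_mul]
          refine Finset.sum_congr rfl fun t _ => ?_
          rw [deltaSign_rev, neg_neg, pow_add, neg_pow]
          field_simp
          ring
  · refine Finset.sum_eq_zero fun k _ => Finset.sum_eq_zero fun l _ => ?_
    rw [hz k l (Or.inr (Ne.symm hij)), smul_zero]

/-- With `c_{ij} = 0` the scalars on both sides of the exchange relation agree and can be cancelled.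
If moreover `j = τ i`, then `δ = 0`, and the sum of residues is the coefficient one index lower than
in `bOp_bOp`. -/
theorem comm_bOp_bOp_of_cart_eq_zero (hx : Generic h x) {c : L} (hc : c ^ 2 = -1)
    {i j : Fin (2 * n)} (hij : cart L i j = 0) (r s : ℕ) :
    comm (bOp h x c i r) (bOp h x c j s) =
      if i.rev = j then ((-1) ^ r : L) • hOp h x j (r + s)
        else (0 : Module.End L (SymPart n d → L)) := by
  have hne : i ≠ j := by
    rintro rfl
    rw [cart_self] at hij
    exact two_ne_zero hij
  have key : comm (bOp h x c i r) (bOp h x c j s) =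
      -∑ k, ∑ l, (spec h x i k ^ r * spec h x j l ^ s) •
        (move h x i k * move h x j l -
          (move h x j l * move h x i k : Module.End L (SymPart n d → L))) := by
    simp only [comm, bOp_mul_bOp c i j, bOp_mul_bOp' c i j, hc, Finset.smul_sum, ← Finset.sum_neg_distrib,
      ← Finset.sum_sub_distrib]
    refine Finset.sum_congr rfl fun k _ => Finset.sum_congr rfl fun l _ => ?_
    module
  have hz : ∀ k l, (l ≠ k.rev ∨ j ≠ i.rev) →
      (move h x i k * move h x j l -
          (move h x j l * move h x i k : Module.End L (SymPart n d → L))) = 0 := by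
    intro k l hkl
    have h1 := move_comm hx i j k l hkl
    rw [hij, zero_mul, zero_div, sub_zero, add_zero] at h1
    have h2 := spec_sub_spec_add_ne hx i j k l 0 (Or.inl (by
      intro h0
      apply hne
      have : (j : ℚ) = i := by linarith
      exact Fin.ext (by exact_mod_cast this.symm)))
    rw [Rat.cast_zero, zero_mul, add_zero] at h2
    exact sub_eq_zero.2 (smul_right_injective _ h2 h1)
  rw [key]
  split_ifs with hr
  · subst hr
    ext F I
    rw [LinearMap.smul_apply, Pi.smul_apply, hOp_apply, smul_eq_mul]
    have hd : (deltaSign i : L) = 0 := by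
      rw [cart_rev_self] at hij
      rw [deltaSign_eq]
      split_ifs at hij with h1
      · simp at hij
      · rw [if_neg (by tauto), if_neg (by tauto), sub_zero]
    have e2 : ∀ k, ∑ l, (spec h x i k ^ r * spec h x i.rev l ^ s) •
        (move h x i k * move h x i.rev l -
          (move h x i.rev l * move h x i k : Module.End L (SymPart n d → L))) =
        (spec h x i k ^ r * (-spec h x i k) ^ s) •
        (move h x i k * move h x i.rev k.rev - move h x i.rev k.rev * move h x i k) := by
      intro k
      rw [Finset.sum_eq_single k.rev]
      · rw [spec_rev hx]
      · intro l _ hl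
        rw [hz k l (Or.inl hl), smul_zero]
      · simp
    have e4 : ∀ k, (move h x i k * move h x i.rev k.rev) F I -
        (move h x i.rev k.rev * move h x i k) F I =
        sgn L i (I.val k) * resid h x i k I * F I := by
      intro k
      have hi : ¬((i : ℕ) + 1 = i.rev ∨ (i.rev : ℕ) + 1 = i) := by
        intro h1
        rw [cart_rev_self, if_pos h1] at hij
        simp at hij
      rw [move_mul_move_rev_apply hx, move_rev_mul_move_apply hx, if_neg (by tauto : ¬_ + 1 = _),
        if_neg (by tauto : ¬_ + 1 = _), sgn]
      by_cases c1 : I.val k = i.castSucc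
      · rw [if_pos c1, if_pos c1, if_neg (by rw [c1]; simp [Fin.ext_iff])]
        ring
      · rw [if_neg c1, if_neg c1]
        split_ifs <;> ring
    have hd2 : (deltaSign i.rev : L) = 0 := by rw [deltaSign_rev, hd, neg_zero]
    simp only [e2, LinearMap.neg_apply, Pi.neg_apply, LinearMap.sum_apply, Finset.sum_apply,
      LinearMap.smul_apply, Pi.smul_apply,
      LinearMap.sub_apply, Pi.sub_apply, smul_eq_mul, e4]
    have e3 := sum_spec_pow_resid_rev hx i I (fun z => z ^ r * (-z) ^ s)
    have h0 := hx.ne_zero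
    rw [coeff_add_one_hSer hx hd2]
    calc _ = -(∑ k, sgn L i (I.val k) * (spec h x i k ^ r * (-spec h x i k) ^ s) *
          resid h x i k I) * F I := by
          rw [neg_mul, Finset.sum_mul]
          congr 1
          exact Finset.sum_congr rfl fun k _ => by ring
      _ = _ := by
          rw [e3, Finset.sum_div, ← mul_assoc, Finset.mul_sum, ← Finset.sum_neg_distrib]
          congr 1
          refine Finset.sum_congr rfl fun t _ => ?_
          rw [neg_neg, pow_add, neg_pow]
          field_simp
  · rw [neg_eq_zero]
    refine Finset.sum_eq_zero fun k _ => Finset.sum_eq_zero fun l _ => ?_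
    rw [hz k l (Or.inr (Ne.symm hr)), smul_zero]

end Relations

/-! ### The Serre relations -/

section SerreAlgebra

variable {L A : Type*} [Field L] [Ring A] [Algebra L A]

/-- The symmetrization in `a` and `b` of `[a, [b, f]]`. -/
def serreSum (a b f : A) : A := comm a (comm b f) + comm b (comm a f)

theorem serreSum_symm (a b f : A) : serreSum a b f = serreSum b a f := add_comm _ _

theorem serreSum_eq (a b f : A) : serreSum a b f =
    a * b * f + b * a * f - (2 : ℤ) • (a * f * b) - (2 : ℤ) • (b * f * a) + f * a * b +
      f * b * a := by
  simp only [serreSum, comm]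
  noncomm_ring

theorem eq_smul_of_smul_eq {a b : L} {y z : A} (ha : a ≠ 0) (hyz : a • y = b • z) :
    y = (b / a) • z := by
  rw [div_eq_inv_mul, mul_smul, ← hyz, inv_smul_smul₀ ha]

theorem comm_comm_smul_sum {ι : Type*} [Fintype ι] (c : L) (a₁ a₂ a₃ : ι → L) (e f : ι → A) :
    comm (c • ∑ k, a₁ k • e k) (comm (c • ∑ m, a₂ m • e m) (c • ∑ l, a₃ l • f l)) =
      c ^ 3 • ∑ k, ∑ m, (a₁ k * a₂ m) • ∑ l, a₃ l • comm (e k) (comm (e m) (f l)) := by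
  rw [smul_sum_comm, smul_sum_comm]
  simp only [comm_smul_sum]
  simp only [Finset.smul_sum, smul_smul]
  refine Finset.sum_congr rfl fun k _ => Finset.sum_congr rfl fun m _ =>
    Finset.sum_congr rfl fun l _ => ?_
  congr 1
  ring

variable [CharZero L]

/-- Here `z` and `v` stand for the differences of spectral parameters of `(a, b)` and `(b, f)`. Only
these two pairs are exchanged, to bring `b` to the left; `a` and `f` keep both orders, so the
formula also applies when `(a, f)` is the exceptional pair. -/
theorem serreSum_left {a b f : A} {z v h : L} (hz : z - h ≠ 0) (hv : v - h / 2 ≠ 0)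
    (hab : (z - h) • (a * b) = (z + h) • (b * a))
    (hbf : (v + h / 2) • (b * f) = (v - h / 2) • (f * b)) :
    serreSum a b f = b * ((-(h * (2 * z + 2 * v + h)) / ((z - h) * (v - h / 2))) • (a * f) +
      ((h * (2 * z + 2 * v - h)) / ((z - h) * (v - h / 2))) • (f * a)) := by
  have e1 := eq_smul_of_smul_eq hz hab
  have e2 := eq_smul_of_smul_eq hv hbf.symm
  have f1 : a * f * b = ((v + h / 2) / (v - h / 2)) • ((z + h) / (z - h)) • (b * (a * f)) := by
    rw [mul_assoc, e2, mul_smul_comm, ← mul_assoc, e1, smul_mul_assoc, mul_assoc]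
  have f2 : f * a * b = ((z + h) / (z - h)) • ((v + h / 2) / (v - h / 2)) • (b * (f * a)) := by
    rw [mul_assoc, e1, mul_smul_comm, ← mul_assoc, e2, smul_mul_assoc, mul_assoc]
  have f3 : f * b * a = ((v + h / 2) / (v - h / 2)) • (b * (f * a)) := by
    rw [e2, smul_mul_assoc, mul_assoc]
  have f4 : a * b * f = ((z + h) / (z - h)) • (b * (a * f)) := by
    rw [e1, smul_mul_assoc, mul_assoc]
  have hv' : 2 * v - h ≠ 0 := fun h0 => hv (by linear_combination h0 / 2)
  rw [serreSum_eq, f1, f2, f3, f4, mul_assoc b a f, mul_assoc b f a, mul_add, mul_smul_comm,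
    mul_smul_comm]
  match_scalars <;> (field_simp; ring)

theorem serreSum_right {a b f : A} {z v h : L} (hz : z + h ≠ 0) (hv : v + h / 2 ≠ 0)
    (hab : (z - h) • (a * b) = (z + h) • (b * a))
    (hbf : (v + h / 2) • (b * f) = (v - h / 2) • (f * b)) :
    serreSum a b f = ((-(h * (2 * z + 2 * v + h)) / ((z + h) * (v + h / 2))) • (a * f) +
      ((h * (2 * z + 2 * v - h)) / ((z + h) * (v + h / 2))) • (f * a)) * b := by
  have e1 := eq_smul_of_smul_eq hz hab.symm
  have e2 := eq_smul_of_smul_eq hv hbf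
  have f1 : a * b * f = ((v - h / 2) / (v + h / 2)) • (a * f * b) := by
    rw [mul_assoc, e2, mul_smul_comm, ← mul_assoc]
  have f2 : f * b * a = ((z - h) / (z + h)) • (f * a * b) := by
    rw [mul_assoc, e1, mul_smul_comm, ← mul_assoc]
  have f3 : b * f * a = ((v - h / 2) / (v + h / 2)) • ((z - h) / (z + h)) • (f * a * b) := by
    rw [e2, smul_mul_assoc, mul_assoc, e1, mul_smul_comm, ← mul_assoc]
  have f4 : b * a * f = ((z - h) / (z + h)) • ((v - h / 2) / (v + h / 2)) • (a * f * b) := by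
    rw [e1, smul_mul_assoc, mul_assoc, e2, mul_smul_comm, ← mul_assoc]
  have hv' : 2 * v + h ≠ 0 := fun h0 => hv (by linear_combination h0 / 2)
  have hv'' : v * 2 + h ≠ 0 := by rwa [mul_comm v]
  rw [serreSum_eq, f1, f2, f3, f4, add_mul, smul_mul_assoc, smul_mul_assoc]
  match_scalars <;> (field_simp; ring)

/-- If `a` and `f` can be exchanged too, the bracket left by `serreSum_left` becomes a multiple of
`f * a` with coefficient zero. -/
theorem serreSum_eq_zero_left {a b f : A} {z v h : L} (hz : z - h ≠ 0) (hv : v - h / 2 ≠ 0)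
    (hu : z + v - h / 2 ≠ 0)
    (hab : (z - h) • (a * b) = (z + h) • (b * a))
    (haf : (z + v + h / 2) • (a * f) = (z + v - h / 2) • (f * a))
    (hbf : (v + h / 2) • (b * f) = (v - h / 2) • (f * b)) : serreSum a b f = 0 := by
  have hv' : 2 * v - h ≠ 0 := fun h0 => hv (by linear_combination h0 / 2)
  have hu' : 2 * (z + v) - h ≠ 0 := fun h0 => hu (by linear_combination h0 / 2)
  rw [serreSum_left hz hv hab hbf, eq_smul_of_smul_eq hu haf.symm, smul_smul, ← add_smul]
  convert mul_zero b
  convert zero_smul L _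
  field_simp
  ring

theorem serreSum_eq_zero_right {a b f : A} {z v h : L} (hz : z + h ≠ 0) (hv : v + h / 2 ≠ 0)
    (hu : z + v + h / 2 ≠ 0)
    (hab : (z - h) • (a * b) = (z + h) • (b * a))
    (haf : (z + v + h / 2) • (a * f) = (z + v - h / 2) • (f * a))
    (hbf : (v + h / 2) • (b * f) = (v - h / 2) • (f * b)) : serreSum a b f = 0 := by
  have hv' : 2 * v + h ≠ 0 := fun h0 => hv (by linear_combination h0 / 2)
  have hu' : 2 * (z + v) + h ≠ 0 := fun h0 => hu (by linear_combination h0 / 2)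
  rw [serreSum_right hz hv hab hbf, eq_smul_of_smul_eq hu haf, smul_smul, ← add_smul]
  convert zero_mul b
  convert zero_smul L _
  field_simp
  ring

theorem serreSum_of_mul_eq_zero {a b f : A} (hab : a * b = 0) (hba : b * a = 0) :
    serreSum a b f = -((2 : ℤ) • (a * f * b)) - (2 : ℤ) • (b * f * a) := by
  rw [serreSum_eq, hab, hba, mul_assoc f, mul_assoc f, hab, hba]
  simp

end SerreAlgebra

section Serre

variable {L : Type*} [Field L] [CharZero L] {n d : ℕ} {h : L} {x : Fin (2 * d) → L}

theorem move_comm_self (hx : Generic h x) (i : Fin (2 * n)) {k m : Fin (2 * d)} :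
    (spec h x i k - spec h x i m - h) • (move h x i k * move h x i m) =
      (spec h x i k - spec h x i m + h) •
        (move h x i m * move h x i k : Module.End L (SymPart n d → L)) := by
  have hi : i ≠ i.rev := by
    intro h
    have := congrArg Fin.val h
    rw [Fin.val_rev] at this
    omega
  have := move_comm hx i i k m (Or.inr hi)
  rwa [cart_self, mul_div_assoc, mul_div_cancel₀ _ two_ne_zero] at this

theorem move_comm_adjacent (hx : Generic h x) {i j : Fin (2 * n)} (hij : cart L i j = -1)
    {k l : Fin (2 * d)} (hkl : l ≠ k.rev ∨ j ≠ i.rev) :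
    (spec h x i k - spec h x j l + h / 2) • (move h x i k * move h x j l) =
      (spec h x i k - spec h x j l - h / 2) •
        (move h x j l * move h x i k : Module.End L (SymPart n d → L)) := by
  have := move_comm hx i j k l hkl
  rwa [hij, neg_one_mul, neg_div, sub_neg_eq_add, ← sub_eq_add_neg] at this

theorem spec_sub_spec_sub_ne (hx : Generic h x) (i : Fin (2 * n)) {k m : Fin (2 * d)}
    (q : ℚ) (hkm : k ≠ m) : spec h x i k - spec h x i m + q * h ≠ 0 :=
  spec_sub_spec_add_ne hx i i k m q (Or.inr hkm)

theorem move_mul_self (i : Fin (2 * n)) (k : Fin (2 * d)) :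
    (move h x i k * move h x i k : Module.End L (SymPart n d → L)) = 0 :=
  move_mul_move_self (by omega) k

theorem move_mul_rev (i : Fin (2 * n)) (k : Fin (2 * d)) :
    (move h x i k * move h x i k.rev : Module.End L (SymPart n d → L)) = 0 := by
  apply move_mul_move_rev
  intro h
  have := congrArg Fin.val h
  rw [Fin.val_rev] at this
  omega

theorem move_mul_move_of_mem_pair (i : Fin (2 * n)) {k m : Fin (2 * d)} (hm : m = k ∨ m = k.rev) :
    (move h x i k * move h x i m : Module.End L (SymPart n d → L)) = 0 := by
  rcases hm with rfl | rfl
  · exact move_mul_self _ _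
  · exact move_mul_rev _ _

theorem move_mul_move_mul_move_eq_zero {i j : Fin (2 * n)} {k m l : Fin (2 * d)}
    (hm : m = k ∨ m = k.rev) (hl : j ≠ i.rev ∨ (l ≠ k.rev ∧ l ≠ m.rev)) :
    (move h x i k * move h x j l * move h x i m : Module.End L (SymPart n d → L)) = 0 := by
  by_cases h1 : l = k
  · subst h1
    rcases hm with rfl | rfl
    · by_cases hij : (i : ℕ) + 1 = j
      · rw [mul_assoc, move_mul_move_self (by omega), mul_zero]
      · rw [move_mul_move_self hij, zero_mul]
    · have : i ≠ j.rev := by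
        rintro rfl
        rw [Fin.rev_rev, Fin.rev_rev] at hl
        tauto
      rw [mul_assoc, move_mul_move_rev this, mul_zero]
  by_cases h2 : l = k.rev
  · subst h2
    rw [move_mul_move_rev (by tauto), zero_mul]
  exact move_mul_move_mul_move h1 h2 hm

theorem mem_pair_symm {k m : Fin (2 * d)} (hm : m = k ∨ m = k.rev) : k = m ∨ k = m.rev := by
  rcases hm with rfl | rfl
  · exact Or.inl rfl
  · exact Or.inr (Fin.rev_rev k).symm

/-- For `m` in `{k, k'}` all triple products vanish. Otherwise the three exchange relations apply.
The left or the right form is chosen so that its denominators stay nonzero even when `l` equals `k`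
or `m`. -/
theorem serreSum_move_eq_zero (hx : Generic h x) {i j : Fin (2 * n)}
    (hij : (i : ℕ) + 1 = j ∨ (j : ℕ) + 1 = i) {k m l : Fin (2 * d)}
    (hl : j ≠ i.rev ∨ (l ≠ k.rev ∧ l ≠ m.rev)) :
    serreSum (move h x i k) (move h x i m) (move h x j l : Module.End L (SymPart n d → L)) = 0 := by
  by_cases hm : m = k ∨ m = k.rev
  · rw [serreSum_of_mul_eq_zero (move_mul_move_of_mem_pair i hm)
      (move_mul_move_of_mem_pair i (mem_pair_symm hm)), move_mul_move_mul_move_eq_zero hm hl,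
      move_mul_move_mul_move_eq_zero (mem_pair_symm hm) (by tauto)]
    simp
  · rw [not_or] at hm
    have hc : cart L i j = -1 := by
      rcases hij with hij | hij
      · exact cart_succ hij
      · exact cart_pred hij
    have h1 := move_comm_self hx i (k := k) (m := m)
    have h2 := move_comm_adjacent hx hc (k := k) (l := l) (by tauto)
    have h3 := move_comm_adjacent hx hc (k := m) (l := l) (by tauto)
    have e : spec h x i k - spec h x j l =
        (spec h x i k - spec h x i m) + (spec h x i m - spec h x j l) := by ring
    rw [e] at h2
    have z1 := spec_sub_spec_sub_ne hx i (-1) (Ne.symm hm.1)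
    have z2 := spec_sub_spec_sub_ne hx i 1 (Ne.symm hm.1)
    rcases hij with hij | hij
    -- For `j = i + 1` a coinciding letter has spectral difference `-h / 2`, which annihilates `v +
    -- h / 2` but not `v - h / 2`; hence the left form.
    · have hq : ((-1 / 2 : ℚ)) ≠ ((j : ℚ) - i) / 2 := by
        rw [← hij]; push_cast; ring_nf; norm_num
      have z3 := spec_sub_spec_add_ne hx i j k l (-1 / 2) (Or.inl hq)
      have z4 := spec_sub_spec_add_ne hx i j m l (-1 / 2) (Or.inl hq)
      refine serreSum_eq_zero_left (z := spec h x i k - spec h x i m)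
        (v := spec h x i m - spec h x j l) (h := h) ?_ ?_ ?_ h1 h2 h3
      · convert z1 using 1; push_cast; ring
      · convert z4 using 1; push_cast; ring
      · convert z3 using 1; push_cast; ring
    · have hq : ((1 / 2 : ℚ)) ≠ ((j : ℚ) - i) / 2 := by
        rw [← hij]; push_cast; ring_nf; norm_num
      have z3 := spec_sub_spec_add_ne hx i j k l (1 / 2) (Or.inl hq)
      have z4 := spec_sub_spec_add_ne hx i j m l (1 / 2) (Or.inl hq)
      refine serreSum_eq_zero_right (z := spec h x i k - spec h x i m)
        (v := spec h x i m - spec h x j l) (h := h) ?_ ?_ ?_ h1 h2 h3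
      · convert z2 using 1; push_cast; ring
      · convert z4 using 1; push_cast; ring
      · convert z3 using 1; push_cast; ring

theorem sym_comm_bOp (c : L) (i j : Fin (2 * n)) (k₁ k₂ r : ℕ) :
    sym (fun k l => comm (bOp h x c i k) (comm (bOp h x c i l) (bOp h x c j r))) k₁ k₂ =
      c ^ 3 • ∑ k, ∑ m, (spec h x i k ^ k₁ * spec h x i m ^ k₂) • ∑ l, spec h x j l ^ r •
        serreSum (move h x i k) (move h x i m)
          (move h x j l : Module.End L (SymPart n d → L)) := by
  rw [sym]
  simp only [bOp]
  rw [comm_comm_smul_sum, comm_comm_smul_sum, ← smul_add]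
  congr 1
  rw [Finset.sum_comm (f := fun k m => (spec h x i k ^ k₂ * spec h x i m ^ k₁) •
    ∑ l, spec h x j l ^ r • comm (move h x i k) (comm (move h x i m) (move h x j l))),
    ← Finset.sum_add_distrib]
  refine Finset.sum_congr rfl fun k _ => ?_
  rw [← Finset.sum_add_distrib]
  refine Finset.sum_congr rfl fun m _ => ?_
  rw [mul_comm (spec h x i m ^ k₂), ← smul_add, ← Finset.sum_add_distrib]
  simp only [← smul_add, serreSum]

theorem sym_comm_bOp_eq_zero (hx : Generic h x) (c : L) {i j : Fin (2 * n)}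
    (hij : (i : ℕ) + 1 = j ∨ (j : ℕ) + 1 = i) (hj : j ≠ i.rev) (k₁ k₂ r : ℕ) :
    sym (fun k l => comm (bOp h x c i k) (comm (bOp h x c i l)
      (bOp h x c j r : Module.End L (SymPart n d → L)))) k₁ k₂ = 0 := by
  rw [sym_comm_bOp]
  simp only [serreSum_move_eq_zero hx hij (Or.inl hj), smul_zero, Finset.sum_const_zero]

/-- Half of the contribution of a pair of letters to the exceptional Serre relation. -/
def halfSerre (h : L) (x : Fin (2 * d) → L) (i : Fin (2 * n)) (k m : Fin (2 * d)) :
    Module.End L (SymPart n d → L) :=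
  (if m = k then (1 / 2 : L) else 1) •
    serreSum (move h x i k) (move h x i m) (move h x i.rev k.rev)

/-- The sum over `l` reduces to the mirrors of `k` and `m`. When `m = k` these coincide, and the
coefficient `1 / 2` in `halfSerre` prevents double counting. -/
theorem sum_serreSum_move (hx : Generic h x) {i : Fin (2 * n)}
    (hi : (i : ℕ) + 1 = i.rev ∨ (i.rev : ℕ) + 1 = i) (k m : Fin (2 * d)) (r : ℕ) :
    ∑ l, spec h x i.rev l ^ r • serreSum (move h x i k) (move h x i m)
        (move h x i.rev l : Module.End L (SymPart n d → L)) =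
      (-spec h x i k) ^ r • halfSerre h x i k m + (-spec h x i m) ^ r • halfSerre h x i m k := by
  have hz : ∀ l, l ≠ k.rev → l ≠ m.rev → spec h x i.rev l ^ r • serreSum (move h x i k)
      (move h x i m) (move h x i.rev l : Module.End L (SymPart n d → L)) = 0 := by
    intro l h1 h2
    rw [serreSum_move_eq_zero hx hi (Or.inr ⟨h1, h2⟩), smul_zero]
  by_cases hkm : m = k
  · subst hkm
    rw [Finset.sum_eq_single m.rev (fun l _ hl => hz l hl hl) (by simp), halfSerre, if_pos rfl,
      spec_rev hx]
    module
  · rw [Finset.sum_eq_add (a := k.rev) (b := m.rev) (fun h => hkm (Fin.rev_injective h).symm)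
      (fun l _ hl => hz l hl.1 hl.2) (by simp) (by simp), halfSerre, halfSerre, if_neg hkm,
      if_neg (Ne.symm hkm), spec_rev hx, spec_rev hx, one_smul, one_smul,
      serreSum_symm (move h x i m)]

end Serre

/-! ### The exceptional Serre relation, for `j = τ i` adjacent to `i` -/

section ExceptionalSerre

variable {L : Type*} [Field L] {n d : ℕ} {h : L} {x : Fin (2 * d) → L}

/-- Convolution with the powers of `c` is division by `1 - c u⁻¹`; comparing coefficients gives the
recursion `hrec`. The condition on `G.coeff 0` starts the sum at the coefficient of `u⁻¹` in `D`. -/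
theorem sum_pow_mul_coeff_eq (c : L) (D G : LaurentSeries L) (h0 : G.coeff 0 = 0)
    (hG : (lu L - HahnSeries.C c) * G = lu L * D) (q : ℕ) :
    ∑ p ∈ Finset.range (q + 1), c ^ p * D.coeff (((q - p : ℕ) : ℤ) + 1) = G.coeff (q + 1) := by
  have hrec : ∀ k, G.coeff (k + 1) = D.coeff (k + 1) + c * G.coeff k := by
    intro k
    have := congrArg (fun F : LaurentSeries L => F.coeff k) hG
    simp only [sub_mul, HahnSeries.coeff_sub, coeff_lu_mul, coeff_C_mul] at this
    linear_combination this
  induction q with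
  | zero =>
    have := hrec 0
    rw [h0] at this
    simp only [zero_add] at this
    simp [this]
  | succ q ih =>
    rw [Finset.sum_range_succ', hrec, Nat.cast_add, Nat.cast_one, ← ih, Finset.mul_sum]
    rw [add_comm]
    congr 1
    · simp
    · refine Finset.sum_congr rfl fun p _ => ?_
      rw [Nat.add_sub_add_right, pow_succ]
      ring

variable (h x) in
/-- The series `u H_i(u) / ((u - α) (u - β))`. -/
def quotSer (i : Fin (2 * n)) (J : SymPart n d) (α β : L) : LaurentSeries L :=
  lu L * hSer h x i J * (geom α * geom β)

theorem quotSer_mul (i : Fin (2 * n)) (J : SymPart n d) (α β : L) :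
    quotSer h x i J α β * ((lu L - HahnSeries.C α) * (lu L - HahnSeries.C β)) =
      lu L * hSer h x i J := by
  rw [quotSer]
  linear_combination (lu L * hSer h x i J) * ((lu L - HahnSeries.C β) * geom β * geom_mul α +
    geom_mul β)

theorem quotSer_coeff_zero (hx : Generic h x) (i : Fin (2 * n)) (J : SymPart n d) (α β : L) :
    (quotSer h x i J α β).coeff 0 = 0 := by
  have h1 : lu L * HahnSeries.ofPowerSeries ℤ L PowerSeries.X = 1 := by
    rw [← inv_lu, mul_inv_cancel₀ lu_ne_zero]
  have : quotSer h x i J α β = HahnSeries.ofPowerSeries ℤ L (PowerSeries.X *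
      (hPow h (deltaSign i / 4 * h) (spec h x i) i J * (PowerSeries.mk fun k => α ^ k) *
        PowerSeries.mk fun k => β ^ k)) := by
    rw [quotSer, hSer_eq_ofPowerSeries hx, geom_eq, geom_eq]
    simp only [map_mul]
    linear_combination (HahnSeries.ofPowerSeries ℤ L PowerSeries.X *
      HahnSeries.ofPowerSeries ℤ L (hPow h (deltaSign i / 4 * h) (spec h x i) i J) *
      HahnSeries.ofPowerSeries ℤ L (PowerSeries.mk fun k => α ^ k) *
      HahnSeries.ofPowerSeries ℤ L (PowerSeries.mk fun k => β ^ k)) * h1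
  have h2 := coeff_ofPowerSeries_natCast (PowerSeries.X *
      (hPow h (deltaSign i / 4 * h) (spec h x i) i J * (PowerSeries.mk fun k => α ^ k) *
        PowerSeries.mk fun k => β ^ k)) 0
  rw [Nat.cast_zero] at h2
  rw [this, h2]
  simp

variable [CharZero L]

variable (h x) in
/-- The contribution of the letter `k` to the partial fraction expansion of `quotSer`. -/
def quotTerm (i : Fin (2 * n)) (J : SymPart n d) (α β : L) (k : Fin (2 * d)) : L :=
  sgn L i (J.val k) * h * (spec h x i k - deltaSign i / 4 * h) * resid h x i k J *
    ((-spec h x i k - α)⁻¹ * (-spec h x i k - β)⁻¹)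

/-- The assumptions on `α` and `β` say that they are zeros of the numerator of `H_{τi}(u)`,
contributed by `m` and `m'`. Dividing by `(u - α)(u - β)` therefore creates no new poles, and each
old residue is divided by the value of the quadratic. -/
theorem quotSer_coeff (hx : Generic h x) (i : Fin (2 * n)) (J : SymPart n d) (m : Fin (2 * d))
    {α β : L} (h1 : sgn L i.rev (J.val m) ≠ 0) (h2 : sgn L i.rev (J.val m.rev) ≠ 0)
    (hα : spec h x i.rev m - sgn L i.rev (J.val m) * h = α)
    (hβ : spec h x i.rev m.rev - sgn L i.rev (J.val m.rev) * h = β) (q : ℕ) :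
    (quotSer h x i.rev J α β).coeff (q + 1) =
      ∑ k, (-spec h x i k) ^ q * quotTerm h x i J α β k := by
  have hm := (rev_ne_self m).symm
  have key := coeff_of_mul_quadratic_eq hx i.rev J (X - C (deltaSign i.rev / 4 * h))
    (quotSer h x i.rev J α β) {m, m.rev} (by
      intro k hk
      simp only [Finset.mem_insert, Finset.mem_singleton] at hk
      rcases hk with rfl | rfl <;> assumption) (by
      have hu := lu_ne_zero (L := L)
      have h4 : (4 : LaurentSeries L) ≠ 0 := by
        rw [← map_ofNat (HahnSeries.C : L →+* LaurentSeries L) 4]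
        exact (_root_.map_ne_zero _).2 (by norm_num)
      rw [Finset.prod_pair hm, hα, hβ, quotSer_mul, hSer_eq hx, ← mul_assoc, eval₂_sub, eval₂_X,
        eval₂_C, map_mul, map_div₀, map_ofNat, ← deltaSign_C]
      congr 1
      field_simp) q
  rw [key, ← Equiv.sum_comp Fin.revPerm]
  refine Finset.sum_congr rfl fun k _ => ?_
  rw [Finset.prod_pair hm, hα, hβ, quotTerm, Fin.revPerm_apply, spec_rev hx, resid_rev hx, J.symm,
    sgn_rev_rev, deltaSign_rev, eval_sub, eval_X, eval_C]
  ring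

/-- The coefficients are `-2h / D` times those in `move_mul_move_rev_comm` with `c_{i,τi} = -1`. The
bracket produced by `serreSum_left` or `serreSum_right` is thus diagonal, and is a residue of
`quotSer`. -/
theorem weight_mul_combination (hx : Generic h x) {i : Fin (2 * n)} (hc : cart L i i.rev = -1)
    {α β D : L} (k : Fin (2 * d)) (F : SymPart n d → L) (J : SymPart n d)
    (hD : (-spec h x i k - α) * (-spec h x i k - β) = D) :
    (-(h * (4 * spec h x i k + h)) / D) * (move h x i k * move h x i.rev k.rev) F J +
      (h * (4 * spec h x i k - h) / D) * (move h x i.rev k.rev * move h x i k) F J =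
    -4 * quotTerm h x i J α β k * F J := by
  have := move_mul_move_rev_comm hx i k F J
  rw [hc] at this
  rw [quotTerm, ← mul_inv, hD, div_eq_mul_inv, div_eq_mul_inv]
  linear_combination (-2 * h * D⁻¹) * this

theorem four_mul_spec_ne (hx : Generic h x) (m : Fin (2 * d)) (q : ℚ) (hq : q ≠ 0) :
    x m + q * h ≠ 0 := by
  intro h0
  apply hx.add_ne m m (-2 * q) (by simpa using hq)
  push_cast
  linear_combination 2 * h0

/-- For letters in general position `serreSum_left` brings `e_{i,m}` to the front, and the remaining
bracket acts on the partition in which `m` has already moved. For `k = m` and `k = m'` the exchange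
argument is replaced by the vanishing of `e_{i,k} e_{i,m}`, and the surviving triple products give
the same formula. -/
theorem halfSerre_apply_left (hx : Generic h x) {i : Fin (2 * n)} (hi : (i : ℕ) + 1 = i.rev)
    (k m : Fin (2 * d)) (F : SymPart n d → L) (I : SymPart n d) :
    halfSerre h x i k m F I = -4 * quotTerm h x i (shift i m I) (spec h x i m - h / 2)
      (-spec h x i m - h) k * (weight h x I i m * F (shift i m I)) := by
  have hc : cart L i i.rev = -1 := cart_succ hi
  have hsi := hshift_of_succ_eq_rev (h := h) hi
  have hd : (deltaSign i : L) = 1 := by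
    rw [deltaSign_eq, if_pos hi, if_neg (by omega), sub_zero]
  have hs : i.succ = i.rev.castSucc := by simpa [Fin.ext_iff] using hi
  have h0 := hx.ne_zero
  have hJ1 : (shift i m I).val m = i.succ := shift_self _ _ _
  have hJ2 : (shift i m I).val m.rev = i.succ := by rw [shift_rev, hs]
  by_cases h1 : k = m
  · subst h1
    rw [halfSerre, if_pos rfl, serreSum_of_mul_eq_zero (move_mul_self _ _) (move_mul_self _ _),
      mul_assoc]
    simp only [two_zsmul, LinearMap.smul_apply, Pi.smul_apply, LinearMap.sub_apply,
      LinearMap.neg_apply, LinearMap.add_apply, Pi.add_apply, Pi.sub_apply, Pi.neg_apply, smul_eq_mul]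
    rw [Module.End.mul_apply, move_apply, move_rev_mul_move_apply hx, if_pos hJ1,
      if_neg (show ¬((i.rev : ℕ) + 1 = i) by omega), quotTerm, hJ1, sgn_succ, hd, spec, hsi]
    have e := four_mul_spec_ne hx k (1 / 2) (by norm_num)
    have e2 : x k * 2 + h ≠ 0 := by
      intro h1; apply e; push_cast; linear_combination h1 / 2
    have e3 : -(-x k - h / 4) - (-x k - h / 4 - h / 2) = x k * 2 + h := by ring
    have e4 : -(-x k - h / 4) - (-(-x k - h / 4) - h) = h := by ring
    rw [e3, e4]
    field_simp
    linear_combination (4 * weight h x I i k * resid h x i k (shift i k I) * F (shift i k I)) *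
      mul_inv_cancel₀ e2
  by_cases h2 : k = m.rev
  · subst h2
    have hz1 : (move h x i m.rev * move h x i m : Module.End L (SymPart n d → L)) = 0 :=
      move_mul_move_of_mem_pair i (Or.inr (Fin.rev_rev m).symm)
    have hz2 : (move h x i.rev m * move h x i m : Module.End L (SymPart n d → L)) = 0 :=
      move_mul_move_self (by omega) m
    have hap := move_rev_mul_move_apply hx i m.rev F (shift i m I)
    rw [Fin.rev_rev] at hap
    rw [halfSerre, if_neg (Ne.symm h1), one_smul, serreSum_of_mul_eq_zero hz1 (move_mul_rev i m),
      Fin.rev_rev, mul_assoc _ _ (move h x i m), hz2, mul_zero, smul_zero, neg_zero, zero_sub,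
      mul_assoc]
    simp only [two_zsmul, LinearMap.neg_apply, LinearMap.add_apply, Pi.add_apply, Pi.neg_apply]
    rw [Module.End.mul_apply, move_apply, hap, if_pos hJ2,
      if_neg (show ¬((i.rev : ℕ) + 1 = i) by omega), quotTerm, hJ2, sgn_succ, hd, spec, spec, hsi,
      hx.rev]
    have e := four_mul_spec_ne hx m (-(1 / 2)) (by norm_num)
    have e2 : x m * 2 - h ≠ 0 := by
      intro h1; apply e; push_cast; linear_combination h1 / 2
    have e3 : -(- -x m - h / 4) - (-x m - h / 4 - h / 2) = h := by ring
    have e4 : -(- -x m - h / 4) - (-(-x m - h / 4) - h) = -(x m * 2 - h) := by ring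
    rw [e3, e4]
    field_simp
    ring
  · have hkm : m.rev ≠ k.rev := fun h => h1 (Fin.rev_injective h).symm
    have hab := move_comm_self hx i (k := k) (m := m)
    have hbf := move_comm_adjacent hx hc (k := m) (l := k.rev) (Or.inl hkm.symm)
    rw [spec_rev hx, sub_neg_eq_add] at hbf
    have hz := spec_sub_spec_sub_ne hx i (-1) h1
    have hv := spec_sub_spec_add_ne hx i i.rev m k.rev (-1 / 2) (Or.inl (by
      rw [← hi]; push_cast; ring_nf; norm_num))
    rw [spec_rev hx] at hv
    rw [halfSerre, if_neg (Ne.symm h1), one_smul, serreSum_left (h := h)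
      (z := spec h x i k - spec h x i m) (v := spec h x i m + spec h x i k)
      (by convert hz using 1; push_cast; ring) (by convert hv using 1; push_cast; ring) hab hbf,
      Module.End.mul_apply, move_apply]
    simp only [LinearMap.add_apply, Pi.add_apply, LinearMap.smul_apply, Pi.smul_apply, smul_eq_mul]
    have := weight_mul_combination hx hc (α := spec h x i m - h / 2) (β := -spec h x i m - h) k F
      (shift i m I) rfl
    have e1 : 2 * (spec h x i k - spec h x i m) + 2 * (spec h x i m + spec h x i k) + h =
      4 * spec h x i k + h := by ring
    have e2 : 2 * (spec h x i k - spec h x i m) + 2 * (spec h x i m + spec h x i k) - h =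
      4 * spec h x i k - h := by ring
    have e3 : (spec h x i k - spec h x i m - h) * (spec h x i m + spec h x i k - h / 2) =
      (-spec h x i k - (spec h x i m - h / 2)) * (-spec h x i k - (-spec h x i m - h)) := by ring
    rw [e1, e2, e3, this]
    ring

/-- In this orientation `serreSum_right` puts `e_{i,m}` last, so the diagonal bracket is evaluated
before `m` moves, at `I` itself. -/
theorem halfSerre_apply_right (hx : Generic h x) {i : Fin (2 * n)} (hi : (i.rev : ℕ) + 1 = i)
    (k m : Fin (2 * d)) (F : SymPart n d → L) (I : SymPart n d) :
    halfSerre h x i k m F I = -4 * quotTerm h x i I (spec h x i m + h / 2)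
      (-spec h x i m + h) k * (weight h x I i m * F (shift i m I)) := by
  have hc : cart L i i.rev = -1 := cart_pred hi
  have hsi : hshift h i = -(h / 4) := by
    have h1 := hshift_of_succ_eq_rev (h := h) (i := i.rev) (by rw [Fin.rev_rev]; exact hi)
    rw [hshift_rev] at h1
    linear_combination -h1
  have hd : (deltaSign i : L) = -1 := by
    rw [deltaSign_eq, if_pos hi, if_neg (by omega), zero_sub]
  have hs : i.castSucc = i.rev.succ := by simpa [Fin.ext_iff, eq_comm] using hi
  have h0 := hx.ne_zero
  by_cases h1 : k = m
  · subst h1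
    rw [halfSerre, if_pos rfl, serreSum_of_mul_eq_zero (move_mul_self _ _) (move_mul_self _ _)]
    simp only [two_zsmul, LinearMap.smul_apply, Pi.smul_apply, LinearMap.sub_apply,
      LinearMap.neg_apply, LinearMap.add_apply, Pi.add_apply, Pi.sub_apply, Pi.neg_apply, smul_eq_mul]
    rw [Module.End.mul_apply, move_mul_move_rev_apply hx, move_apply]
    by_cases hk : I.val k = i.castSucc
    · rw [if_pos hk,
        if_neg (show ¬((i : ℕ) + 1 = i.rev) by omega), quotTerm, hk, sgn_castSucc, hd, spec, hsi]
      have e := four_mul_spec_ne hx k (-(1 / 2)) (by norm_num)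
      have e2 : x k * 2 - h ≠ 0 := by
        intro h1; apply e; push_cast; linear_combination h1 / 2
      have e3 : -(-x k - -(h / 4)) - (-x k - -(h / 4) + h / 2) = x k * 2 - h := by ring
      have e4 : -(-x k - -(h / 4)) - (-(-x k - -(h / 4)) + h) = -h := by ring
      rw [e3, e4]
      field_simp
      linear_combination (4 * weight h x I i k * resid h x i k I * F (shift i k I)) *
        mul_inv_cancel₀ e2
    · rw [if_neg hk, weight_of_ne hk]
      ring
  by_cases h2 : k = m.rev
  · subst h2
    have hz1 : (move h x i m.rev * move h x i m : Module.End L (SymPart n d → L)) = 0 :=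
      move_mul_move_of_mem_pair i (Or.inr (Fin.rev_rev m).symm)
    have hz2 : (move h x i m * move h x i.rev m : Module.End L (SymPart n d → L)) = 0 :=
      move_mul_move_self (by omega) m
    have hap := move_mul_move_rev_apply hx i m.rev (move h x i m F) I
    rw [Fin.rev_rev] at hap
    rw [halfSerre, if_neg (Ne.symm h1), one_smul, serreSum_of_mul_eq_zero hz1 (move_mul_rev i m),
      Fin.rev_rev, hz2, zero_mul, smul_zero, sub_zero]
    simp only [two_zsmul, LinearMap.neg_apply, LinearMap.add_apply, Pi.add_apply, Pi.neg_apply]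
    rw [Module.End.mul_apply, hap, move_apply]
    by_cases hk : I.val m = i.castSucc
    · have hk2 : I.val m.rev = i.castSucc := by rw [I.symm, hk, hs, Fin.rev_succ, Fin.rev_rev, hs]
      rw [if_pos hk2,
        if_neg (show ¬((i : ℕ) + 1 = i.rev) by omega), quotTerm, hk2, sgn_castSucc, hd, spec, spec,
        hsi, hx.rev]
      have e := four_mul_spec_ne hx m (1 / 2) (by norm_num)
      have e2 : x m * 2 + h ≠ 0 := by
        intro h1; apply e; push_cast; linear_combination h1 / 2
      have e3 : -(- -x m - -(h / 4)) - (-x m - -(h / 4) + h / 2) = -h := by ring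
      have e4 : -(- -x m - -(h / 4)) - (-(-x m - -(h / 4)) + h) = -(x m * 2 + h) := by ring
      rw [e3, e4]
      field_simp
      ring
    · rw [weight_of_ne hk]
      ring
  · have hkm : m.rev ≠ k.rev := fun h => h1 (Fin.rev_injective h).symm
    have hab := move_comm_self hx i (k := k) (m := m)
    have hbf := move_comm_adjacent hx hc (k := m) (l := k.rev) (Or.inl hkm.symm)
    rw [spec_rev hx, sub_neg_eq_add] at hbf
    have hz := spec_sub_spec_sub_ne hx i 1 h1
    have hv := spec_sub_spec_add_ne hx i i.rev m k.rev (1 / 2) (Or.inl (by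
      rw [← hi]; push_cast; ring_nf; norm_num))
    rw [spec_rev hx] at hv
    rw [halfSerre, if_neg (Ne.symm h1), one_smul, serreSum_right (h := h)
      (z := spec h x i k - spec h x i m) (v := spec h x i m + spec h x i k)
      (by convert hz using 1; push_cast; ring) (by convert hv using 1; push_cast; ring) hab hbf,
      Module.End.mul_apply]
    simp only [LinearMap.add_apply, Pi.add_apply, LinearMap.smul_apply, Pi.smul_apply, smul_eq_mul]
    have := weight_mul_combination hx hc (α := spec h x i m + h / 2) (β := -spec h x i m + h) k
      (move h x i m F) I rfl
    have e1 : 2 * (spec h x i k - spec h x i m) + 2 * (spec h x i m + spec h x i k) + h =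
      4 * spec h x i k + h := by ring
    have e2 : 2 * (spec h x i k - spec h x i m) + 2 * (spec h x i m + spec h x i k) - h =
      4 * spec h x i k - h := by ring
    have e3 : (spec h x i k - spec h x i m + h) * (spec h x i m + spec h x i k + h / 2) =
      (-spec h x i k - (spec h x i m + h / 2)) * (-spec h x i k - (-spec h x i m + h)) := by ring
    rw [e1, e2, e3, this, move_apply]

/-- The sum over `p` divides by `u - a / 3`, which cancels `3u - a` up to the factor 3. This
accounts for the powers of `1/3` in the exceptional Serre relation. -/
theorem sum_pow_mul_coeff_sub (hx : Generic h x) {j : Fin (2 * n)} {I J : SymPart n d} {a : L}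
    {α β : L} (K : SymPart n d)
    (hK : (hSer h x j J - hSer h x j I) * ((lu L - HahnSeries.C α) * (lu L - HahnSeries.C β)) =
      HahnSeries.C h * (3 * lu L - HahnSeries.C a) * hSer h x j K) (q : ℕ) :
    ∑ p ∈ Finset.range (q + 1), (a / 3) ^ p * ((hSer h x j J).coeff (((q - p : ℕ) : ℤ) + 1) -
      (hSer h x j I).coeff (((q - p : ℕ) : ℤ) + 1)) =
      3 * h * (quotSer h x j K α β).coeff (q + 1) := by
  have h3 : (HahnSeries.C (3 : L) : LaurentSeries L) = 3 := map_ofNat _ 3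
  have h30 : (3 : LaurentSeries L) ≠ 0 := by
    rw [← h3]; exact (_root_.map_ne_zero _).2 (by norm_num)
  have := sum_pow_mul_coeff_eq (a / 3) (hSer h x j J - hSer h x j I)
    (HahnSeries.C (3 * h) * quotSer h x j K α β) (by
      rw [coeff_C_mul, quotSer_coeff_zero hx, mul_zero]) (by
      apply mul_right_cancel₀ (mul_ne_zero (lu_sub_C_ne_zero α) (lu_sub_C_ne_zero β))
      rw [mul_assoc, mul_assoc (HahnSeries.C (3 * h)), quotSer_mul, mul_assoc, hK, map_mul,
        map_div₀, h3]
      field_simp) q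
  rw [coeff_C_mul] at this
  rw [← this]
  simp only [HahnSeries.coeff_sub]

/-- Both sides are the same coefficient of `quotSer`: the left one through its partial fractions,
the right one through the telescoped difference of `H_{τi}(u)` before and after the move of `m`. -/
theorem sum_halfSerre (hx : Generic h x) {i : Fin (2 * n)}
    (hi : (i : ℕ) + 1 = i.rev ∨ (i.rev : ℕ) + 1 = i) (m : Fin (2 * d)) (q : ℕ) :
    ∑ k, (-spec h x i k) ^ q • halfSerre h x i k m = -(4 / 3 : L) • ∑ p ∈ Finset.range (q + 1),
      (spec h x i m / 3) ^ p • comm (move h x i m)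
        (hOp h x i.rev (q - p) : Module.End L (SymPart n d → L)) := by
  ext F I
  have h0 := hx.ne_zero
  have hcomm : ∀ r, comm (move h x i m) (hOp h x i.rev r) F I =
      ((hSer h x i.rev (shift i m I)).coeff (r + 1) - (hSer h x i.rev I).coeff (r + 1)) / h *
        (weight h x I i m * F (shift i m I)) := by
    intro r
    rw [comm, hOp, LinearMap.sub_apply, Pi.sub_apply, move_diag_apply, diag_move_apply]
    ring
  simp only [LinearMap.sum_apply, Finset.sum_apply, LinearMap.smul_apply, Pi.smul_apply,
    smul_eq_mul, hcomm]
  by_cases hm : I.val m = i.castSucc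
  swap
  · rw [weight_of_ne hm]
    rcases hi with hi | hi
    · simp only [halfSerre_apply_left hx hi, weight_of_ne hm]
      simp
    · simp only [halfSerre_apply_right hx hi, weight_of_ne hm]
      simp
  have hr : ∀ S : L, ∑ p ∈ Finset.range (q + 1), (spec h x i m / 3) ^ p *
      ((hSer h x i.rev (shift i m I)).coeff (((q - p : ℕ) : ℤ) + 1) -
        (hSer h x i.rev I).coeff (((q - p : ℕ) : ℤ) + 1)) = 3 * h * S →
      -(4 / 3) * ∑ p ∈ Finset.range (q + 1), (spec h x i m / 3) ^ p *
      (((hSer h x i.rev (shift i m I)).coeff (((q - p : ℕ) : ℤ) + 1) -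
        (hSer h x i.rev I).coeff (((q - p : ℕ) : ℤ) + 1)) / h *
        (weight h x I i m * F (shift i m I))) =
      -4 * S * (weight h x I i m * F (shift i m I)) := by
    intro S hS
    have : S = (∑ p ∈ Finset.range (q + 1), (spec h x i m / 3) ^ p *
      ((hSer h x i.rev (shift i m I)).coeff (((q - p : ℕ) : ℤ) + 1) -
        (hSer h x i.rev I).coeff (((q - p : ℕ) : ℤ) + 1))) / (3 * h) := by
      rw [hS]; field_simp
    rw [this, Finset.sum_div, Finset.mul_sum, Finset.mul_sum, Finset.sum_mul]
    refine Finset.sum_congr rfl fun p _ => ?_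
    field_simp
  have hsh := hSer_shift hx i.rev i m I hm
  rw [Fin.rev_rev, cart_self, cart_symm] at hsh
  rcases hi with hi | hi
  · have hc : cart L i i.rev = -1 := cart_succ hi
    have hsi := hshift_of_succ_eq_rev (h := h) hi
    have hs : i.succ = i.rev.castSucc := by simpa [Fin.ext_iff] using hi
    simp only [halfSerre_apply_left hx hi]
    have hJ1 : (shift i m I).val m = i.rev.castSucc := by rw [shift_self, hs]
    have hJ2 : (shift i m I).val m.rev = i.rev.castSucc := shift_rev _ _ _
    rw [hr _ (sum_pow_mul_coeff_sub hx (α := spec h x i m - h / 2) (β := -spec h x i m - h)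
      (shift i m I) ?_ q)]
    · rw [quotSer_coeff hx i (shift i m I) m (by rw [hJ1, sgn_castSucc]; exact one_ne_zero)
        (by rw [hJ2, sgn_castSucc]; exact one_ne_zero)
        (by rw [hJ1, sgn_castSucc, spec, spec, hshift_rev, hsi]; ring)
        (by rw [hJ2, sgn_castSucc, spec_rev hx, one_mul]), Finset.mul_sum, Finset.sum_mul]
      exact Finset.sum_congr rfl fun k _ => by ring
    -- With Cartan entries `-1` and `2`, and `s = spec h x i m`, the two quadratics of `hSer_shift`
    -- differ by `h (3u - s)`.
    · rw [hc] at hsh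
      have e1 : spec h x i m + -1 * h / 2 = spec h x i m - h / 2 := by ring
      have e2 : -spec h x i m - 2 * h / 2 = -spec h x i m - h := by ring
      have e3 : spec h x i m - -1 * h / 2 = spec h x i m + h / 2 := by ring
      have e4 : -spec h x i m + 2 * h / 2 = -spec h x i m + h := by ring
      rw [e1, e2, e3, e4] at hsh
      rw [sub_mul, hsh]
      simp only [map_sub, map_add, map_neg]
      have e5 : (HahnSeries.C (h / 2) : LaurentSeries L) = HahnSeries.C h / 2 := by
        rw [map_div₀, map_ofNat]
      rw [e5]
      have h20 : (2 : LaurentSeries L) ≠ 0 := by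
        rw [← map_ofNat (HahnSeries.C : L →+* LaurentSeries L) 2]
        exact (_root_.map_ne_zero _).2 two_ne_zero
      field_simp
      ring
  · have hc : cart L i i.rev = -1 := cart_pred hi
    have hsi : hshift h i = -(h / 4) := by
      have h1 := hshift_of_succ_eq_rev (h := h) (i := i.rev) (by rw [Fin.rev_rev]; exact hi)
      rw [hshift_rev] at h1
      linear_combination -h1
    have hs : i.castSucc = i.rev.succ := by simpa [Fin.ext_iff, eq_comm] using hi
    simp only [halfSerre_apply_right hx hi]
    have hJ1 : I.val m = i.rev.succ := by rw [hm, hs]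
    have hJ2 : I.val m.rev = i.rev.succ := by rw [I.symm, hm, Fin.rev_castSucc]
    rw [hr _ (sum_pow_mul_coeff_sub hx (α := spec h x i m + h / 2) (β := -spec h x i m + h)
      I ?_ q)]
    · rw [quotSer_coeff hx i I m (by rw [hJ1, sgn_succ]; exact neg_ne_zero.2 one_ne_zero)
        (by rw [hJ2, sgn_succ]; exact neg_ne_zero.2 one_ne_zero)
        (by rw [hJ1, sgn_succ, spec, spec, hshift_rev, hsi]; ring)
        (by rw [hJ2, sgn_succ, spec_rev hx]; ring), Finset.mul_sum, Finset.sum_mul]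
      exact Finset.sum_congr rfl fun k _ => by ring
    · rw [hc] at hsh
      have e1 : spec h x i m + -1 * h / 2 = spec h x i m - h / 2 := by ring
      have e2 : -spec h x i m - 2 * h / 2 = -spec h x i m - h := by ring
      have e3 : spec h x i m - -1 * h / 2 = spec h x i m + h / 2 := by ring
      have e4 : -spec h x i m + 2 * h / 2 = -spec h x i m + h := by ring
      rw [e1, e2, e3, e4] at hsh
      rw [sub_mul, ← hsh]
      simp only [map_sub, map_add, map_neg]
      have e5 : (HahnSeries.C (h / 2) : LaurentSeries L) = HahnSeries.C h / 2 := by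
        rw [map_div₀, map_ofNat]
      rw [e5]
      have h20 : (2 : LaurentSeries L) ≠ 0 := by
        rw [← map_ofNat (HahnSeries.C : L →+* LaurentSeries L) 2]
        exact (_root_.map_ne_zero _).2 two_ne_zero
      field_simp
      ring

theorem sym_comm_bOp_rev (hx : Generic h x) {c : L} (hc : c ^ 2 = -1) {i : Fin (2 * n)}
    (hi : (i : ℕ) + 1 = i.rev ∨ (i.rev : ℕ) + 1 = i) (k₁ k₂ r : ℕ) :
    sym (fun k l => comm (bOp h x c i k) (comm (bOp h x c i l)
      (bOp h x c i.rev r : Module.End L (SymPart n d → L)))) k₁ k₂ =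
    (4 / 3 : L) • sym (fun k l => ((-1) ^ k : L) • ∑ p ∈ Finset.range (k + r + 1),
      ((3 : L) ^ p)⁻¹ • comm (bOp h x c i (l + p)) (hOp h x i.rev (k + r - p))) k₁ k₂ := by
  -- Each half of the right-hand side is the sum of one kind of half contribution. The factor
  -- `(-1)^k` converts `(-spec)^(k + r)` into `spec^k (-spec)^r`.
  have e1 : ∀ k l : ℕ, (4 / 3 : L) • ((-1) ^ k : L) • ∑ p ∈ Finset.range (k + r + 1),
      ((3 : L) ^ p)⁻¹ • comm (bOp h x c i (l + p))
        (hOp h x i.rev (k + r - p) : Module.End L (SymPart n d → L)) =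
      c ^ 3 • ∑ m, ∑ k', (spec h x i k' ^ k * spec h x i m ^ l * (-spec h x i k') ^ r) •
        halfSerre h x i k' m := by
    intro k l
    have e2 : ∀ m, ∑ k', (spec h x i k' ^ k * spec h x i m ^ l * (-spec h x i k') ^ r) •
        (halfSerre h x i k' m : Module.End L (SymPart n d → L)) =
        ((-1) ^ k * spec h x i m ^ l) • ∑ k', (-spec h x i k') ^ (k + r) •
          halfSerre h x i k' m := by
      intro m
      rw [Finset.smul_sum]
      refine Finset.sum_congr rfl fun k' _ => ?_
      rw [smul_smul]
      congr 1
      have : ((-1 : L) ^ k) * (-1) ^ k = 1 := by rw [← mul_pow]; simp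
      rw [pow_add, neg_pow (spec h x i k') k]
      linear_combination -(spec h x i k' ^ k * spec h x i m ^ l * (-spec h x i k') ^ r) * this
    have hc3 : c ^ 3 = -c := by rw [pow_succ, hc]; ring
    simp only [bOp, smul_sum_comm]
    simp only [e2, sum_halfSerre hx hi, hc3, Finset.smul_sum, smul_smul]
    rw [Finset.sum_comm]
    refine Finset.sum_congr rfl fun m _ => Finset.sum_congr rfl fun p _ => ?_
    congr 1
    rw [div_pow, pow_add]
    field_simp
  rw [sym_comm_bOp, sym, smul_add, e1, e1, ← smul_add]
  congr 1
  simp only [sum_serreSum_move hx hi, smul_add, smul_smul, Finset.sum_add_distrib]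
  congr 1
  · rw [Finset.sum_comm]
  · refine Finset.sum_congr rfl fun k _ => Finset.sum_congr rfl fun m _ => ?_
    rw [mul_comm (spec h x i k ^ k₁)]

end ExceptionalSerre

/-! ### Weyl group substitutions, extended to the fraction field -/

section Substitution

variable {d : ℕ}

theorem xvar_rev (s : Fin (2 * d)) : (xvar s.rev : Rh d) = -xvar s := by
  have h1 := Fin.val_rev s
  have h2 := s.2
  unfold xvar
  by_cases h : (s : ℕ) < d
  · rw [dif_pos h, dif_neg (by omega)]
    congr 3
    omega
  · rw [dif_neg h, dif_pos (by omega), neg_neg]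
    congr 2
    omega

theorem xvar_castLE (k : Fin d) : (xvar (Fin.castLE (by omega) k : Fin (2 * d)) : Rh d) =
    MvPolynomial.X k := by
  rw [xvar, dif_pos (by simp)]
  rfl

theorem exists_castLE (s : Fin (2 * d)) :
    ∃ k : Fin d, s = Fin.castLE (by omega) k ∨ s = (Fin.castLE (by omega) k : Fin (2 * d)).rev := by
  by_cases h : (s : ℕ) < d
  · exact ⟨⟨s, h⟩, Or.inl (Fin.ext rfl)⟩
  · exact ⟨⟨2 * d - 1 - s, by omega⟩, Or.inr (Fin.ext (by simp [Fin.val_rev]; omega))⟩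

/-- The substitution `x_s ↦ y s`, for a family `y` with `y s.rev = -y s`. -/
def oddSubst (y : Fin (2 * d) → Rh d) : Rh d →ₐ[ℂ[X]] Rh d :=
  MvPolynomial.aeval fun k : Fin d => y (Fin.castLE (by omega) k)

theorem oddSubst_xvar {y : Fin (2 * d) → Rh d} (hy : ∀ s, y s.rev = -y s) (s : Fin (2 * d)) :
    oddSubst y (xvar s) = y s := by
  obtain ⟨k, rfl | rfl⟩ := exists_castLE s
  · rw [xvar_castLE, oddSubst, MvPolynomial.aeval_X]
  · rw [xvar_rev, map_neg, hy, xvar_castLE, oddSubst, MvPolynomial.aeval_X]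

theorem subst_eq_oddSubst (σ : Equiv.Perm (Fin (2 * d))) : subst σ = oddSubst fun s => xvar (σ s) :=
  rfl

theorem subst_xvar {σ : Equiv.Perm (Fin (2 * d))} (hσ : σ ∈ weyl d) (s : Fin (2 * d)) :
    subst σ (xvar s) = xvar (σ s) := by
  rw [subst_eq_oddSubst, oddSubst_xvar]
  intro s
  rw [hσ s, xvar_rev]

/-- A substitution records only the images of the first `d` letters. It is compatible with
composition because the outer permutation respects `x_{r'} = -x_r`; the inner one is arbitrary. -/
theorem subst_subst {σ : Equiv.Perm (Fin (2 * d))} (hσ : σ ∈ weyl d)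
    (τ : Equiv.Perm (Fin (2 * d))) (p : Rh d) : subst σ (subst τ p) = subst (σ * τ) p := by
  have : (subst σ).comp (subst τ) = subst (σ * τ) := by
    apply MvPolynomial.algHom_ext
    intro k
    rw [AlgHom.comp_apply, subst, subst, subst, MvPolynomial.aeval_X, MvPolynomial.aeval_X]
    exact subst_xvar hσ _
  exact DFunLike.congr_fun this p

theorem subst_one (p : Rh d) : subst 1 p = p := by
  have : subst (1 : Equiv.Perm (Fin (2 * d))) = AlgHom.id _ _ := by
    apply MvPolynomial.algHom_ext
    intro k
    rw [subst, MvPolynomial.aeval_X, Equiv.Perm.one_apply, xvar_castLE]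
    rfl
  rw [this]
  rfl

theorem subst_injective {σ : Equiv.Perm (Fin (2 * d))} (hσ : σ ∈ weyl d) :
    Function.Injective (subst σ) := by
  intro p q h
  have := congrArg (subst σ⁻¹) h
  rwa [subst_subst (inv_mem hσ), subst_subst (inv_mem hσ), inv_mul_cancel, subst_one,
    subst_one] at this

theorem toK_injective : Function.Injective (toK d) := IsFractionRing.injective (Rh d) (Kh d)

/-- Modulo `α` the two homomorphisms agree on the variables, hence everywhere. -/
theorem dvd_oddSubst_sub {y z : Fin (2 * d) → Rh d} {α : Rh d} (h : ∀ s, α ∣ y s - z s)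
    (p : Rh d) : α ∣ oddSubst y p - oddSubst z p := by
  have : (Ideal.Quotient.mkₐ ℂ[X] (Ideal.span {α})).comp (oddSubst y) =
      (Ideal.Quotient.mkₐ ℂ[X] (Ideal.span {α})).comp (oddSubst z) := by
    apply MvPolynomial.algHom_ext
    intro k
    rw [AlgHom.comp_apply, AlgHom.comp_apply, oddSubst, oddSubst, MvPolynomial.aeval_X,
      MvPolynomial.aeval_X]
    exact Ideal.Quotient.eq.2 (Ideal.mem_span_singleton.2 (h _))
  exact Ideal.mem_span_singleton.1 (Ideal.Quotient.eq.1 (DFunLike.congr_fun this p))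

/-- The automorphism of the fraction field that extends `subst σ`. -/
def substK {σ : Equiv.Perm (Fin (2 * d))} (hσ : σ ∈ weyl d) : Kh d →+* Kh d :=
  IsFractionRing.lift (A := Rh d) (g := (toK d).comp (subst σ : Rh d →+* Rh d))
    (toK_injective.comp (subst_injective hσ))

theorem substK_toK {σ : Equiv.Perm (Fin (2 * d))} (hσ : σ ∈ weyl d) (p : Rh d) :
    substK hσ (toK d p) = toK d (subst σ p) :=
  IsFractionRing.lift_algebraMap _ p

theorem substK_hK {σ : Equiv.Perm (Fin (2 * d))} (hσ : σ ∈ weyl d) : substK hσ (hK d) = hK d := by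
  rw [hK, substK_toK]
  congr 1
  exact (subst σ).commutes X

instance : CharZero (Kh d) := charZero_of_injective_algebraMap (R := Rh d) toK_injective

theorem xvar_injective : Function.Injective (xvar : Fin (2 * d) → Rh d) := by
  intro s t h
  have hX : ∀ k l : Fin d, (MvPolynomial.X k : Rh d) ≠ -MvPolynomial.X l := by
    intro k l h
    have := congrArg (MvPolynomial.eval fun _ => (1 : ℂ[X])) h
    simp only [MvPolynomial.eval_X, map_neg] at this
    have h2 := congrArg (Polynomial.eval 0) this
    norm_num at h2
  obtain ⟨k, rfl | rfl⟩ := exists_castLE s <;> obtain ⟨l, rfl | rfl⟩ := exists_castLE t <;>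
    simp only [xvar_rev, xvar_castLE] at h
  · rw [MvPolynomial.X_injective h]
  · exact absurd h (hX _ _)
  · exact absurd h.symm (hX _ _)
  · rw [MvPolynomial.X_injective (neg_injective h)]

/-- The elements `x_1, …, x_{2d}` of the fraction field. -/
def xK (d : ℕ) (s : Fin (2 * d)) : Kh d := toK d (xvar s)

theorem substK_xK {σ : Equiv.Perm (Fin (2 * d))} (hσ : σ ∈ weyl d) (s : Fin (2 * d)) :
    substK hσ (xK d s) = xK d (σ s) := by
  rw [xK, substK_toK, subst_xvar hσ]
  rfl

theorem generic_xK : Generic (hK d) (xK d) where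
  rev s := by rw [xK, xvar_rev, map_neg]; rfl
  inj s t h := xvar_injective (toK_injective h)
  ne_zero h := by
    rw [hK, map_eq_zero_iff _ toK_injective] at h
    exact X_ne_zero (MvPolynomial.C_injective _ _ (h.trans (map_zero _).symm))
  add_ne a b q hq h := by
    have e : (q : Kh d) = toK d (MvPolynomial.C (C (q : ℂ))) := by
      exact (map_ratCast ((toK d).comp ((MvPolynomial.C).comp (C : ℂ →+* ℂ[X]))) q).symm
    rw [e, hK, xK, xK, ← map_mul, ← map_add] at h
    -- Setting all `x_s` to zero kills the left-hand side but not `q ħ`.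
    have h1 := congrArg (MvPolynomial.eval fun _ => (0 : ℂ[X])) (toK_injective h)
    have h2 : ∀ s : Fin (2 * d), MvPolynomial.eval (fun _ => (0 : ℂ[X])) (xvar s) = 0 := by
      intro s
      unfold xvar
      split_ifs <;> simp
    rw [map_add, h2, h2, map_mul, MvPolynomial.eval_C, MvPolynomial.eval_C, add_zero] at h1
    have h3 : (C (q : ℂ) : ℂ[X]) ≠ 0 := by simpa using hq
    exact mul_ne_zero h3 X_ne_zero h1.symm

end Substitution

/-! ### `P` as the space of equivariant functions of partitions -/

section Evaluation

variable {n d : ℕ}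

/-- The stable sorting permutation is unique, and its conjugate by `r ↦ r'` is again a stable sort
of the same symmetric labelling. -/
theorem sort_mem_weyl (I : SymPart n d) : Tuple.sort I.val ∈ weyl d := by
  set σ := Tuple.sort I.val with hσ
  obtain ⟨h1, h2⟩ := Tuple.eq_sort_iff.1 hσ
  have h : Fin.revPerm * σ * Fin.revPerm = Tuple.sort I.val := by
    refine Tuple.eq_sort_iff.2 ⟨fun i j hij => ?_, fun i j hij h => ?_⟩
    · have := h1 (Fin.rev_le_rev.2 hij)
      simp only [Function.comp_apply, Equiv.Perm.mul_apply, Fin.revPerm_apply, I.symm] at this ⊢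
      exact Fin.rev_le_rev.2 this
    · simp only [Equiv.Perm.mul_apply, Fin.revPerm_apply, I.symm, Fin.rev_inj] at h ⊢
      exact Fin.rev_lt_rev.2 (h2 _ _ (Fin.rev_lt_rev.2 hij) h.symm)
  intro r
  rw [← hσ] at h
  have := DFunLike.congr_fun h r.rev
  simp only [Equiv.Perm.mul_apply, Fin.revPerm_apply, Fin.rev_rev] at this
  exact this.symm

theorem label_monotone (v : Lam n d) : Monotone (label v) := by
  intro r s hrs
  refine Fin.le_def.2 ?_
  simp only [label]
  refine Finset.card_le_card fun i hi => ?_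
  rw [Finset.mem_filter] at hi ⊢
  exact ⟨hi.1, hi.2.trans hrs⟩

theorem sum_shape_val (I : SymPart n d) (s : Finset (Fin (2 * n + 1))) :
    ∑ l ∈ s, I.shape.val l = (Finset.univ.filter fun r => I.val r ∈ s).card := by
  rw [Finset.card_eq_sum_card_fiberwise (f := I.val) (t := s) (fun r hr => by simpa using hr)]
  refine Finset.sum_congr rfl fun l hl => ?_
  change (I.block l).card = _
  congr 1
  ext r
  simp only [SymPart.block, Finset.mem_filter, Finset.mem_univ, true_and]
  constructor
  · rintro rfl
    exact ⟨hl, rfl⟩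
  · exact fun h => h.2

theorem label_shape_of_monotone (I : SymPart n d) {σ : Equiv.Perm (Fin (2 * d))}
    (h : Monotone (I.val ∘ σ)) (r : Fin (2 * d)) : label I.shape r = I.val (σ r) := by
  rw [label_eq_iff, sum_shape_val, sum_shape_val]
  have e : ∀ p : Fin (2 * n + 1) → Prop, ∀ [DecidablePred p],
      (Finset.univ.filter fun r => p (I.val r)).card =
        (Finset.univ.filter fun r => p ((I.val ∘ σ) r)).card := by
    intro p _
    refine (Finset.card_equiv σ fun r => ?_).symm
    simp
  simp only [Finset.mem_Iio, Finset.mem_Iic]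
  rw [e (· < I.val (σ r)), e (· ≤ I.val (σ r)),
    Tuple.lt_card_le_iff_apply_le_of_monotone h, ← not_lt,
    Tuple.lt_card_lt_iff_apply_lt_of_monotone h]
  simp

theorem shape_std (v : Lam n d) : (std v).shape = v := by
  -- Partial sums are easier to compare than parts: the letters in the blocks up to `l` form an
  -- initial interval of length `v_1 + ⋯ + v_l`.
  have h : ∀ l, ∑ j ∈ Finset.Iic l, (std v).shape.val j = ∑ j ∈ Finset.Iic l, v.val j := by
    intro l
    have hle : ∑ j ∈ Finset.Iic l, v.val j ≤ 2 * d := by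
      rw [← v.sum_eq]
      exact Finset.sum_le_sum_of_subset (Finset.subset_univ _)
    rw [sum_shape_val]
    have : ∀ r : Fin (2 * d), (std v).val r ∈ Finset.Iic l ↔
        (r : ℕ) < ∑ j ∈ Finset.Iic l, v.val j := by
      intro r
      have h1 := (label_eq_iff v r (label v r)).1 rfl
      rw [Finset.mem_Iic]
      change label v r ≤ l ↔ _
      constructor
      · intro h2
        exact h1.2.trans_le (Finset.sum_le_sum_of_subset (Finset.Iic_subset_Iic.2 h2))
      · intro h2
        by_contra h3
        rw [not_le] at h3
        have : ∑ j ∈ Finset.Iic l, v.val j ≤ ∑ j ∈ Finset.Iio (label v r), v.val j := by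
          refine Finset.sum_le_sum_of_subset fun j hj => ?_
          rw [Finset.mem_Iic] at hj
          exact Finset.mem_Iio.2 (hj.trans_lt h3)
        omega
    simp only [this]
    rw [Fin.card_filter_val_lt]
    omega
  have e3 : ∀ (w : Fin (2 * n + 1) → ℕ) (l : Fin (2 * n + 1)),
      ∑ j ∈ Finset.Iic l, w j = ∑ j ∈ Finset.Iio l, w j + w l := by
    intro w l
    rw [← Finset.Iio_insert l, Finset.sum_insert (by simp), add_comm]
  ext l
  induction l using WellFoundedLT.induction with
  | ind l ih =>
    have h1 := h l
    have h2 := Finset.sum_congr (rfl : Finset.Iio l = _) fun j hj => ih j (Finset.mem_Iio.1 hj)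
    rw [e3, e3, h2] at h1
    exact Nat.add_left_cancel h1

theorem sort_label (v : Lam n d) : Tuple.sort (std v).val = 1 :=
  Tuple.sort_eq_refl_iff_monotone.2 (label_monotone v)

instance : Finite (SymPart n d) :=
  Finite.of_injective SymPart.val fun _ _ h => SymPart.ext h

instance : Finite (Lam n d) :=
  Finite.of_surjective (SymPart.shape : SymPart n d → Lam n d) fun v => ⟨std v, shape_std v⟩

/-- The partition `w⁻¹ I`, for an element `w` of the Weyl group. -/
def SymPart.comp (I : SymPart n d) {w : Equiv.Perm (Fin (2 * d))} (hw : w ∈ weyl d) :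
    SymPart n d :=
  ⟨fun r => I.val (w r), fun r => by rw [hw, I.symm]⟩

theorem comp_sort (I : SymPart n d) : I.comp (sort_mem_weyl I) = std I.shape := by
  ext r : 2
  exact (label_shape_of_monotone I (Tuple.monotone_sort I.val) r).symm

theorem shape_comp (I : SymPart n d) {w : Equiv.Perm (Fin (2 * d))} (hw : w ∈ weyl d) :
    (I.comp hw).shape = I.shape := by
  ext l
  simp only [SymPart.shape]
  exact Finset.card_equiv w fun r => by
    rw [mem_block, mem_block]
    rfl

theorem evalAt_std (v : Lam n d) (f : P n d) : evalAt (std v) f = (f v : Rh d) := by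
  rw [evalAt, sort_label, subst_one, shape_std]

/-- Two Weyl elements that carry the standard partition to `I` differ by an element that preserves
its blocks, and this fixes the component of `f`. So the increasing order chosen inside the blocks is
immaterial. -/
theorem evalAt_eq_subst (I : SymPart n d) {σ : Equiv.Perm (Fin (2 * d))} (hσ : σ ∈ weyl d)
    (h : I.comp hσ = std I.shape) (f : P n d) : evalAt I f = subst σ (f I.shape : Rh d) := by
  have hs := sort_mem_weyl I
  set τ := Tuple.sort I.val with hτ
  have hm : σ⁻¹ * τ ∈ weylSub I.shape := by
    refine ⟨mul_mem (inv_mem hσ) hs, fun r => ?_⟩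
    have e1 : ∀ s, label I.shape s = I.val (σ s) := fun s =>
      congrFun (congrArg SymPart.val h.symm) s
    have e2 : label I.shape r = I.val (τ r) :=
      congrFun (congrArg SymPart.val (comp_sort I).symm) r
    rw [e1, e2]
    simp
  have h2 : subst (σ⁻¹ * τ) (f I.shape : Rh d) = f I.shape := (f I.shape).2 _ hm
  rw [evalAt, ← hτ]
  conv_rhs => rw [← h2, subst_subst hσ, mul_inv_cancel_left]

theorem subst_evalAt (I : SymPart n d) {w : Equiv.Perm (Fin (2 * d))} (hw : w ∈ weyl d)
    (f : P n d) : subst w (evalAt (I.comp hw) f) = evalAt I f := by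
  have hs := sort_mem_weyl (I.comp hw)
  rw [evalAt, subst_subst hw, shape_comp]
  refine (evalAt_eq_subst I (mul_mem hw hs) ?_ f).symm
  rw [← shape_comp I hw, ← comp_sort]
  rfl

/-- The functions of partitions with values in `R[ħ]` that are compatible with the action of the
Weyl group. -/
def equivariant (n d : ℕ) : Submodule ℂ[X] (SymPart n d → Kh d) where
  carrier := {F | (∀ I, F I ∈ (toK d).range) ∧
    ∀ (w : Equiv.Perm (Fin (2 * d))) (hw : w ∈ weyl d) (I : SymPart n d),
      substK hw (F (I.comp hw)) = F I}
  add_mem' := by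
    intro F G hF hG
    refine ⟨fun I => add_mem (hF.1 I) (hG.1 I), fun w hw I => ?_⟩
    rw [Pi.add_apply, map_add, hF.2, hG.2, Pi.add_apply]
  zero_mem' := ⟨fun I => zero_mem _, fun w hw I => map_zero _⟩
  smul_mem' := by
    intro c F hF
    have e : ∀ a : Kh d, c • a = toK d (MvPolynomial.C c) * a := fun a => Algebra.smul_def c a
    refine ⟨fun I => ?_, fun w hw I => ?_⟩
    · rw [Pi.smul_apply, e]
      exact mul_mem ⟨_, rfl⟩ (hF.1 I)
    · rw [Pi.smul_apply, Pi.smul_apply, e, e, map_mul, hF.2, substK_toK]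
      congr 2
      exact (subst w).commutes c

/-- The function of partitions given by an element of `P`. -/
def evalP (n d : ℕ) : P n d →ₗ[ℂ[X]] (SymPart n d → Kh d) where
  toFun f I := toK d (evalAt I f)
  map_add' f g := by
    ext I
    rw [Pi.add_apply, evalAt, DirectSum.add_apply, Subalgebra.coe_add, map_add, map_add]
    rfl
  map_smul' c f := by
    ext I
    rw [Pi.smul_apply, evalAt, DirectSum.smul_apply, Subalgebra.coe_smul, map_smul,
      Algebra.smul_def, map_mul, RingHom.id_apply, Algebra.smul_def]
    rfl

theorem evalP_apply (f : P n d) (I : SymPart n d) : evalP n d f I = toK d (evalAt I f) := rfl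

theorem evalP_std (f : P n d) (v : Lam n d) : evalP n d f (std v) = toK d (f v : Rh d) := by
  rw [evalP_apply, evalAt_std]

theorem evalP_injective : Function.Injective (evalP n d) := by
  intro f g h
  refine DFinsupp.ext fun v => Subtype.ext (toK_injective ?_)
  rw [← evalP_std, ← evalP_std, h]

theorem evalP_mem (f : P n d) : evalP n d f ∈ equivariant n d :=
  ⟨fun I => ⟨_, rfl⟩, fun w hw I => by
    rw [evalP_apply, substK_toK, subst_evalAt, evalP_apply]⟩

/-- The values at the standard partitions determine the function. Equivariance under the stabilizer
of such a partition says that the value there is an invariant polynomial. -/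
theorem exists_evalP_eq {F : SymPart n d → Kh d} (hF : F ∈ equivariant n d) :
    ∃ f, evalP n d f = F := by
  choose g hg using hF.1
  have hinv : ∀ v : Lam n d, g (std v) ∈ invariants v := by
    intro v w hw
    apply toK_injective
    rw [← substK_toK hw.1, hg]
    have : (std v).comp hw.1 = std v := by
      ext r : 2
      exact hw.2 r
    have h2 := hF.2 w hw.1 (std v)
    rwa [this] at h2
  have := Fintype.ofFinite (Lam n d)
  classical
  refine ⟨DFinsupp.equivFunOnFintype.symm fun v => ⟨g (std v), hinv v⟩, ?_⟩
  ext I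
  rw [evalP_apply, evalAt]
  change toK d (subst (Tuple.sort I.val) (g (std I.shape))) = _
  rw [← substK_toK (sort_mem_weyl I), hg, ← comp_sort, hF.2]

theorem exists_end_evalP (T : Module.End (Kh d) (SymPart n d → Kh d))
    (hT : ∀ F ∈ equivariant n d, T F ∈ equivariant n d) :
    ∃ S : Module.End ℂ[X] (P n d), ∀ f, evalP n d (S f) = T (evalP n d f) := by
  choose S hS using fun f => exists_evalP_eq (hT _ (evalP_mem f))
  refine ⟨⟨⟨S, fun f g => evalP_injective ?_⟩, fun c f => evalP_injective ?_⟩, hS⟩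
  · rw [hS, map_add, map_add, map_add, hS, hS]
  · simp only [RingHom.id_apply]
    rw [hS, map_smul, LinearMap.map_smul_of_tower, map_smul, hS]

end Evaluation

/-! ### Equivariance of the operators and integrality of `hOp` -/

section Equivariance

variable {n d : ℕ}

theorem ratCast_mem_range (q : ℚ) : (q : Kh d) ∈ (toK d).range :=
  ⟨MvPolynomial.C (C (q : ℂ)),
    map_ratCast ((toK d).comp ((MvPolynomial.C).comp (C : ℂ →+* ℂ[X]))) q⟩

theorem hshift_mem_range (i : Fin (2 * n)) : hshift (hK d) i ∈ (toK d).range := by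
  have h : hK d ∈ (toK d).range := ⟨_, rfl⟩
  have e : hshift (hK d) i = (((n - (i + 1)) / 2 + 1 / 4 : ℚ) : Kh d) * hK d := by
    rw [hshift]
    push_cast
    ring
  rw [e]
  exact mul_mem (ratCast_mem_range _) h

theorem spec_mem_range (i : Fin (2 * n)) (k : Fin (2 * d)) :
    spec (hK d) (xK d) i k ∈ (toK d).range :=
  sub_mem (neg_mem ⟨_, rfl⟩) (hshift_mem_range i)

theorem deltaSign_mem_range (i : Fin (2 * n)) : (deltaSign i / 4 : Kh d) ∈ (toK d).range := by
  have e : (deltaSign i / 4 : Kh d) = ((deltaSign i / 4 : ℚ) : Kh d) := by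
    rw [deltaSign, deltaSign]
    split_ifs <;> push_cast <;> ring
  rw [e]
  exact ratCast_mem_range _

section Weyl

variable {w : Equiv.Perm (Fin (2 * d))} (hw : w ∈ weyl d)

theorem substK_ratCast (q : ℚ) : substK hw (q : Kh d) = q := map_ratCast _ q

theorem substK_hshift (i : Fin (2 * n)) : substK hw (hshift (hK d) i) = hshift (hK d) i := by
  rw [hshift]
  simp only [map_add, map_mul, map_div₀, map_sub, map_natCast, map_ofNat, map_one, substK_hK]

theorem substK_spec (i : Fin (2 * n)) (k : Fin (2 * d)) :
    substK hw (spec (hK d) (xK d) i k) = spec (hK d) (xK d) i (w k) := by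
  rw [spec, map_sub, map_neg, substK_xK, substK_hshift, spec]

theorem substK_deltaSign (i : Fin (2 * n)) :
    substK hw (deltaSign i / 4 * hK d) = deltaSign i / 4 * hK d := by
  have e : (deltaSign i / 4 : Kh d) = ((deltaSign i / 4 : ℚ) : Kh d) := by
    rw [deltaSign, deltaSign]
    split_ifs <;> push_cast <;> ring
  rw [e, map_mul, substK_ratCast, substK_hK]

theorem substK_weight (I : SymPart n d) (i : Fin (2 * n)) (k : Fin (2 * d)) :
    substK hw (weight (hK d) (xK d) (I.comp hw) i k) = weight (hK d) (xK d) I i (w k) := by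
  rw [weight, weight]
  change substK hw (if I.val (w k) = i.castSucc then _ else _) = _
  rw [apply_ite (substK hw), map_zero]
  congr 1
  rw [Phi, Phi, map_prod]
  refine Finset.prod_equiv w (fun s => ?_) fun s _ => ?_
  · rw [Finset.mem_sdiff, Finset.mem_sdiff, mem_block, mem_block, Finset.mem_singleton,
      Finset.mem_singleton, w.injective.eq_iff]
    rfl
  · rw [phi, phi, map_add, map_div₀, map_sub, substK_xK, substK_xK, substK_hK, map_one]

theorem shift_comp (I : SymPart n d) (i : Fin (2 * n)) (k : Fin (2 * d)) :
    shift i k (I.comp hw) = (shift i (w k) I).comp hw := by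
  ext s : 2
  have h2 : w s = (w k).rev ↔ s = k.rev := by rw [← hw k, w.injective.eq_iff]
  simp only [shift, SymPart.comp, h2, w.injective.eq_iff]

end Weyl

theorem bOp_apply {L : Type*} [Field L] (h : L) (x : Fin (2 * d) → L) (c : L) (i : Fin (2 * n))
    (r : ℕ) (F : SymPart n d → L) (I : SymPart n d) :
    bOp h x c i r F I =
      c * ∑ k, spec h x i k ^ r * (weight h x I i k * F (shift i k I)) := by
  simp only [bOp, LinearMap.smul_apply, Pi.smul_apply, LinearMap.sum_apply, Finset.sum_apply,
    move_apply, smul_eq_mul]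

/-- The square root of `-1` in the fraction field. -/
def iK (d : ℕ) : Kh d := toK d (MvPolynomial.C (C Complex.I))

theorem iK_sq : iK d ^ 2 = -1 := by
  rw [iK, ← map_pow, ← map_pow, ← map_pow, Complex.I_sq]
  simp only [map_neg, map_one]

theorem substK_iK {w : Equiv.Perm (Fin (2 * d))} (hw : w ∈ weyl d) : substK hw (iK d) = iK d := by
  rw [iK, substK_toK]
  congr 1
  exact (subst w).commutes _

theorem substK_bOp {F : SymPart n d → Kh d} (hF : F ∈ equivariant n d) (i : Fin (2 * n)) (r : ℕ)
    {w : Equiv.Perm (Fin (2 * d))} (hw : w ∈ weyl d) (I : SymPart n d) :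
    substK hw (bOp (hK d) (xK d) (iK d) i r F (I.comp hw)) =
      bOp (hK d) (xK d) (iK d) i r F I := by
  rw [bOp_apply, bOp_apply, map_mul, map_sum, substK_iK]
  congr 1
  conv_rhs => rw [← Equiv.sum_comp w]
  refine Finset.sum_congr rfl fun k _ => ?_
  rw [map_mul, map_mul, map_pow, substK_spec, substK_weight, shift_comp, hF.2]

theorem hPow_comp {R : Type*} [CommRing R] (h δ : R) (a : Fin (2 * d) → R) (i : Fin (2 * n))
    (I : SymPart n d) {w : Equiv.Perm (Fin (2 * d))} (hw : w ∈ weyl d) :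
    hPow h δ (fun t => a (w t)) i (I.comp hw) = hPow h δ a i I := by
  rw [hPow, hPow]
  congr 1
  exact Equiv.prod_comp w fun t => if I.val t = i.castSucc then
    1 + PowerSeries.C h * PowerSeries.X * PowerSeries.mk fun k => a t ^ k
    else if I.val t = i.succ then
      1 - PowerSeries.C h * PowerSeries.X * PowerSeries.mk fun k => a t ^ k
    else 1

/-- The series `hPow` is already defined over `R[ħ]`, where its positive coefficients are multiples
of `ħ`; the division by `hK d` thus stays in the image of `toK d`. -/
theorem hOp_mem (i : Fin (2 * n)) (r : ℕ) {F : SymPart n d → Kh d} (hF : F ∈ equivariant n d) :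
    hOp (hK d) (xK d) i r F ∈ equivariant n d := by
  have key : ∀ I : SymPart n d, (hSer (hK d) (xK d) i I).coeff ((r : ℤ) + 1) =
      PowerSeries.coeff (r + 1)
        (hPow (hK d) (deltaSign i / 4 * hK d) (spec (hK d) (xK d) i) i I) := by
    intro I
    rw [hSer_eq_ofPowerSeries generic_xK, ← coeff_ofPowerSeries_natCast]
    norm_cast
  refine ⟨fun I => ?_, fun w hw I => ?_⟩
  · rw [hOp_apply, key]
    refine mul_mem ?_ (hF.1 I)
    obtain ⟨e, he⟩ := deltaSign_mem_range (d := d) i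
    choose a ha using fun k : Fin (2 * d) => spec_mem_range (d := d) i k
    obtain ⟨G, hG⟩ := hPow_eq_one_add (MvPolynomial.C X : Rh d) e a i I
    have e1 := hPow_map (toK d) (MvPolynomial.C X : Rh d) (e * MvPolynomial.C X) a i I
    rw [map_mul, he] at e1
    simp only [ha] at e1
    change _ = hPow (hK d) (_ * hK d) (spec (hK d) (xK d) i) i I at e1
    rw [← e1, PowerSeries.coeff_map, hG, map_add, mul_assoc, PowerSeries.coeff_C_mul,
      PowerSeries.coeff_succ_X_mul, PowerSeries.coeff_one, if_neg (by omega), zero_add, map_mul]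
    change hK d * _ / hK d ∈ _
    rw [mul_div_cancel_left₀ _ generic_xK.ne_zero]
    exact ⟨_, rfl⟩
  · rw [hOp_apply, hOp_apply, map_mul, map_div₀, substK_hK, hF.2, key, key,
      ← PowerSeries.coeff_map, hPow_map, substK_hK, substK_deltaSign]
    simp only [substK_spec]
    rw [hPow_comp]

end Equivariance

/-! ### Removing a simple pole by reflection invariance -/

section Localization

variable {d : ℕ}

/-- The fractions that have a denominator outside the kernel of `φ`. -/
def localAt (φ : Rh d →+* Rh d) : Subring (Kh d) where
  carrier := {G | ∃ c r, φ c ≠ 0 ∧ toK d c * G = toK d r}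
  mul_mem' := by
    rintro G G' ⟨c, r, hc, h⟩ ⟨c', r', hc', h'⟩
    exact ⟨c * c', r * r', by rw [map_mul]; exact mul_ne_zero hc hc', by
      rw [map_mul, map_mul, ← h, ← h']; ring⟩
  one_mem' := ⟨1, 1, by rw [map_one]; exact one_ne_zero, by simp⟩
  add_mem' := by
    rintro G G' ⟨c, r, hc, h⟩ ⟨c', r', hc', h'⟩
    exact ⟨c * c', r * c' + r' * c, by rw [map_mul]; exact mul_ne_zero hc hc', by
      rw [map_mul, map_add, map_mul, map_mul, ← h, ← h']; ring⟩
  zero_mem' := ⟨1, 0, by rw [map_one]; exact one_ne_zero, by simp⟩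
  neg_mem' := by
    rintro G ⟨c, r, hc, h⟩
    exact ⟨c, -r, hc, by rw [map_neg, ← h]; ring⟩

theorem range_le_localAt (φ : Rh d →+* Rh d) {G : Kh d} (h : G ∈ (toK d).range) :
    G ∈ localAt φ := by
  obtain ⟨r, rfl⟩ := h
  exact ⟨1, r, by rw [map_one]; exact one_ne_zero, by simp⟩

theorem inv_mem_localAt {φ : Rh d →+* Rh d} {c : Rh d} (hc : φ c ≠ 0) :
    (toK d c)⁻¹ ∈ localAt φ := by
  refine ⟨c, 1, hc, ?_⟩
  rw [map_one, mul_inv_cancel₀]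
  rw [Ne, map_eq_zero_iff _ toK_injective]
  rintro rfl
  exact hc (map_zero φ)

/-- From `c r = α r'` the map `φ`, which represents reduction modulo `α`, gives `φ c · φ r = 0`.
Hence `φ r = 0`, so `α` divides `r`. -/
theorem mem_range_of_mem_localAt {φ : Rh d →+* Rh d} {α : Rh d} (h0 : α ≠ 0) (hα : φ α = 0)
    (hφ : ∀ p, α ∣ p - φ p) {G : Kh d} (h1 : toK d α * G ∈ (toK d).range) (h2 : G ∈ localAt φ) :
    G ∈ (toK d).range := by
  obtain ⟨r, hr⟩ := h1
  obtain ⟨c, r', hc, h⟩ := h2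
  have e : c * r = α * r' := by
    apply toK_injective
    rw [map_mul, map_mul, hr, ← h]
    ring
  have e2 : φ r = 0 := by
    have := congrArg φ e
    rw [map_mul, map_mul, hα, zero_mul] at this
    exact (mul_eq_zero.1 this).resolve_left hc
  have e3 := hφ r
  rw [e2, sub_zero] at e3
  obtain ⟨q, rfl⟩ := e3
  refine ⟨q, mul_left_cancel₀ ((map_ne_zero_iff _ toK_injective).2 h0) ?_⟩
  rw [← map_mul, hr]

/-- If `α G = r / c`, the reflection gives `-α G = σr / σc`. Subtracting, `2 α G = (r · σc - c · σr)
/ (c · σc)`, whose numerator is antisymmetric and divisible by `α`. The new denominator stays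
outside the kernel of `φ`, since `σ` is trivial modulo `α`. -/
theorem mem_localAt_of_reflection {φ : Rh d →+* Rh d} {α : Rh d} (h0 : α ≠ 0) (hα : φ α = 0)
    {σ : Equiv.Perm (Fin (2 * d))} (hσ : σ ∈ weyl d) (hs : ∀ p, α ∣ p - subst σ p)
    (hn : subst σ α = -α) {G : Kh d} (h1 : toK d α * G ∈ localAt φ) (h2 : substK hσ G = G) :
    G ∈ localAt φ := by
  obtain ⟨c, r, hc, h⟩ := h1
  have e1 : toK d (subst σ c) * (-toK d α * G) = toK d (subst σ r) := by
    rw [← substK_toK hσ r, ← h, map_mul, map_mul, substK_toK, substK_toK, h2, hn, map_neg]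
  have e2 : φ (subst σ c) = φ c := by
    obtain ⟨q, hq⟩ := hs c
    have := congrArg φ hq
    rw [map_sub, map_mul, hα, zero_mul, sub_eq_zero] at this
    exact this.symm
  obtain ⟨q, hq⟩ : α ∣ r * subst σ c - c * subst σ r := by
    have : r * subst σ c - c * subst σ r =
        subst σ c * (r - subst σ r) - subst σ r * (c - subst σ c) := by ring
    rw [this]
    exact dvd_sub (dvd_mul_of_dvd_right (hs r) _) (dvd_mul_of_dvd_right (hs c) _)
  refine ⟨2 * (c * subst σ c), q, ?_, ?_⟩
  · rw [map_mul, map_mul, e2, map_ofNat]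
    exact mul_ne_zero two_ne_zero (mul_ne_zero hc hc)
  · apply mul_left_cancel₀ ((map_ne_zero_iff _ toK_injective).2 h0)
    rw [← map_mul _ α q, ← hq, map_sub, map_mul, map_mul, map_mul, map_mul, map_ofNat, ← h, ← e1]
    ring

theorem mem_range_of_prod_mul_mem {ι : Type*} [DecidableEq ι] (T : Finset ι) (α : ι → Rh d)
    {G : Kh d}
    (hT : ∀ t ∈ T, α t ≠ 0 ∧ ∃ φ : Rh d →+* Rh d, φ (α t) = 0 ∧ (∀ p, α t ∣ p - φ p) ∧
      G ∈ localAt φ)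
    (h : toK d (∏ t ∈ T, α t) * G ∈ (toK d).range) : G ∈ (toK d).range := by
  induction T using Finset.induction_on with
  | empty => simpa using h
  | insert t T ht ih =>
    refine ih (fun s hs => hT s (Finset.mem_insert_of_mem hs)) ?_
    obtain ⟨h0, φ, h1, h2, h3⟩ := hT t (Finset.mem_insert_self t T)
    refine mem_range_of_mem_localAt h0 h1 h2 ?_ (mul_mem (range_le_localAt φ ⟨_, rfl⟩) h3)
    rwa [Finset.prod_insert ht, map_mul, mul_assoc] at h

end Localization

/-! ### Reflections in the roots `x_a - x_b` and restriction to their hyperplanes -/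

section Reflection

variable {d : ℕ} (a b : Fin (2 * d))

/-- The underlying map of the reflection in the root `x_a - x_b`. -/
def reflFun (s : Fin (2 * d)) : Fin (2 * d) :=
  if s = a then b else if s = b then a else if s = a.rev then b.rev else
    if s = b.rev then a.rev else s

/-- A family that represents the `x_s` modulo `x_a - x_b`. -/
def foldVar (s : Fin (2 * d)) : Rh d :=
  if s = a then (if b = a.rev then 0 else xvar b) else
    if s = a.rev then -(if b = a.rev then 0 else xvar b) else xvar s

theorem xvar_ne_zero (s : Fin (2 * d)) : (xvar s : Rh d) ≠ 0 := by
  intro h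
  have := generic_xK.apply_ne_zero s
  rw [xK, h, map_zero] at this
  exact this rfl

variable {a b}

theorem reflFun_reflFun (s : Fin (2 * d)) : reflFun a b (reflFun a b s) = s := by
  have h1 := rev_ne_self a
  have h2 := rev_ne_self b
  have h3 := Fin.rev_rev a
  have h4 := Fin.rev_rev b
  unfold reflFun
  grind

theorem reflFun_rev (s : Fin (2 * d)) : reflFun a b s.rev = (reflFun a b s).rev := by
  have h1 := rev_ne_self a
  have h2 := rev_ne_self b
  have h3 := Fin.rev_rev a
  have h4 := Fin.rev_rev b
  have h5 := Fin.rev_rev s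
  unfold reflFun
  grind

theorem xvar_reflFun (s : Fin (2 * d)) :
    (xvar (reflFun a b s) - xvar s : Rh d) = xvar a - xvar b ∨
      (xvar (reflFun a b s) - xvar s : Rh d) = -(xvar a - xvar b) ∨ reflFun a b s = s := by
  have h1 := xvar_rev a
  have h2 := xvar_rev b
  unfold reflFun
  grind

theorem foldVar_rev (s : Fin (2 * d)) : foldVar a b s.rev = -foldVar a b s := by
  have h1 := rev_ne_self a
  have h3 := Fin.rev_rev a
  have h5 := Fin.rev_rev s
  have h6 := xvar_rev s
  unfold foldVar
  grind

/-- Two distinct letters can have equal values on the hyperplane `x_a = x_b` only if the reflection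
exchanges them. When `b = a'` the root is `2 x_a`, so `x_a` and `x_{a'}` both become zero. -/
theorem foldVar_eq {s k : Fin (2 * d)} (hsk : s ≠ k) (h : foldVar a b s = foldVar a b k) :
    s = reflFun a b k := by
  have h1 := rev_ne_self a
  have h2 := rev_ne_self b
  have h3 := Fin.rev_rev a
  have h4 := Fin.rev_rev b
  have h5 := xvar_ne_zero s
  have h6 := xvar_ne_zero k
  have h7 := xvar_ne_zero b
  have h8 := xvar_rev b
  have h9 : ∀ u v : Fin (2 * d), (xvar u : Rh d) = xvar v → u = v := fun u v h => xvar_injective h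
  have h10 : ∀ p : Rh d, p = -p → p = 0 := fun p hp => self_eq_neg.1 hp
  have h11 := h9 s k
  have h12 := h9 s b
  have h13 := h9 s b.rev
  have h14 := h9 b k
  have h15 := h9 b.rev k
  have h16 := h10 (xvar b)
  unfold foldVar at h
  unfold reflFun
  clear h9 h10
  split_ifs at h <;> grind

end Reflection

/-! ### Integrality of `bOp` -/

section Integrality

variable {n d : ℕ}

/-- The reflection in the root `x_a - x_b`. -/
def reflPerm (a b : Fin (2 * d)) : Equiv.Perm (Fin (2 * d)) :=
  Function.Involutive.toPerm (reflFun a b) reflFun_reflFun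

theorem reflPerm_apply (a b s : Fin (2 * d)) : reflPerm a b s = reflFun a b s := rfl

theorem reflPerm_mem (a b : Fin (2 * d)) : reflPerm a b ∈ weyl d := reflFun_rev

theorem comp_reflPerm {a b : Fin (2 * d)} {I : SymPart n d} (h : I.val a = I.val b) :
    I.comp (reflPerm_mem a b) = I := by
  have h1 := I.symm a
  have h2 := I.symm b
  ext s : 2
  change I.val (reflFun a b s) = I.val s
  unfold reflFun
  grind

theorem subst_reflPerm_sub {a b : Fin (2 * d)} :
    subst (reflPerm a b) (xvar a - xvar b) = -(xvar a - xvar b) := by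
  have h1 : reflFun a b a = b := if_pos rfl
  have h2 : reflFun a b b = a := by
    unfold reflFun
    grind
  rw [map_sub, subst_xvar (reflPerm_mem a b), subst_xvar (reflPerm_mem a b), reflPerm_apply,
    reflPerm_apply, h1, h2, neg_sub]

theorem oddSubst_xvar_eq (p : Rh d) : oddSubst xvar p = p := by
  have := subst_one p
  rwa [subst_eq_oddSubst] at this

theorem dvd_sub_subst_reflPerm (a b : Fin (2 * d)) (p : Rh d) :
    (xvar a - xvar b : Rh d) ∣ p - subst (reflPerm a b) p := by
  have key := dvd_oddSubst_sub (y := xvar) (z := fun s => xvar (reflPerm a b s))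
    (α := xvar a - xvar b) (fun s => ?_) p
  · rwa [oddSubst_xvar_eq, ← subst_eq_oddSubst] at key
  · rw [reflPerm_apply]
    rcases xvar_reflFun (a := a) (b := b) s with h | h | h
    · exact ⟨-1, by linear_combination -h⟩
    · exact ⟨1, by linear_combination -h⟩
    · rw [h, sub_self]
      exact dvd_zero _

theorem dvd_sub_oddSubst_foldVar (a b : Fin (2 * d)) (p : Rh d) :
    (xvar a - xvar b : Rh d) ∣ p - oddSubst (foldVar a b) p := by
  have key := dvd_oddSubst_sub (y := xvar) (z := foldVar a b) (α := xvar a - xvar b)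
    (fun s => ?_) p
  · rwa [oddSubst_xvar_eq] at key
  · have h : (xvar a - xvar b : Rh d) ∣ xvar a - if b = a.rev then 0 else xvar b := by
      split_ifs with hb
      · refine ⟨MvPolynomial.C (C (1 / 2)), ?_⟩
        have e : (2 : Rh d) * MvPolynomial.C (C (1 / 2 : ℂ)) = 1 := by
          rw [← map_ofNat (MvPolynomial.C : ℂ[X] →+* Rh d) 2, ← map_ofNat (C : ℂ →+* ℂ[X]) 2,
            ← map_mul, ← map_mul]
          norm_num
        rw [hb, xvar_rev]
        linear_combination -(xvar a : Rh d) * e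
      · exact dvd_rfl
    unfold foldVar
    by_cases h1 : s = a
    · rw [if_pos h1, h1]
      exact h
    by_cases h2 : s = a.rev
    · rw [if_neg h1, if_pos h2, h2, xvar_rev]
      obtain ⟨q, hq⟩ := h
      exact ⟨-q, by linear_combination -hq⟩
    · rw [if_neg h1, if_neg h2, sub_self]
      exact dvd_zero _

theorem oddSubst_foldVar_sub {a b : Fin (2 * d)} (hab : a ≠ b) :
    oddSubst (foldVar a b) (xvar a - xvar b) = 0 := by
  have h1 := xvar_rev a
  rw [map_sub, oddSubst_xvar foldVar_rev, oddSubst_xvar foldVar_rev]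
  unfold foldVar
  grind

variable {I : SymPart n d} {i : Fin (2 * n)}

theorem weight_eq_prod {k : Fin (2 * d)} (hk : I.val k = i.castSucc) :
    weight (hK d) (xK d) I i k =
      ∏ s ∈ (I.block i.castSucc).erase k, (1 + hK d / toK d (xvar s - xvar k)) := by
  rw [weight_of_eq hk, Phi, Finset.sdiff_singleton_eq_erase]
  simp only [phi, map_sub]
  rfl

theorem hK_mem_range : hK d ∈ (toK d).range := ⟨_, rfl⟩

theorem toK_sub_ne_zero {s k : Fin (2 * d)} (h : s ≠ k) : toK d (xvar s - xvar k) ≠ 0 := by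
  rw [map_sub]
  exact generic_xK.sub_ne_zero h

/-- The denominators of the weight are among the differences of distinct letters of the block. The
product over ordered pairs repeats roots, which is harmless for a common denominator. -/
theorem prod_mul_weight_mem_range {k : Fin (2 * d)} :
    toK d (∏ p ∈ (I.block i.castSucc).offDiag, (xvar p.1 - xvar p.2)) *
      weight (hK d) (xK d) I i k ∈ (toK d).range := by
  by_cases hk : I.val k = i.castSucc
  swap
  · rw [weight_of_ne hk, mul_zero]
    exact zero_mem _
  have hsub : ((I.block i.castSucc).erase k).image (fun s => (s, k)) ⊆
      (I.block i.castSucc).offDiag := by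
    intro p hp
    obtain ⟨s, hs, rfl⟩ := Finset.mem_image.1 hp
    rw [Finset.mem_erase] at hs
    exact Finset.mem_offDiag.2 ⟨hs.2, (mem_block _ _ _).2 hk, hs.1⟩
  obtain ⟨q, hq⟩ := Finset.prod_dvd_prod_of_subset _ _ (fun p => (xvar p.1 - xvar p.2 : Rh d)) hsub
  rw [Finset.prod_image (by simp)] at hq
  rw [hq, weight_eq_prod hk, map_mul, mul_right_comm, map_prod, ← Finset.prod_mul_distrib]
  refine mul_mem (prod_mem fun s hs => ?_) ⟨_, rfl⟩
  have := toK_sub_ne_zero (Finset.ne_of_mem_erase hs)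
  rw [mul_add, mul_one, mul_div_cancel₀ _ this]
  exact add_mem ⟨_, rfl⟩ hK_mem_range

/-- At most one factor of the weight is singular on the hyperplane, that of the letter exchanged
with `k`; its denominator is `±(x_a - x_b)`. So the pole is at most simple. -/
theorem sub_mul_weight_mem_localAt {a b : Fin (2 * d)} {k : Fin (2 * d)} :
    toK d (xvar a - xvar b) * weight (hK d) (xK d) I i k ∈
      localAt (oddSubst (foldVar a b) : Rh d →+* Rh d) := by
  by_cases hk : I.val k = i.castSucc
  swap
  · rw [weight_of_ne hk, mul_zero]
    exact zero_mem _
  have hgood : ∀ s ≠ k, s ≠ reflFun a b k → 1 + hK d / toK d (xvar s - xvar k) ∈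
      localAt (oddSubst (foldVar a b) : Rh d →+* Rh d) := by
    intro s hs1 hs2
    rw [div_eq_mul_inv]
    refine add_mem (one_mem _) (mul_mem (range_le_localAt _ hK_mem_range) (inv_mem_localAt ?_))
    rw [RingHom.coe_coe, map_sub, oddSubst_xvar foldVar_rev, oddSubst_xvar foldVar_rev,
      sub_ne_zero]
    exact fun h => hs2 (foldVar_eq hs1 h)
  rw [weight_eq_prod hk]
  by_cases hr : reflFun a b k ∈ (I.block i.castSucc).erase k
  · rw [← Finset.mul_prod_erase _ _ hr, ← mul_assoc]
    refine mul_mem (range_le_localAt _ ?_) (prod_mem fun s hs => ?_)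
    · have hne := toK_sub_ne_zero (Finset.ne_of_mem_erase hr)
      rcases xvar_reflFun (a := a) (b := b) k with h | h | h
      · rw [h] at hne ⊢
        rw [mul_add, mul_one, mul_div_cancel₀ _ hne]
        exact add_mem ⟨_, rfl⟩ hK_mem_range
      · rw [h, map_neg] at hne
        have e : ∀ t : Kh d, -t ≠ 0 → t * (1 + hK d / -t) = t - hK d := by
          intro t ht
          have := neg_ne_zero.1 ht
          field_simp
          ring
        rw [h, map_neg, e _ hne]
        exact sub_mem ⟨_, rfl⟩ hK_mem_range
      · exact absurd h (Finset.ne_of_mem_erase hr)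
    · rw [Finset.mem_erase, Finset.mem_erase] at hs
      exact hgood s hs.2.1 hs.1
  · refine mul_mem (range_le_localAt _ ⟨_, rfl⟩) (prod_mem fun s hs => hgood s ?_ ?_)
    · exact Finset.ne_of_mem_erase hs
    · rintro rfl
      exact hr hs

/-- The reflection in `x_a - x_b` preserves `I`, because `a` and `b` lie in one block. It permutes
the summands and fixes their sum, so each simple pole disappears from the sum though not from the
summands. -/
theorem bOp_mem (i : Fin (2 * n)) (r : ℕ) {F : SymPart n d → Kh d} (hF : F ∈ equivariant n d) :
    bOp (hK d) (xK d) (iK d) i r F ∈ equivariant n d := by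
  refine ⟨fun I => ?_, fun w hw I => substK_bOp hF i r hw I⟩
  -- Used twice: with `A` the polynomials and `g` the common denominator, and with `A` the local
  -- ring at one hyperplane and `g` a single root.
  have hmul : ∀ (A : Subring (Kh d)) (g : Kh d), (∀ p, toK d p ∈ A) →
      (∀ k, g * weight (hK d) (xK d) I i k ∈ A) →
      g * bOp (hK d) (xK d) (iK d) i r F I ∈ A := by
    intro A g hA hg
    have hA' : ∀ {G}, G ∈ (toK d).range → G ∈ A := by
      rintro _ ⟨p, rfl⟩
      exact hA p
    rw [bOp_apply, mul_left_comm, Finset.mul_sum]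
    refine mul_mem (hA _) (sum_mem fun k _ => ?_)
    rw [mul_left_comm, ← mul_assoc g]
    exact mul_mem (pow_mem (hA' (spec_mem_range i k)) r) (mul_mem (hg k) (hA' (hF.1 _)))
  refine mem_range_of_prod_mul_mem (I.block i.castSucc).offDiag
    (fun p => (xvar p.1 - xvar p.2 : Rh d)) (fun p hp => ?_)
    (hmul _ _ (fun p => ⟨p, rfl⟩) fun k => prod_mul_weight_mem_range)
  obtain ⟨a, b⟩ := p
  obtain ⟨ha, hb, hab⟩ := Finset.mem_offDiag.1 hp
  simp only at ha hb hab ⊢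
  have h0 : (xvar a - xvar b : Rh d) ≠ 0 := sub_ne_zero.2 fun h => hab (xvar_injective h)
  refine ⟨h0, oddSubst (foldVar a b), oddSubst_foldVar_sub hab, dvd_sub_oddSubst_foldVar a b, ?_⟩
  refine mem_localAt_of_reflection h0 (oddSubst_foldVar_sub hab) (reflPerm_mem a b)
    (dvd_sub_subst_reflPerm a b) subst_reflPerm_sub
    (hmul _ _ (fun p => range_le_localAt _ ⟨p, rfl⟩) fun k => sub_mul_weight_mem_localAt) ?_
  have hI := comp_reflPerm (a := a) (b := b) (I := I)
    (((mem_block _ _ _).1 ha).trans ((mem_block _ _ _).1 hb).symm)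
  conv_lhs => rw [← hI]
  exact substK_bOp hF i r (reflPerm_mem a b) I

end Integrality

/-! ### The representation of the free algebra and its factorization through the relations -/

section Representation

variable {n d : ℕ}

theorem map_comm {A B F : Type*} [Ring A] [Ring B] [FunLike F A B] [RingHomClass F A B] (f : F)
    (x y : A) : f (comm x y) = comm (f x) (f y) := by
  rw [comm, comm, map_sub, map_mul, map_mul]

theorem map_anti {A B F : Type*} [Ring A] [Ring B] [FunLike F A B] [RingHomClass F A B] (f : F)
    (x y : A) : f (anti x y) = anti (f x) (f y) := by
  rw [anti, anti, map_add, map_mul, map_mul]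

theorem map_sym {A B F : Type*} [Ring A] [Ring B] [FunLike F A B] [RingHomClass F A B] (f : F)
    (G : ℕ → ℕ → A) (k l : ℕ) : f (sym G k l) = sym (fun k l => f (G k l)) k l := by
  rw [sym, sym, map_add]

/-- The scalars `ℂ[ħ]` in the fraction field. -/
def scalarK (d : ℕ) : ℂ[X] →+* Kh d := algebraMap ℂ[X] (Kh d)

theorem scalarK_X : scalarK d X = hK d := rfl

theorem scalarK_cartan (i j : Fin (2 * n)) : scalarK d (C (cartan i j)) = cart (Kh d) i j :=
  map_intCast ((scalarK d).comp C) _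

theorem scalarK_C_div (a b : ℂ) : scalarK d (C (a / b)) = scalarK d (C a) / scalarK d (C b) :=
  map_div₀ ((scalarK d).comp C) a b

theorem scalarK_C_inv (a : ℂ) : scalarK d (C a⁻¹) = (scalarK d (C a))⁻¹ :=
  map_inv₀ ((scalarK d).comp C) a

theorem scalarK_smul (c : ℂ[X]) (T : Module.End (Kh d) (SymPart n d → Kh d)) :
    c • T = scalarK d c • T :=
  (algebraMap_smul (Kh d) c T).symm

/-- The action of the generators on functions of partitions. -/
def genOp (n d : ℕ) : Gen n → Module.End (Kh d) (SymPart n d → Kh d)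
  | .b i r => bOp (hK d) (xK d) (iK d) i r
  | .h i r => hOp (hK d) (xK d) i r

theorem genOp_mem (g : Gen n) {F : SymPart n d → Kh d} (hF : F ∈ equivariant n d) :
    genOp n d g F ∈ equivariant n d := by
  cases g with
  | b i r => exact bOp_mem i r hF
  | h i r => exact hOp_mem i r hF

/-- The action of the free algebra on functions of partitions. -/
def freeRep (n d : ℕ) : Free n →ₐ[ℂ[X]] Module.End (Kh d) (SymPart n d → Kh d) :=
  FreeAlgebra.lift ℂ[X] (genOp n d)

theorem freeRep_fb (i : Fin (2 * n)) (r : ℕ) :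
    freeRep n d (fb i r) = bOp (hK d) (xK d) (iK d) i r := by
  rw [freeRep, fb, FreeAlgebra.lift_ι_apply, genOp]

theorem freeRep_fh (i : Fin (2 * n)) (r : ℕ) :
    freeRep n d (fh i r) = hOp (hK d) (xK d) i r := by
  rw [freeRep, fh, FreeAlgebra.lift_ι_apply, genOp]

theorem adjacent_of_cartan {i j : Fin (2 * n)} (h : cartan i j = -1) :
    (i : ℕ) + 1 = j ∨ (j : ℕ) + 1 = i := by
  by_contra hc
  rw [not_or] at hc
  have h2 : cart ℂ i j = -1 := h
  by_cases hij : i = j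
  · rw [hij, cart_self] at h2
    norm_num at h2
  · rw [cart_of_ne hij hc.1 hc.2] at h2
    norm_num at h2

theorem freeRep_eq_of_rel {a b : Free n} (hab : Rel n a b) : freeRep n d a = freeRep n d b := by
  have hx := generic_xK (d := d)
  induction hab with
  | hh i j r s => rw [map_comm, freeRep_fh, freeRep_fh, comm_hOp_hOp, map_zero]
  | h_tau i => rw [map_neg, freeRep_fh, freeRep_fh, hOp_rev_zero hx]
  | h_zero_b i j r =>
    rw [map_comm, map_smul, freeRep_fh, freeRep_fb, comm_hOp_zero_bOp hx, scalarK_smul, map_sub,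
      map_sub, scalarK_cartan, scalarK_cartan]
  | h_one_b i j r =>
    rw [map_comm, map_add, map_smul, map_smul, map_anti, freeRep_fh, freeRep_fh, freeRep_fb,
      freeRep_fb, comm_hOp_one_bOp hx, scalarK_smul, scalarK_smul]
    simp only [map_mul, scalarK_C_div, map_sub, map_add, scalarK_cartan, scalarK_X, map_ofNat]
  | h_b i j r s =>
    simp only [map_comm, map_anti, map_add, map_sub, map_smul, freeRep_fh, freeRep_fb]
    rw [comm_hOp_bOp hx, scalarK_smul, scalarK_smul, scalarK_smul]
    simp only [map_mul, map_pow, scalarK_C_div, map_sub, map_add, scalarK_cartan, scalarK_X,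
      map_ofNat]
  | b_b i j r s =>
    simp only [map_comm, map_anti, map_sub, map_smul, freeRep_fb]
    rw [bOp_bOp hx iK_sq, scalarK_smul, apply_ite (freeRep n d), map_zero, map_smul, freeRep_fh,
      scalarK_smul]
    simp only [map_mul, map_pow, scalarK_C_div, scalarK_cartan, scalarK_X, map_ofNat, map_neg,
      map_one]
  | serre_zero i j r s hc =>
    have h0 : cart (Kh d) i j = 0 := by rw [← scalarK_cartan, hc, map_zero, map_zero]
    rw [map_comm, freeRep_fb, freeRep_fb, comm_bOp_bOp_of_cart_eq_zero hx iK_sq h0,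
      apply_ite (freeRep n d), map_zero, map_smul, freeRep_fh, scalarK_smul, map_pow, map_neg,
      map_one]
  | serre_neg_one i j k₁ k₂ r hc hj =>
    rw [map_sym, map_zero]
    simp only [map_comm, freeRep_fb]
    exact sym_comm_bOp_eq_zero hx _ (adjacent_of_cartan hc) hj _ _ _
  | serre_tau i k₁ k₂ r hc =>
    rw [map_sym, map_smul, map_sym]
    simp only [map_comm, map_smul, map_sum, freeRep_fb, freeRep_fh]
    rw [sym_comm_bOp_rev hx iK_sq (adjacent_of_cartan hc), scalarK_smul]
    simp only [scalarK_smul, scalarK_C_div, scalarK_C_inv, map_pow, map_neg, map_one, map_ofNat]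

end Representation

/-! ### Comparison with the defining formulas on `P` -/

section Main

variable {n d : ℕ}

theorem bOp_evalP_std (i : Fin (2 * n)) (r : ℕ) (f : P n d) (v : Lam n d) :
    bOp (hK d) (xK d) (iK d) i r (evalP n d f) (std v) = bFormula i r f v := by
  rw [bOp_apply, bFormula, iK]
  congr 1
  rw [SymPart.block, Finset.sum_filter]
  refine Finset.sum_congr rfl fun k _ => ?_
  rw [weight]
  split_ifs with hk
  · rw [← mul_assoc]
    rfl
  · rw [zero_mul, mul_zero]

theorem hOp_evalP_std (i : Fin (2 * n)) (r : ℕ) (f : P n d) (v : Lam n d) :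
    hOp (hK d) (xK d) i r (evalP n d f) (std v) = hCoeff i r v * toK d (f v : Rh d) := by
  rw [hOp_apply, evalP_std]
  rfl

theorem evalP_lift {A : Gen n → Module.End ℂ[X] (P n d)}
    (hA : ∀ g f, evalP n d (A g f) = genOp n d g (evalP n d f)) (a : Free n) (f : P n d) :
    evalP n d (FreeAlgebra.lift ℂ[X] A a f) = freeRep n d a (evalP n d f) := by
  induction a using FreeAlgebra.induction generalizing f with
  | grade0 c =>
    rw [AlgHom.commutes, AlgHom.commutes, Module.algebraMap_end_apply, map_smul,
      Algebra.algebraMap_eq_smul_one, LinearMap.smul_apply, Module.End.one_apply]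
  | grade1 g => rw [freeRep, FreeAlgebra.lift_ι_apply, FreeAlgebra.lift_ι_apply, hA]
  | mul a b ha hb => rw [map_mul, map_mul, Module.End.mul_apply, Module.End.mul_apply, ha, hb]
  | add a b ha hb =>
    rw [map_add, map_add, LinearMap.add_apply, LinearMap.add_apply, map_add, ha, hb]

end Main

end TwistedYangian

end

theorem theorem4p2 (n d : ℕ) (hn : 0 < n) (hd : 0 < d) :
    ∃ B H : Fin (2 * n) → ℕ → Module.End (Polynomial ℂ) (TwistedYangian.P n d),
      (∀ i r, TwistedYangian.IsB i r (B i r)) ∧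
      (∀ i r, TwistedYangian.IsH i r (H i r)) ∧
      ∃! ρ : TwistedYangian.Y n →ₐ[Polynomial ℂ]
          Module.End (Polynomial ℂ) (TwistedYangian.P n d),
        ∀ (i : Fin (2 * n)) (r : ℕ),
          ρ (TwistedYangian.Y.b i r) = B i r ∧ ρ (TwistedYangian.Y.h i r) = H i r := by
  choose A hA using fun g : TwistedYangian.Gen n =>
    TwistedYangian.exists_end_evalP (TwistedYangian.genOp n d g) fun F hF =>
      TwistedYangian.genOp_mem g hF
  refine ⟨fun i r => A (.b i r), fun i r => A (.h i r), fun i r f v => ?_, fun i r f v => ?_, ?_⟩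
  · rw [← TwistedYangian.evalP_std, hA]
    exact TwistedYangian.bOp_evalP_std i r f v
  · rw [← TwistedYangian.evalP_std, hA]
    exact TwistedYangian.hOp_evalP_std i r f v
  -- Since `evalP` is injective and intertwines the two actions of the free algebra, a relation that
  -- holds on functions of partitions holds on `P`.
  have hrel : ∀ ⦃a b⦄, TwistedYangian.Rel n a b →
      FreeAlgebra.lift (Polynomial ℂ) A a = FreeAlgebra.lift (Polynomial ℂ) A b := by
    intro a b hab
    ext1 f
    apply TwistedYangian.evalP_injective
    rw [TwistedYangian.evalP_lift hA, TwistedYangian.evalP_lift hA,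
      TwistedYangian.freeRep_eq_of_rel hab]
  refine ⟨RingQuot.liftAlgHom (Polynomial ℂ) ⟨FreeAlgebra.lift (Polynomial ℂ) A, hrel⟩,
    fun i r => ⟨?_, ?_⟩, fun ρ hρ => ?_⟩
  · rw [TwistedYangian.Y.b, RingQuot.liftAlgHom_mkAlgHom_apply, TwistedYangian.fb,
      FreeAlgebra.lift_ι_apply]
  · rw [TwistedYangian.Y.h, RingQuot.liftAlgHom_mkAlgHom_apply, TwistedYangian.fh,
      FreeAlgebra.lift_ι_apply]
  · apply RingQuot.ringQuot_ext'
    apply FreeAlgebra.hom_ext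
    funext g
    simp only [Function.comp_apply, AlgHom.comp_apply, RingQuot.liftAlgHom_mkAlgHom_apply,
      FreeAlgebra.lift_ι_apply]
    cases g with
    | b i r => exact (hρ i r).1
    | h i r => exact (hρ i r).2
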